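/- For each $n$ let $\mathbb{G}_n$ be a simple graph on $\{1,\dots,n\}$ with adjacency matrix $\mathbf{G}_n$, degrees $d_1,\dots,d_n$ and average degree $\overline d=\frac1n\sum_{i=1}^n d_i$. Put $\mathbf{Q}=\mathbf{G}_n/\overline d$, let $\lambda_1(\mathbf Q)\ge\dots\ge\lambda_n(\mathbf Q)$ be its eigenvalues, and let $\alpha_n=\sqrt{\log n/\overline d}$. For fixed $\beta\in\mathbb{R}$ let $\mathbf{X}\in\{-1,1\}^n$ have the Ising law $\mathbb{P}_{\beta,\mathbf{Q},\mathbf{0}}(\mathbf{X}=\mathbf{x})\propto\exp\big(\tfrac{\beta}{2}\mathbf{x}^\top\mathbf{Q}\mathbf{x}\big)$, and write $\bar{\mathbf X}=\frac1n\sum_i X_i$. Here $a_n\ll b_n$ means $a_n/b_n\to0$, and $a_n\lesssim b_n$ means $\limsup a_n/b_n<\infty$. Assume $\max_{i\in[n]}|d_i/\overline d-1|\to0$, fix $c>0$, and let $s=s_n$ be any sequence of nonnegative integers with $s\le c\log n$ for all large $n$. (a) If $0\le\beta<1$ and $\overline d\gg(\log n)^4$, then $$\lim_{n\to\infty}\ \sup_{S\subseteq[n]:|S|=s,\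 \mathbf a\in\{-1,1\}^s}\left|\frac{\mathbb{P}_{\beta,\mathbf{Q},\mathbf{0}}(\mathbf{X}_S=\mathbf a)}{2^{-s}}-1\right|=0 .$$ (b) If $\beta=1$, $\max_{i\in[n]}|d_i/\overline d-1|\lesssim\alpha_n$ and $\overline d\gg(\log n)^{10}$, then the conclusion of (a) holds. (c) Suppose $\beta>1$, $\max_{i\in[n]}|d_i/\overline d-1|\lesssim\alpha_n$, $\overline d\gg(\log n)^4$, and that either (i) $\overline d\gg\sqrt{n\log n}$ and $\limsup_{n\to\infty}\lambda_2(\mathbf Q)<1$, or (ii) $\overline d\ge n^\gamma$ for some $\gamma>0$ and all large $n$, and $\max_{2\le i\le n}|\lambda_i(\mathbf Q)|\to0$. Let $t>0$ be the positive root of $t=\tanh(\beta t)$. Then $$\lim_{n\to\infty}\ \sup_{S\subseteq[n]:|S|=s,\ \mathbf a\in\{-1,1\}^s}\left|\frac{\mathbb{P}_{\beta,\mathbf{Q},\mathbf{0}}(\mathbf{X}_S=\mathbf a\mid\bar{\mathbf X}\ge0)}{g(\mathbf a,s)}-1\right|=0,\qquad g(\mathbf a,s)=\frac{\exp(\beta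 t\sum_{i=1}^s a_i)}{\sum_{\mathbf b\in\{-1,1\}^s}\exp(\beta t\sum_{i=1}^s b_i)} .$$ -/

import Mathlib

open Filter Topology Asymptotics

/-- A spin configuration on `ι`: an element of `{-1, 1}^ι`. -/
abbrev Spins (ι : Type*) : Type _ := ι → ℤˣ

/-- The real value `±1` of a spin. -/
def spin (u : ℤˣ) : ℝ := ((u : ℤ) : ℝ)

/-- The unnormalised Ising weight `exp ((β / 2) xᵀ Q x + μᵀ x)`. -/
noncomputable def isingWeight {n : ℕ} (β : ℝ) (Q : Matrix (Fin n) (Fin n) ℝ) (μ : Fin n → ℝ)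
    (x : Spins (Fin n)) : ℝ :=
  Real.exp (β / 2 * (∑ i, ∑ j, Q i j * spin (x i) * spin (x j)) + ∑ i, μ i * spin (x i))

/-- The normalising constant `Z_n(β, Q, μ)`. -/
noncomputable def isingZ {n : ℕ} (β : ℝ) (Q : Matrix (Fin n) (Fin n) ℝ) (μ : Fin n → ℝ) : ℝ :=
  ∑ x : Spins (Fin n), isingWeight β Q μ x

/-- The probability `P_{β,Q,μ}(X ∈ A)` of an event `A` under the Ising model. -/
noncomputable def isingProb {n : ℕ} (β : ℝ) (Q : Matrix (Fin n) (Fin n) ℝ) (μ : Fin n → ℝ)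
    (A : Set (Spins (Fin n))) : ℝ :=
  ∑ x : Spins (Fin n), A.indicator (fun y => isingWeight β Q μ y / isingZ β Q μ) x

/-- The conditional probability `P_{β,Q,μ}(X ∈ A | X ∈ B)`. -/
noncomputable def isingCondProb {n : ℕ} (β : ℝ) (Q : Matrix (Fin n) (Fin n) ℝ) (μ : Fin n → ℝ)
    (A B : Set (Spins (Fin n))) : ℝ :=
  isingProb β Q μ (A ∩ B) / isingProb β Q μ B

/-- The event `X_S = a`. -/
def eqOnEvent {n : ℕ} (S : Finset (Fin n)) (a : Spins S) : Set (Spins (Fin n)) :=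
  {x | ∀ i : S, x i = a i}

/-- The event that the average spin is nonnegative. -/
def nonnegMeanEvent (n : ℕ) : Set (Spins (Fin n)) :=
  {x | 0 ≤ (∑ i, spin (x i)) / (n : ℝ)}

/-- The product law on `{-1, 1}^ι` with weight proportional to `exp (θ ∑ i, a i)`. -/
noncomputable def tiltedLaw {ι : Type*} [Fintype ι] [DecidableEq ι] (θ : ℝ) (a : Spins ι) : ℝ :=
  Real.exp (θ * ∑ i, spin (a i)) / ∑ b : Spins ι, Real.exp (θ * ∑ i, spin (b i))

open Classical in
/-- The degree of the vertex `i`, as a real number. -/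
noncomputable def vertexDegree {n : ℕ} (G : SimpleGraph (Fin n)) (i : Fin n) : ℝ :=
  (G.degree i : ℝ)

/-- The average degree. -/
noncomputable def avgDegree {n : ℕ} (G : SimpleGraph (Fin n)) : ℝ :=
  (∑ i, vertexDegree G i) / (n : ℝ)

/-- `max_i |d_i / d̄ - 1|`. -/
noncomputable def degreeDeviation {n : ℕ} (G : SimpleGraph (Fin n)) : ℝ :=
  ⨆ i, |vertexDegree G i / avgDegree G - 1|

/-- `α_n = √(log n / d̄)`. -/
noncomputable def alphaRate {n : ℕ} (G : SimpleGraph (Fin n)) : ℝ :=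
  Real.sqrt (Real.log n / avgDegree G)

open Classical in
/-- The coupling matrix: the adjacency matrix divided by the average degree. -/
noncomputable def coupling {n : ℕ} (G : SimpleGraph (Fin n)) : Matrix (Fin n) (Fin n) ℝ :=
  (avgDegree G)⁻¹ • G.adjMatrix ℝ

theorem coupling_isHermitian {n : ℕ} (G : SimpleGraph (Fin n)) : (coupling G).IsHermitian := by
  classical
  ext i j
  simp [coupling, Matrix.conjTranspose_apply, SimpleGraph.adjMatrix_apply, SimpleGraph.adj_comm]

/-- The `k`-th largest eigenvalue (`1 ≤ k ≤ n`, with multiplicity) of the coupling matrix;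
outside that range of `k` the value is `0`. -/
noncomputable def couplingEigenvalue {n : ℕ} (G : SimpleGraph (Fin n)) (k : ℕ) : ℝ :=
  if h : 1 ≤ k ∧ k - 1 < Fintype.card (Fin n) then
    (coupling_isHermitian G).eigenvalues₀ ⟨k - 1, h.2⟩
  else 0

/-- `sup_{|S| = s, a ∈ {-1,1}^S} |P(X_S = a) / 2^{-s} - 1|`, with no external field. -/
noncomputable def uniformError {n : ℕ} (β : ℝ) (G : SimpleGraph (Fin n)) (s : ℕ) : ℝ :=
  ⨆ p : (S : {S : Finset (Fin n) // S.card = s}) × Spins S.1,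
    |isingProb β (coupling G) 0 (eqOnEvent p.1.1 p.2) / ((2 : ℝ)⁻¹ ^ s) - 1|

/-- `sup_{|S| = s, a ∈ {-1,1}^S} |P(X_S = a | X̄ ≥ 0) / g(a) - 1|`, with no external field, where
`g` is the product law proportional to `exp (β t ∑ i, a i)`. -/
noncomputable def tiltedError {n : ℕ} (β t : ℝ) (G : SimpleGraph (Fin n)) (s : ℕ) : ℝ :=
  ⨆ p : (S : {S : Finset (Fin n) // S.card = s}) × Spins S.1,
    |isingCondProb β (coupling G) 0 (eqOnEvent p.1.1 p.2) (nonnegMeanEvent n) /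
      tiltedLaw (β * t) p.2 - 1|

namespace Ising

/-! ### Elementary facts about spins and flips -/

/-! Write m_i = ∑ j, Q i j * x_j for the local field at i. Resetting the s = O(log n) spins of S
changes the log-weight by β ∑ Δ_i m_i, up to O(s²/d̄). So if all local fields lie within o(1/log n)
of one constant t, the patterns on S have relative weights exp(βt ∑ a_i) up to a factor 1 + o(1).
The exceptional event must have probability n^{-K} for every K, because the pattern probabilities
are themselves as small as n^{-O(1)}. This reduction is `tendsto_condError`; for β ≤ 1 it is used
with t = 0.

The local fields nearly solve the mean-field equations. A spin-flip (Stein type) argument shows that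
∑ w_k (x_k - tanh(β m_k)) is subgaussian with variance O(|w|²). For w a row of Q this is O(1/d̄), so
m_i ≈ ∑ j, Q i j tanh(β m_j) holds simultaneously at all vertices (`mass_localField_le`). If β ≤ 1,
comparison at the vertex with the largest |m_i| forces all fields to be small: linearly in the
errors when β < 1, and through tanh M ≤ M - M³/48 when β = 1, which costs cube roots.

If β > 1 the equations have several solutions and the right one must be selected. Let R be Q
compressed to mean-zero vectors. The fluctuation |Rx|² + n(|x̄| - t)² has an exponential moment of
order exp(O(1 + n/d̄ + n·dev²)) up to a polynomial factor (`exists_exponential_moment`). Its proof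
works on slices of fixed magnetisation m. There the energy is βm²n/2 plus a linear term in the
degree deviations plus a quadratic form in R. Large eigenvalues of R are linearised by Gaussian
integrals under the product law of mean t, whose variance proxy is exactly 1/β, so that λ₂ < 1
suffices; the rest is handled by Hanson-Wright under field βm. Young's inequality joins the two, and
the quadratic gap of the free energy at ±t pays for the fluctuation term. Jensen's inequality gives
the matching bound Z ≥ exp(n F(t)).

On x̄ ≥ 0 a small fluctuation puts every m_i near t, by Cauchy-Schwarz in the dense case and, when
the nontrivial spectrum vanishes, because a set of bad vertices would span too dense a subgraph.
Near t the mean-field map is a contraction, which improves closeness to the required o(1/log n). -/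

theorem spin_one : spin 1 = 1 := by simp [spin]

theorem spin_neg_one : spin (-1) = -1 := by simp [spin]

theorem spin_neg (u : ℤˣ) : spin (-u) = -spin u := by simp [spin]

theorem spin_sq (u : ℤˣ) : spin u ^ 2 = 1 := by
  rcases Int.units_eq_one_or u with rfl | rfl <;> norm_num [spin]

theorem abs_spin (u : ℤˣ) : |spin u| = 1 := by
  rcases Int.units_eq_one_or u with rfl | rfl <;> norm_num [spin]

theorem sum_units (F : ℤˣ → ℝ) : ∑ u : ℤˣ, F u = F 1 + F (-1) := by
  rw [show (Finset.univ : Finset ℤˣ) = {1, -1} from rfl, Finset.sum_pair (by decide)]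

section Flip

variable {ι : Type*} [DecidableEq ι]

/-- Reverse the spin at `j`. -/
def flip (j : ι) (x : Spins ι) : Spins ι := Function.update x j (-x j)

theorem flip_same (j : ι) (x : Spins ι) : flip j x j = -x j := by simp [flip]

theorem flip_of_ne {j k : ι} (h : k ≠ j) (x : Spins ι) : flip j x k = x k := by simp [flip, h]

theorem flip_flip (j : ι) (x : Spins ι) : flip j (flip j x) = x := by
  ext k
  by_cases h : k = j
  · subst h; simp [flip_same]
  · simp [flip_of_ne h]

theorem spin_flip_sub (j k : ι) (x : Spins ι) :
    spin (flip j x k) - spin (x k) = if k = j then -2 * spin (x j) else 0 := by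
  by_cases h : k = j
  · subst h; simp [flip_same, spin_neg]; ring
  · simp [flip_of_ne h, h]

variable [Fintype ι]

theorem sum_comp_flip (j : ι) (F : Spins ι → ℝ) : ∑ x, F (flip j x) = ∑ x, F x :=
  Equiv.sum_comp (Function.Involutive.toPerm (flip j) (flip_flip j)) F

/-- Flipping one spin is an involution of the cube, so a sum is half of a sum over pairs. This plays
the role of conditioning on all spins but one. -/
theorem sum_le_sum_of_flip (j : ι) {F K : Spins ι → ℝ}
    (h : ∀ x, F x + F (flip j x) ≤ K x + K (flip j x)) : ∑ x, F x ≤ ∑ x, K x := by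
  have := Finset.sum_le_sum (s := Finset.univ) fun x _ => h x
  rw [Finset.sum_add_distrib, Finset.sum_add_distrib, sum_comp_flip, sum_comp_flip] at this
  linarith

theorem sum_eq_zero_of_flip (j : ι) {F : Spins ι → ℝ}
    (h : ∀ x, F x + F (flip j x) = 0) : ∑ x, F x = 0 := by
  have := Finset.sum_congr (rfl : (Finset.univ : Finset (Spins ι)) = _) fun x _ => h x
  rw [Finset.sum_add_distrib, sum_comp_flip, Finset.sum_const_zero] at this
  linarith

theorem sum_exp_field (h : ι → ℝ) :
    ∑ x : Spins ι, Real.exp (∑ i, h i * spin (x i)) = ∏ i, (2 * Real.cosh (h i)) := by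
  have := Finset.prod_univ_sum (fun _ : ι => (Finset.univ : Finset ℤˣ))
    (fun i u => Real.exp (h i * spin u))
  rw [Fintype.piFinset_univ] at this
  simp_rw [Real.exp_sum]
  rw [← this]
  refine Finset.prod_congr rfl fun i _ => ?_
  rw [sum_units, spin_one, spin_neg_one, Real.cosh_eq]
  simp only [mul_one, mul_neg]
  ring

end Flip

/-! ### The hyperbolic tangent -/

theorem hasDerivAt_tanh (x : ℝ) : HasDerivAt Real.tanh (1 - Real.tanh x ^ 2) x := by
  have h := (Real.hasDerivAt_sinh x).div (Real.hasDerivAt_cosh x) (Real.cosh_pos x).ne'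
  have e : Real.tanh = fun y => Real.sinh y / Real.cosh y := by
    funext y; exact Real.tanh_eq_sinh_div_cosh y
  rw [e]
  convert! h using 1
  have := (Real.cosh_pos x).ne'
  simp only
  field_simp

theorem differentiable_tanh : Differentiable ℝ Real.tanh :=
  fun x => (hasDerivAt_tanh x).differentiableAt

theorem tanh_monotone : Monotone Real.tanh :=
  monotone_of_deriv_nonneg differentiable_tanh fun x => by
    rw [(hasDerivAt_tanh x).deriv]; linarith [Real.tanh_sq_lt_one x]

theorem abs_tanh_sub_le (x y : ℝ) : |Real.tanh x - Real.tanh y| ≤ |x - y| := by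
  have := Convex.norm_image_sub_le_of_norm_deriv_le (f := Real.tanh) (C := 1) (s := Set.univ)
    (fun x _ => differentiable_tanh x) (fun x _ => by
      rw [(hasDerivAt_tanh x).deriv, Real.norm_eq_abs, abs_le]
      constructor <;> nlinarith [Real.tanh_sq_lt_one x, sq_nonneg (Real.tanh x)])
    convex_univ (Set.mem_univ y) (Set.mem_univ x)
  simpa using this

theorem tanh_le_self {x : ℝ} (hx : 0 ≤ x) : Real.tanh x ≤ x := by
  have := abs_tanh_sub_le x 0
  simp only [Real.tanh_zero, sub_zero, abs_of_nonneg hx] at this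
  exact (le_abs_self _).trans this

theorem tanh_nonneg {x : ℝ} (hx : 0 ≤ x) : 0 ≤ Real.tanh x := by
  simpa using tanh_monotone hx

theorem abs_tanh_le_tanh_abs (x : ℝ) : |Real.tanh x| ≤ Real.tanh |x| := by
  rcases le_total 0 x with h | h
  · rw [abs_of_nonneg h, abs_of_nonneg (tanh_nonneg h)]
  · rw [abs_of_nonpos h, Real.tanh_neg, abs_of_nonpos]
    have := tanh_monotone h
    simpa using this

theorem hasDerivAt_log_cosh (x : ℝ) :
    HasDerivAt (fun y => Real.log (Real.cosh y)) (Real.tanh x) x := by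
  have := (Real.hasDerivAt_cosh x).log (Real.cosh_pos x).ne'
  rwa [← Real.tanh_eq_sinh_div_cosh] at this

/-- A function whose derivative has the sign of `y - a` is minimal at `a`. -/
theorem le_of_deriv_sign {f f' : ℝ → ℝ} {a : ℝ} (hf : ∀ y, HasDerivAt f (f' y) y)
    (hr : ∀ y, a < y → 0 ≤ f' y) (hl : ∀ y, y < a → f' y ≤ 0) (x : ℝ) : f a ≤ f x := by
  have hc : Continuous f := continuous_iff_continuousAt.2 fun y => (hf y).continuousAt
  rcases le_total a x with h | h
  · refine monotoneOn_of_deriv_nonneg (convex_Ici a) hc.continuousOn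
      (fun y _ => (hf y).differentiableAt.differentiableWithinAt) (fun y hy => ?_)
      Set.self_mem_Ici h h
    rw [interior_Ici] at hy
    rw [(hf y).deriv]; exact hr y hy
  · refine antitoneOn_of_deriv_nonpos (convex_Iic a) hc.continuousOn
      (fun y _ => (hf y).differentiableAt.differentiableWithinAt) (fun y hy => ?_)
      h Set.self_mem_Iic h
    rw [interior_Iic] at hy
    rw [(hf y).deriv]; exact hl y hy

/-- Hoeffding's lemma for a tilted spin. -/
theorem cosh_add_le (h θ : ℝ) :
    Real.cosh (h + θ) ≤ Real.cosh h * Real.exp (θ * Real.tanh h + θ ^ 2 / 2) := by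
  -- The gap between the exponent and log cosh(h + y) has derivative tanh h + y - tanh(h + y), which
  -- has the sign of y because tanh is 1-Lipschitz.
  have key := le_of_deriv_sign (a := 0)
    (f := fun y => y * Real.tanh h + y ^ 2 / 2 - Real.log (Real.cosh (h + y)))
    (f' := fun y => Real.tanh h + y - Real.tanh (h + y))
    (fun y => by
      have h1 := (hasDerivAt_log_cosh (h + y)).comp_const_add h y
      have h2 := ((hasDerivAt_id y).mul_const (Real.tanh h)).add
        (((hasDerivAt_id y).pow 2).div_const 2)
      convert! h2.sub h1 using 1
      simp)
    (fun y hy => by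
      have := (abs_le.1 (abs_tanh_sub_le (h + y) h)).2
      rw [add_sub_cancel_left, abs_of_pos hy] at this
      linarith)
    (fun y hy => by
      have := (abs_le.1 (abs_tanh_sub_le (h + y) h)).1
      rw [add_sub_cancel_left, abs_of_neg hy] at this
      linarith) θ
  simp only [zero_mul, ne_eq, OfNat.ofNat_ne_zero, not_false_eq_true, zero_pow, zero_div, add_zero,
    zero_sub] at key
  rw [← Real.exp_log (Real.cosh_pos (h + θ))]
  conv_rhs => rw [← Real.exp_log (Real.cosh_pos h)]
  rw [← Real.exp_add]
  gcongr
  linarith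

end Ising

/-! ### Local fields and subgaussian concentration of mean-field residuals -/

namespace Ising

variable {n : ℕ}

/-- The local field `∑ j, Q i j * x j` felt by the spin at `i`. -/
noncomputable def localField (Q : Matrix (Fin n) (Fin n) ℝ) (x : Spins (Fin n)) (i : Fin n) : ℝ :=
  ∑ j, Q i j * spin (x j)

/-- The quadratic form `xᵀ Q x`. -/
noncomputable def energy (Q : Matrix (Fin n) (Fin n) ℝ) (x : Spins (Fin n)) : ℝ :=
  ∑ i, ∑ j, Q i j * spin (x i) * spin (x j)

/-- A symmetric ferromagnetic coupling without self-interaction, with entries at most `q` and row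
sums at most `2`. -/
structure IsFerromagnetic (Q : Matrix (Fin n) (Fin n) ℝ) (q : ℝ) : Prop where
  symm : ∀ i j, Q i j = Q j i
  diag : ∀ i, Q i i = 0
  nonneg : ∀ i j, 0 ≤ Q i j
  le : ∀ i j, Q i j ≤ q
  row : ∀ i, ∑ j, Q i j ≤ 2

theorem isingWeight_zero (β : ℝ) (Q : Matrix (Fin n) (Fin n) ℝ) (x : Spins (Fin n)) :
    isingWeight β Q 0 x = Real.exp (β / 2 * energy Q x) := by
  simp [isingWeight, energy]

theorem isingWeight_pos (β : ℝ) (Q : Matrix (Fin n) (Fin n) ℝ) (μ : Fin n → ℝ)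
    (x : Spins (Fin n)) : 0 < isingWeight β Q μ x := Real.exp_pos _

theorem isingZ_pos (β : ℝ) (Q : Matrix (Fin n) (Fin n) ℝ) (μ : Fin n → ℝ) :
    0 < isingZ β Q μ :=
  Finset.sum_pos (fun x _ => isingWeight_pos β Q μ x) Finset.univ_nonempty

theorem energy_eq_sum_localField (Q : Matrix (Fin n) (Fin n) ℝ) (x : Spins (Fin n)) :
    energy Q x = ∑ i, spin (x i) * localField Q x i := by
  unfold energy localField
  refine Finset.sum_congr rfl fun i _ => ?_
  rw [Finset.mul_sum]
  exact Finset.sum_congr rfl fun j _ => by ring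

/-- Exact Taylor expansion of a quadratic form whose gradient at x is twice the local field. -/
theorem energy_change {Q : Matrix (Fin n) (Fin n) ℝ} (hQ : ∀ i j, Q i j = Q j i)
    (x y : Spins (Fin n)) :
    energy Q y = energy Q x + 2 * ∑ i, (spin (y i) - spin (x i)) * localField Q x i
      + ∑ i, ∑ j, Q i j * (spin (y i) - spin (x i)) * (spin (y j) - spin (x j)) := by
  have h : ∑ i, ∑ j, Q i j * spin (x i) * (spin (y j) - spin (x j))
      = ∑ i, (spin (y i) - spin (x i)) * localField Q x i := by
    rw [Finset.sum_comm]
    refine Finset.sum_congr rfl fun i _ => ?_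
    rw [localField, Finset.mul_sum]
    refine Finset.sum_congr rfl fun j _ => ?_
    rw [hQ j i]; ring
  have h' : ∑ i, ∑ j, Q i j * (spin (y i) - spin (x i)) * spin (x j)
      = ∑ i, (spin (y i) - spin (x i)) * localField Q x i := by
    refine Finset.sum_congr rfl fun i _ => ?_
    rw [localField, Finset.mul_sum]
    refine Finset.sum_congr rfl fun j _ => ?_
    ring
  rw [two_mul, ← add_assoc]
  nth_rw 1 [← h]
  rw [← h', energy, energy, ← Finset.sum_add_distrib, ← Finset.sum_add_distrib,
    ← Finset.sum_add_distrib]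
  refine Finset.sum_congr rfl fun i _ => ?_
  rw [← Finset.sum_add_distrib, ← Finset.sum_add_distrib, ← Finset.sum_add_distrib]
  exact Finset.sum_congr rfl fun j _ => by ring

theorem localField_flip (Q : Matrix (Fin n) (Fin n) ℝ) (j : Fin n) (x : Spins (Fin n))
    (k : Fin n) : localField Q (flip j x) k = localField Q x k - 2 * Q k j * spin (x j) := by
  have : localField Q (flip j x) k - localField Q x k = -(2 * Q k j * spin (x j)) := by
    rw [localField, localField, ← Finset.sum_sub_distrib]
    rw [Finset.sum_eq_single j]
    · rw [← mul_sub, spin_flip_sub, if_pos rfl]; ring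
    · intro i _ hi
      rw [← mul_sub, spin_flip_sub, if_neg hi, mul_zero]
    · simp
  linarith

theorem energy_flip {Q : Matrix (Fin n) (Fin n) ℝ} (hQ : ∀ i j, Q i j = Q j i)
    (hd : ∀ i, Q i i = 0) (j : Fin n) (x : Spins (Fin n)) :
    energy Q (flip j x) = energy Q x - 4 * (spin (x j) * localField Q x j) := by
  rw [energy_change hQ x (flip j x)]
  simp_rw [spin_flip_sub]
  simp [hd]
  ring

theorem abs_exp_sub_le (u v : ℝ) :
    |Real.exp u - Real.exp v| ≤ |u - v| * (Real.exp u + Real.exp v) := by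
  wlog h : v ≤ u generalizing u v
  · rw [abs_sub_comm, abs_sub_comm u v, add_comm]
    exact this v u (le_of_not_ge h)
  rw [abs_of_nonneg (sub_nonneg.2 (Real.exp_le_exp.2 h)), abs_of_nonneg (sub_nonneg.2 h)]
  have h1 : Real.exp v = Real.exp u * Real.exp (-(u - v)) := by
    rw [← Real.exp_add]; congr 1; ring
  have h2 := Real.add_one_le_exp (-(u - v))
  have := Real.exp_pos u
  have := mul_nonneg (sub_nonneg.2 h) (Real.exp_pos v).le
  nlinarith

/-- Given the other spins, x_j has mean tanh of its field, so the left side vanishes when u = v.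
What remains is sech a times exp u - exp v, and sech a is at most twice either weight. -/
theorem two_point_bound (a s u v : ℝ) (hs : |s| = 1) :
    |Real.exp a * ((s - s * Real.tanh a) * Real.exp u)
      + Real.exp (-a) * ((-s - s * Real.tanh a) * Real.exp v)|
      ≤ 2 * |u - v| * (Real.exp a * Real.exp u + Real.exp (-a) * Real.exp v) := by
  have hc := Real.cosh_pos a
  have h1 : Real.exp a * (1 - Real.tanh a) = 1 / Real.cosh a := by
    rw [Real.tanh_eq_sinh_div_cosh]
    field_simp
    rw [Real.cosh_sub_sinh, ← Real.exp_add]; simp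
  have h2 : Real.exp (-a) * (1 + Real.tanh a) = 1 / Real.cosh a := by
    rw [Real.tanh_eq_sinh_div_cosh]
    field_simp
    rw [Real.cosh_add_sinh, ← Real.exp_add]; simp
  have h3 : Real.exp a * ((s - s * Real.tanh a) * Real.exp u)
      + Real.exp (-a) * ((-s - s * Real.tanh a) * Real.exp v)
      = s * (1 / Real.cosh a) * (Real.exp u - Real.exp v) := by
    linear_combination (s * Real.exp u) * h1 - (s * Real.exp v) * h2
  rw [h3, abs_mul, abs_mul, hs, one_mul, abs_of_pos (by positivity)]
  have e1 : 1 / Real.cosh a ≤ 2 * Real.exp a := by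
    rw [div_le_iff₀ hc, Real.cosh_eq]
    have : Real.exp a * Real.exp (-a) = 1 := by rw [← Real.exp_add]; simp
    nlinarith [sq_nonneg (Real.exp a)]
  have e2 : 1 / Real.cosh a ≤ 2 * Real.exp (-a) := by
    rw [div_le_iff₀ hc, Real.cosh_eq]
    have : Real.exp a * Real.exp (-a) = 1 := by rw [← Real.exp_add]; simp
    nlinarith [sq_nonneg (Real.exp (-a))]
  calc 1 / Real.cosh a * |Real.exp u - Real.exp v|
      ≤ 1 / Real.cosh a * (|u - v| * (Real.exp u + Real.exp v)) := by
        gcongr; exact abs_exp_sub_le u v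
    _ = |u - v| * (1 / Real.cosh a * Real.exp u + 1 / Real.cosh a * Real.exp v) := by ring
    _ ≤ |u - v| * (2 * Real.exp a * Real.exp u + 2 * Real.exp (-a) * Real.exp v) := by gcongr
    _ = _ := by ring

/-- The linear statistic `∑ k, w k * (x k - tanh (β m k))`. -/
noncomputable def residual (β : ℝ) (Q : Matrix (Fin n) (Fin n) ℝ) (w : Fin n → ℝ)
    (x : Spins (Fin n)) : ℝ :=
  ∑ k, w k * (spin (x k) - Real.tanh (β * localField Q x k))

/-- A flip at j changes the spin part only at k = j, and moves each local field m_k by 2 Q k j,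
which the 1-Lipschitz tanh passes on. -/
theorem abs_residual_flip_le {β : ℝ} (hβ : 0 ≤ β) {Q : Matrix (Fin n) (Fin n) ℝ}
    (hn : ∀ i j, 0 ≤ Q i j) (w : Fin n → ℝ) (j : Fin n) (x : Spins (Fin n)) :
    |residual β Q w x - residual β Q w (flip j x)|
      ≤ 2 * (|w j| + β * ∑ k, |w k| * Q k j) := by
  have e : residual β Q w x - residual β Q w (flip j x)
      = ∑ k, w k * (spin (x k) - spin (flip j x k))
        + ∑ k, w k * (Real.tanh (β * localField Q (flip j x) k)
            - Real.tanh (β * localField Q x k)) := by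
    rw [residual, residual, ← Finset.sum_sub_distrib, ← Finset.sum_add_distrib]
    exact Finset.sum_congr rfl fun k _ => by ring
  have e1 : ∑ k, w k * (spin (x k) - spin (flip j x k)) = w j * (2 * spin (x j)) := by
    rw [Finset.sum_eq_single j]
    · rw [← neg_sub, spin_flip_sub, if_pos rfl]; ring
    · intro i _ hi
      rw [← neg_sub, spin_flip_sub, if_neg hi]; simp
    · simp
  rw [e, e1, mul_add]
  refine (abs_add_le _ _).trans (add_le_add ?_ ?_)
  · rw [abs_mul, abs_mul, abs_spin]; norm_num [mul_comm]
  · refine (Finset.abs_sum_le_sum_abs _ _).trans ?_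
    rw [Finset.mul_sum, Finset.mul_sum]
    refine Finset.sum_le_sum fun k _ => ?_
    rw [abs_mul]
    have := abs_tanh_sub_le (β * localField Q (flip j x) k) (β * localField Q x k)
    rw [localField_flip, ← mul_sub, sub_sub_cancel_left, abs_mul, abs_neg, abs_mul, abs_mul,
      abs_spin, abs_of_nonneg hβ, abs_of_nonneg (hn k j)] at this
    norm_num at this
    have := mul_le_mul_of_nonneg_left this (abs_nonneg (w k))
    rw [localField_flip]
    linarith

/-- The left side is the θ-derivative of the Laplace transform Φ of the residual. Pairing over flips
at each j leaves only the effect of the flip on the exponential, so Φ' ≤ 4θVΦ with V of order |w|².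
-/
theorem sum_weight_residual_le {β : ℝ} (hβ : 0 ≤ β) {Q : Matrix (Fin n) (Fin n) ℝ} {q : ℝ}
    (hQ : IsFerromagnetic Q q) (w : Fin n → ℝ) {θ : ℝ} (hθ : 0 ≤ θ) :
    ∑ x, isingWeight β Q 0 x * (residual β Q w x * Real.exp (θ * residual β Q w x))
      ≤ 4 * θ * ((1 + 2 * β) * ∑ k, w k ^ 2) *
        ∑ x, isingWeight β Q 0 x * Real.exp (θ * residual β Q w x) := by
  set D : Fin n → ℝ := fun j => |w j| + β * ∑ k, |w k| * Q k j with hD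
  -- Schur's test: AM-GM on |w k| |w j|, then row sums at most 2.
  have hsum : ∑ j, |w j| * D j ≤ (1 + 2 * β) * ∑ k, w k ^ 2 := by
    have h1 : ∀ k j, |w k| * |w j| * Q k j ≤ Q k j * (w k ^ 2 + w j ^ 2) / 2 := by
      intro k j
      have := mul_nonneg (hQ.nonneg k j) (sq_nonneg (|w k| - |w j|))
      rw [← sq_abs (w k), ← sq_abs (w j)]
      nlinarith
    have h2 : ∑ j, ∑ k, |w k| * |w j| * Q k j ≤ 2 * ∑ k, w k ^ 2 := by
      calc ∑ j, ∑ k, |w k| * |w j| * Q k j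
          ≤ ∑ j, ∑ k, (Q k j * w k ^ 2 / 2 + Q j k * w j ^ 2 / 2) := by
            refine Finset.sum_le_sum fun j _ => Finset.sum_le_sum fun k _ => ?_
            have := h1 k j
            rw [hQ.symm j k]; linarith
        _ = ∑ k, ∑ j, Q k j * w k ^ 2 / 2 + ∑ j, ∑ k, Q j k * w j ^ 2 / 2 := by
            simp_rw [Finset.sum_add_distrib]
            rw [Finset.sum_comm]
        _ = ∑ k, (∑ j, Q k j) * w k ^ 2 := by
            rw [← Finset.sum_add_distrib]
            refine Finset.sum_congr rfl fun k _ => ?_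
            rw [Finset.sum_mul, ← Finset.sum_add_distrib]
            exact Finset.sum_congr rfl fun j _ => by ring
        _ ≤ ∑ k, 2 * w k ^ 2 := by
            refine Finset.sum_le_sum fun k _ => ?_
            have := hQ.row k
            gcongr
        _ = _ := by rw [Finset.mul_sum]
    calc ∑ j, |w j| * D j = ∑ j, w j ^ 2 + β * ∑ j, ∑ k, |w k| * |w j| * Q k j := by
          rw [Finset.mul_sum, ← Finset.sum_add_distrib]
          refine Finset.sum_congr rfl fun j _ => ?_
          rw [hD]
          simp only
          rw [mul_add, ← sq, sq_abs, Finset.mul_sum, Finset.mul_sum, Finset.mul_sum]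
          congr 1
          exact Finset.sum_congr rfl fun k _ => by ring
      _ ≤ ∑ j, w j ^ 2 + β * (2 * ∑ k, w k ^ 2) := by gcongr
      _ = _ := by ring
  set Φ := ∑ x, isingWeight β Q 0 x * Real.exp (θ * residual β Q w x) with hΦ
  have hΦ0 : 0 ≤ Φ := Finset.sum_nonneg fun x _ =>
    mul_nonneg (isingWeight_pos _ _ _ _).le (Real.exp_pos _).le
  have hj : ∀ j, ∑ x, isingWeight β Q 0 x * (w j * (spin (x j)
      - Real.tanh (β * localField Q x j)) * Real.exp (θ * residual β Q w x))
      ≤ 4 * θ * (|w j| * D j) * Φ := by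
    intro j
    rw [hΦ, Finset.mul_sum]
    refine sum_le_sum_of_flip j fun x => ?_
    set y := flip j x
    set a := β * (spin (x j) * localField Q x j) with ha
    -- Common factor of the two weights: with zero diagonal, x and its flip have the same field at j
    -- and energies differing by 4 x_j m_j, so the weights are k exp(±a).
    set k := Real.exp (β / 2 * energy Q x - a) with hk
    have w1 : isingWeight β Q 0 x = k * Real.exp a := by
      rw [isingWeight_zero, hk, ← Real.exp_add]; congr 1; ring
    have w2 : isingWeight β Q 0 y = k * Real.exp (-a) := by
      rw [isingWeight_zero, hk, ← Real.exp_add, energy_flip hQ.symm hQ.diag, ha]; congr 1; ring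
    have t2 : localField Q y j = localField Q x j := by
      rw [localField_flip, hQ.diag]; ring
    have t1 : Real.tanh (β * localField Q x j) = spin (x j) * Real.tanh a := by
      rcases Int.units_eq_one_or (x j) with h | h
      · rw [ha, h]; simp [spin_one]
      · rw [ha, h]; simp [spin_neg_one, Real.tanh_neg]
    have s2 : spin (y j) = -spin (x j) := by
      show spin (flip j x j) = _
      rw [flip_same, spin_neg]
    rw [w1, w2, t2, t1, s2]
    set u := θ * residual β Q w x with hu
    set v := θ * residual β Q w y with hv
    have huv : |u - v| ≤ θ * (2 * D j) := by
      rw [hu, hv, ← mul_sub, abs_mul, abs_of_nonneg hθ]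
      gcongr
      exact abs_residual_flip_le hβ hQ.nonneg w j x
    have tp := two_point_bound a (spin (x j)) u v (abs_spin _)
    have hk0 : 0 ≤ k := (Real.exp_pos _).le
    set E := Real.exp a * Real.exp u + Real.exp (-a) * Real.exp v with hE
    have hE0 : 0 ≤ E := by positivity
    calc _ = k * (w j * (Real.exp a * ((spin (x j) - spin (x j) * Real.tanh a) * Real.exp u)
      + Real.exp (-a) * ((-spin (x j) - spin (x j) * Real.tanh a) * Real.exp v))) := by ring
      _ ≤ k * (|w j| * (2 * |u - v| * E)) := by
        refine mul_le_mul_of_nonneg_left ((le_abs_self _).trans ?_) hk0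
        rw [abs_mul]
        exact mul_le_mul_of_nonneg_left tp (abs_nonneg _)
      _ ≤ k * (|w j| * (2 * (θ * (2 * D j)) * E)) := by gcongr
      _ = _ := by rw [hE]; ring
  calc ∑ x, isingWeight β Q 0 x * (residual β Q w x * Real.exp (θ * residual β Q w x))
      = ∑ j, ∑ x, isingWeight β Q 0 x * (w j * (spin (x j)
        - Real.tanh (β * localField Q x j)) * Real.exp (θ * residual β Q w x)) := by
        rw [Finset.sum_comm]
        refine Finset.sum_congr rfl fun x _ => ?_
        rw [← Finset.mul_sum, ← Finset.sum_mul]; rfl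
    _ ≤ ∑ j, 4 * θ * (|w j| * D j) * Φ := Finset.sum_le_sum fun j _ => hj j
    _ = 4 * θ * (∑ j, |w j| * D j) * Φ := by rw [← Finset.sum_mul, ← Finset.mul_sum]
    _ ≤ _ := by gcongr

/-- The exponential moments of a linear residual are subgaussian. -/
theorem sum_weight_exp_residual_le {β : ℝ} (hβ : 0 ≤ β) {Q : Matrix (Fin n) (Fin n) ℝ} {q : ℝ}
    (hQ : IsFerromagnetic Q q) (w : Fin n → ℝ) {θ : ℝ} (hθ : 0 ≤ θ) :
    ∑ x, isingWeight β Q 0 x * Real.exp (θ * residual β Q w x)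
      ≤ isingZ β Q 0 * Real.exp (2 * θ ^ 2 * ((1 + 2 * β) * ∑ k, w k ^ 2)) := by
  set V := (1 + 2 * β) * ∑ k, w k ^ 2
  set φ : ℝ → ℝ := fun θ => ∑ x, isingWeight β Q 0 x * Real.exp (θ * residual β Q w x) with hφ
  set f : ℝ → ℝ := fun θ => φ θ * Real.exp (-(2 * θ ^ 2 * V)) with hf
  have hd : ∀ y, HasDerivAt f
      ((∑ x, isingWeight β Q 0 x * (residual β Q w x * Real.exp (y * residual β Q w x)))
          * Real.exp (-(2 * y ^ 2 * V))
        + φ y * (Real.exp (-(2 * y ^ 2 * V)) * (-(4 * y * V)))) y := by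
    intro y
    refine HasDerivAt.mul ?_ ?_
    · refine HasDerivAt.fun_sum fun x _ => ?_
      refine HasDerivAt.const_mul _ ?_
      have := ((hasDerivAt_id y).mul_const (residual β Q w x)).exp
      convert! this using 1
      simp [mul_comm]
    · have := ((((hasDerivAt_id y).pow 2).const_mul 2).mul_const V).neg.exp
      convert! this using 1
      push_cast
      simp only [id, pow_one, Pi.pow_apply, Pi.neg_apply]
      ring
  -- Grönwall: Φ' ≤ 4θVΦ says that Φ exp(-2θ²V) decreases from its value Z at θ = 0.
  have hanti : AntitoneOn f (Set.Ici 0) := by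
    refine antitoneOn_of_deriv_nonpos (convex_Ici 0)
      (fun y _ => (hd y).continuousAt.continuousWithinAt)
      (fun y _ => (hd y).differentiableAt.differentiableWithinAt) fun y hy => ?_
    rw [interior_Ici] at hy
    rw [(hd y).deriv]
    have := sum_weight_residual_le hβ hQ w (le_of_lt hy)
    have := mul_le_mul_of_nonneg_right this (Real.exp_pos (-(2 * y ^ 2 * V))).le
    simp only [hφ]
    linarith
  have h := hanti (Set.self_mem_Ici) hθ hθ
  have h0 : f 0 = isingZ β Q 0 := by simp [hf, hφ, isingZ]
  rw [h0] at h
  simp only [hf] at h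
  rw [Real.exp_neg, ← div_eq_mul_inv, div_le_iff₀ (Real.exp_pos _)] at h
  exact h

/-- The total weight of a set of configurations. -/
noncomputable def mass (β : ℝ) (Q : Matrix (Fin n) (Fin n) ℝ) (A : Set (Spins (Fin n))) : ℝ :=
  ∑ x, A.indicator (isingWeight β Q 0) x

theorem mass_nonneg (β : ℝ) (Q : Matrix (Fin n) (Fin n) ℝ) (A : Set (Spins (Fin n))) :
    0 ≤ mass β Q A :=
  Finset.sum_nonneg fun x _ => Set.indicator_nonneg (fun _ _ => (isingWeight_pos _ _ _ _).le) x

theorem mass_mono (β : ℝ) (Q : Matrix (Fin n) (Fin n) ℝ) {A B : Set (Spins (Fin n))}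
    (h : A ⊆ B) : mass β Q A ≤ mass β Q B :=
  Finset.sum_le_sum fun x _ =>
    Set.indicator_le_indicator_of_subset h (fun _ => (isingWeight_pos _ _ _ _).le) x

theorem mass_univ (β : ℝ) (Q : Matrix (Fin n) (Fin n) ℝ) : mass β Q Set.univ = isingZ β Q 0 := by
  simp [mass, isingZ]

theorem mass_union_le (β : ℝ) (Q : Matrix (Fin n) (Fin n) ℝ) (A B : Set (Spins (Fin n))) :
    mass β Q (A ∪ B) ≤ mass β Q A + mass β Q B := by
  unfold mass
  rw [← Finset.sum_add_distrib]
  refine Finset.sum_le_sum fun x _ => ?_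
  have := (isingWeight_pos β Q 0 x).le
  by_cases hA : x ∈ A <;> by_cases hB : x ∈ B <;> simp [hA, hB, this]

theorem mass_iUnion_le (β : ℝ) (Q : Matrix (Fin n) (Fin n) ℝ) {ι : Type*} [Fintype ι]
    (A : ι → Set (Spins (Fin n))) : mass β Q (⋃ i, A i) ≤ ∑ i, mass β Q (A i) := by
  unfold mass
  rw [Finset.sum_comm]
  refine Finset.sum_le_sum fun x _ => ?_
  have h0 : ∀ i, 0 ≤ (A i).indicator (isingWeight β Q 0) x := fun i =>
    Set.indicator_nonneg (fun _ _ => (isingWeight_pos _ _ _ _).le) x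
  by_cases hx : x ∈ ⋃ i, A i
  · obtain ⟨i, hi⟩ := Set.mem_iUnion.1 hx
    rw [Set.indicator_of_mem hx, ← Set.indicator_of_mem hi (isingWeight β Q 0)]
    exact Finset.single_le_sum (fun j _ => h0 j) (Finset.mem_univ i)
  · rw [Set.indicator_of_notMem hx]
    exact Finset.sum_nonneg fun i _ => h0 i

/-- Markov's inequality for the weights. -/
theorem mass_le_of_exp (β : ℝ) (Q : Matrix (Fin n) (Fin n) ℝ) (f : Spins (Fin n) → ℝ) (r : ℝ) :
    mass β Q {x | r ≤ f x} ≤ Real.exp (-r) * ∑ x, isingWeight β Q 0 x * Real.exp (f x) := by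
  rw [mass, Finset.mul_sum]
  refine Finset.sum_le_sum fun x _ => ?_
  have hw := (isingWeight_pos β Q 0 x).le
  by_cases hx : r ≤ f x
  · rw [Set.indicator_of_mem (by exact hx)]
    have : 1 ≤ Real.exp (-r) * Real.exp (f x) := by
      rw [← Real.exp_add]; exact Real.one_le_exp (by linarith)
    nlinarith
  · rw [Set.indicator_of_notMem (by exact hx)]
    positivity

theorem mass_residual_le {β : ℝ} (hβ : 0 ≤ β) {Q : Matrix (Fin n) (Fin n) ℝ} {q : ℝ}
    (hQ : IsFerromagnetic Q q) (w : Fin n → ℝ) {V r : ℝ} (hV : 0 < V)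
    (hw : ∑ k, w k ^ 2 ≤ V) (hr : 0 ≤ r) :
    mass β Q {x | r ≤ |residual β Q w x|}
      ≤ 2 * Real.exp (-(r ^ 2 / (8 * (1 + 2 * β) * V))) * isingZ β Q 0 := by
  -- Minimiser of the Chernoff exponent -θr + 2θ²(1 + 2β)V.
  set θ := r / (4 * (1 + 2 * β) * V) with hθ
  have hV' : 0 < (1 + 2 * β) * V := by positivity
  have hθ0 : 0 ≤ θ := by positivity
  have one : ∀ w' : Fin n → ℝ, ∑ k, w' k ^ 2 ≤ V →
      mass β Q {x | r ≤ residual β Q w' x}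
        ≤ Real.exp (-(r ^ 2 / (8 * (1 + 2 * β) * V))) * isingZ β Q 0 := by
    intro w' hw'
    have h1 := mass_le_of_exp β Q (fun x => θ * residual β Q w' x) (θ * r)
    have h2 := sum_weight_exp_residual_le hβ hQ w' hθ0
    have h3 : {x | r ≤ residual β Q w' x} ⊆ {x | θ * r ≤ θ * residual β Q w' x} :=
      fun x hx => mul_le_mul_of_nonneg_left hx hθ0
    refine (mass_mono β Q h3).trans (h1.trans ?_)
    have hZ := isingZ_pos β Q 0
    calc _ ≤ Real.exp (-(θ * r)) * (isingZ β Q 0 *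
          Real.exp (2 * θ ^ 2 * ((1 + 2 * β) * ∑ k, w' k ^ 2))) := by gcongr
      _ ≤ Real.exp (-(θ * r)) * (isingZ β Q 0 *
          Real.exp (2 * θ ^ 2 * ((1 + 2 * β) * V))) := by gcongr
      _ = (Real.exp (-(θ * r)) * Real.exp (2 * θ ^ 2 * ((1 + 2 * β) * V))) * isingZ β Q 0 := by
          ring
      _ = _ := by
          rw [← Real.exp_add]
          congr 2
          rw [hθ]
          field_simp
          ring
  have hneg : ∀ x, residual β Q (fun k => -w k) x = -residual β Q w x := by
    intro x
    simp [residual, Finset.sum_neg_distrib]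
  have hsub : {x | r ≤ |residual β Q w x|} ⊆
      {x | r ≤ residual β Q w x} ∪ {x | r ≤ residual β Q (fun k => -w k) x} := by
    intro x hx
    rcases le_abs.1 (show r ≤ |residual β Q w x| from hx) with h | h
    · exact Or.inl h
    · refine Or.inr ?_
      rw [Set.mem_ofPred_eq, hneg]; exact h
  refine (mass_mono β Q hsub).trans ((mass_union_le β Q _ _).trans ?_)
  have a := one w hw
  have b := one (fun k => -w k) (by simpa using hw)
  linarith

/-- With high probability every local field nearly satisfies the mean-field equation. -/
theorem mass_localField_le {β : ℝ} (hβ : 0 ≤ β) {Q : Matrix (Fin n) (Fin n) ℝ} {q : ℝ}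
    (hQ : IsFerromagnetic Q q) (hq : 0 < q) {r : ℝ} (hr : 0 ≤ r) :
    mass β Q {x | ∃ i, r ≤ |localField Q x i - ∑ j, Q i j * Real.tanh (β * localField Q x j)|}
      ≤ n * (2 * Real.exp (-(r ^ 2 / (16 * (1 + 2 * β) * q)))) * isingZ β Q 0 := by
  have e : {x | ∃ i, r ≤ |localField Q x i - ∑ j, Q i j * Real.tanh (β * localField Q x j)|}
      = ⋃ i, {x | r ≤ |residual β Q (Q i) x|} := by
    ext x
    simp only [Set.mem_ofPred_eq, Set.mem_iUnion]
    refine exists_congr fun i => ?_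
    rw [residual, localField, ← Finset.sum_sub_distrib]
    simp_rw [mul_sub]
  rw [e]
  refine (mass_iUnion_le β Q _).trans ?_
  have : ∀ i, mass β Q {x | r ≤ |residual β Q (Q i) x|}
      ≤ 2 * Real.exp (-(r ^ 2 / (16 * (1 + 2 * β) * q))) * isingZ β Q 0 := by
    intro i
    -- Entries at most q and row sum at most 2 give a row of squared norm O(q). With q = 1/d̄ this
    -- sets the concentration scale of the local fields.
    have hs : ∑ k, Q i k ^ 2 ≤ 2 * q := by
      calc ∑ k, Q i k ^ 2 ≤ ∑ k, q * Q i k := Finset.sum_le_sum fun k _ => by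
            rw [sq]; exact mul_le_mul_of_nonneg_right (hQ.le i k) (hQ.nonneg i k)
        _ = q * ∑ k, Q i k := by rw [Finset.mul_sum]
        _ ≤ q * 2 := by gcongr; exact hQ.row i
        _ = _ := by ring
    have := mass_residual_le hβ hQ (Q i) (by positivity) hs hr
    rwa [show 8 * (1 + 2 * β) * (2 * q) = 16 * (1 + 2 * β) * q by ring] at this
  calc _ ≤ ∑ _i : Fin n, 2 * Real.exp (-(r ^ 2 / (16 * (1 + 2 * β) * q))) * isingZ β Q 0 :=
        Finset.sum_le_sum fun i _ => this i
    _ = _ := by simp; ring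

end Ising

/-! ### Resetting a few spins: from local fields to finite-dimensional laws -/

namespace Ising

variable {n : ℕ}

/-- Overwrite the spins of `x` on `S` by `b`. -/
def setOn (S : Finset (Fin n)) (b : Spins S) (x : Spins (Fin n)) : Spins (Fin n) :=
  fun i => if h : i ∈ S then b ⟨i, h⟩ else x i

theorem setOn_of_mem {S : Finset (Fin n)} (b : Spins S) (x : Spins (Fin n)) (i : S) :
    setOn S b x i = b i := by simp [setOn]

theorem setOn_of_notMem {S : Finset (Fin n)} (b : Spins S) (x : Spins (Fin n)) {i : Fin n}
    (h : i ∉ S) : setOn S b x i = x i := by simp [setOn, h]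

theorem setOn_injOn (S : Finset (Fin n)) (a b : Spins S) :
    Set.InjOn (setOn S b) (eqOnEvent S a) := by
  intro x hx y hy hxy
  funext i
  by_cases h : i ∈ S
  · rw [hx ⟨i, h⟩, hy ⟨i, h⟩]
  · have := congrFun hxy i
    rwa [setOn_of_notMem b x h, setOn_of_notMem b y h] at this

/-- Only coordinates in S change, each by at most 2. The first-order term of the energy is t ∑ Δ_i
up to 2|S|ρ, and the second-order term is at most 4|S|²q. -/
theorem weight_le_weight_setOn {β : ℝ} (hβ : 0 ≤ β) {Q : Matrix (Fin n) (Fin n) ℝ} {q : ℝ}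
    (hQ : IsFerromagnetic Q q) {t ρ : ℝ} {S : Finset (Fin n)} {x : Spins (Fin n)}
    (hx : ∀ i, |localField Q x i - t| ≤ ρ) (b : Spins S) :
    isingWeight β Q 0 x * Real.exp (β * t * ∑ i, spin (b i))
      ≤ Real.exp (2 * β * S.card * ρ + 2 * β * S.card ^ 2 * q) *
        (Real.exp (β * t * ∑ i : S, spin (x i)) * isingWeight β Q 0 (setOn S b x)) := by
  set y := setOn S b x
  set Δ : Fin n → ℝ := fun i => spin (y i) - spin (x i) with hΔ
  have hΔ0 : ∀ i, i ∉ S → Δ i = 0 := by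
    intro i hi
    have : y i = x i := setOn_of_notMem b x hi
    simp [hΔ, this]
  have hΔ2 : ∀ i, |Δ i| ≤ 2 := by
    intro i
    have := abs_sub (spin (y i)) (spin (x i))
    rw [abs_spin, abs_spin] at this
    simp only [hΔ]; linarith
  have e := energy_change hQ.symm x y
  have e1 : ∑ i, Δ i * localField Q x i = ∑ i ∈ S, Δ i * localField Q x i :=
    (Finset.sum_subset (Finset.subset_univ S) fun i _ hi => by simp [hΔ0 i hi]).symm
  have e2 : ∑ i, ∑ j, Q i j * Δ i * Δ j = ∑ i ∈ S, ∑ j ∈ S, Q i j * Δ i * Δ j := by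
    rw [← Finset.sum_subset (Finset.subset_univ S) fun i _ hi => by simp [hΔ0 i hi]]
    refine Finset.sum_congr rfl fun i _ => ?_
    rw [← Finset.sum_subset (Finset.subset_univ S) fun j _ hj => by simp [hΔ0 j hj]]
  have b1 : t * ∑ i ∈ S, Δ i - 2 * S.card * ρ ≤ ∑ i ∈ S, Δ i * localField Q x i := by
    have h : ∀ i ∈ S, -(2 * ρ) ≤ Δ i * (localField Q x i - t) := by
      intro i _
      have h1 : |Δ i * (localField Q x i - t)| ≤ 2 * ρ := by
        rw [abs_mul]; exact mul_le_mul (hΔ2 i) (hx i) (abs_nonneg _) (by norm_num)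
      exact (abs_le.1 h1).1
    have := Finset.card_nsmul_le_sum S _ _ h
    have e : ∑ i ∈ S, Δ i * (localField Q x i - t)
        = ∑ i ∈ S, Δ i * localField Q x i - t * ∑ i ∈ S, Δ i := by
      rw [Finset.mul_sum, ← Finset.sum_sub_distrib]
      exact Finset.sum_congr rfl fun i _ => by ring
    rw [e, nsmul_eq_mul] at this
    linarith
  have b2 : -(4 * S.card ^ 2 * q) ≤ ∑ i ∈ S, ∑ j ∈ S, Q i j * Δ i * Δ j := by
    have h : ∀ i ∈ S, ∀ j ∈ S, -(4 * q) ≤ Q i j * Δ i * Δ j := by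
      intro i _ j _
      have h1 : |Q i j * Δ i * Δ j| ≤ q * 2 * 2 := by
        rw [abs_mul, abs_mul, abs_of_nonneg (hQ.nonneg i j)]
        have hq := (hQ.nonneg i j).trans (hQ.le i j)
        refine mul_le_mul (mul_le_mul (hQ.le i j) (hΔ2 i) (abs_nonneg _) hq) (hΔ2 j)
          (abs_nonneg _) (by positivity)
      linarith [(abs_le.1 h1).1]
    have h2 : ∀ i ∈ S, S.card • (-(4 * q)) ≤ ∑ j ∈ S, Q i j * Δ i * Δ j := fun i hi =>
      Finset.card_nsmul_le_sum S _ _ (h i hi)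
    have := Finset.card_nsmul_le_sum S _ _ h2
    simp only [nsmul_eq_mul] at this
    linarith
  have e3 : ∑ i ∈ S, Δ i = ∑ i, spin (b i) - ∑ i : S, spin (x i) := by
    rw [← Finset.sum_coe_sort S, ← Finset.sum_sub_distrib]
    refine Finset.sum_congr rfl fun i _ => ?_
    simp only [hΔ]
    rw [show y i = b i from setOn_of_mem b x i]
  rw [isingWeight_zero, isingWeight_zero, ← Real.exp_add, ← Real.exp_add, ← Real.exp_add]
  refine Real.exp_le_exp.2 ?_
  rw [e, e2, e1]
  have h1 := mul_le_mul_of_nonneg_left b1 hβ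
  have h2 := mul_le_mul_of_nonneg_left b2 hβ
  rw [e3] at h1
  linarith

/-- Overwriting S by b is injective on configurations that agree on S, so the pointwise weight
comparison can be summed without loss. -/
theorem mass_inter_eqOn_le {β : ℝ} (hβ : 0 ≤ β) {Q : Matrix (Fin n) (Fin n) ℝ} {q : ℝ}
    (hQ : IsFerromagnetic Q q) {t ρ : ℝ} {S : Finset (Fin n)} {A G : Set (Spins (Fin n))}
    (hG : ∀ x ∈ G, ∀ i, |localField Q x i - t| ≤ ρ)
    (hA : ∀ x ∈ G, ∀ b : Spins S, setOn S b x ∈ A) (a b : Spins S) :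
    mass β Q (G ∩ eqOnEvent S a) * Real.exp (β * t * ∑ i, spin (b i))
      ≤ Real.exp (2 * β * S.card * ρ + 2 * β * S.card ^ 2 * q) *
        (Real.exp (β * t * ∑ i, spin (a i)) * mass β Q (eqOnEvent S b ∩ A)) := by
  classical
  set κ := 2 * β * S.card * ρ + 2 * β * S.card ^ 2 * q
  let F : Set (Spins (Fin n)) → Finset (Spins (Fin n)) := fun B => Finset.univ.filter (· ∈ B)
  have mem_F : ∀ {B x}, x ∈ F B ↔ x ∈ B := fun {B x} => by simp [F]
  have em : ∀ B : Set (Spins (Fin n)), mass β Q B = ∑ x ∈ F B, isingWeight β Q 0 x := by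
    intro B
    rw [mass, Finset.sum_filter]
    rfl
  rw [em, em, Finset.sum_mul, ← mul_assoc]
  calc ∑ x ∈ F (G ∩ eqOnEvent S a),
        isingWeight β Q 0 x * Real.exp (β * t * ∑ i, spin (b i))
      ≤ ∑ x ∈ F (G ∩ eqOnEvent S a),
        Real.exp κ * Real.exp (β * t * ∑ i, spin (a i)) * isingWeight β Q 0 (setOn S b x) := by
        refine Finset.sum_le_sum fun x hx => ?_
        obtain ⟨hxG, hxa⟩ := (mem_F.1 hx)
        have := weight_le_weight_setOn hβ hQ (hG x hxG) b
        have e : ∑ i : S, spin (x i) = ∑ i, spin (a i) :=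
          Finset.sum_congr rfl fun i _ => by rw [hxa i]
        rw [e] at this
        rw [mul_assoc (Real.exp κ)]; exact this
    _ = Real.exp κ * Real.exp (β * t * ∑ i, spin (a i)) *
        ∑ x ∈ (F (G ∩ eqOnEvent S a)).image (setOn S b),
          isingWeight β Q 0 x := by
        rw [← Finset.mul_sum, Finset.sum_image]
        intro x hx y hy h
        exact setOn_injOn S a b (mem_F.1 hx).2 (mem_F.1 hy).2 h
    _ ≤ _ := by
        refine mul_le_mul_of_nonneg_left ?_ (by positivity)
        refine Finset.sum_le_sum_of_subset_of_nonneg ?_ fun x _ _ => (isingWeight_pos _ _ _ _).le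
        intro y hy
        obtain ⟨x, hx, rfl⟩ := Finset.mem_image.1 hy
        refine mem_F.2 ⟨fun i => setOn_of_mem b x i, ?_⟩
        exact hA x (mem_F.1 hx).1 b

theorem sum_mass_eqOn (β : ℝ) (Q : Matrix (Fin n) (Fin n) ℝ) (S : Finset (Fin n))
    (B : Set (Spins (Fin n))) : ∑ a : Spins S, mass β Q (B ∩ eqOnEvent S a) = mass β Q B := by
  classical
  unfold mass
  rw [Finset.sum_comm]
  refine Finset.sum_congr rfl fun x _ => ?_
  rw [Finset.sum_eq_single (fun i : S => x i)]
  · by_cases hx : x ∈ B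
    · rw [Set.indicator_of_mem hx,
        Set.indicator_of_mem (show x ∈ B ∩ eqOnEvent S _ from ⟨hx, fun i => rfl⟩)]
    · rw [Set.indicator_of_notMem hx, Set.indicator_of_notMem fun h => hx h.1]
  · intro a _ ha
    refine Set.indicator_of_notMem (fun h => ha ?_) _
    funext i
    exact (h.2 i).symm
  · simp

theorem isingProb_eq_mass (β : ℝ) (Q : Matrix (Fin n) (Fin n) ℝ) (A : Set (Spins (Fin n))) :
    isingProb β Q 0 A = mass β Q A / isingZ β Q 0 := by
  rw [isingProb, mass, Finset.sum_div]
  refine Finset.sum_congr rfl fun x _ => ?_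
  by_cases hx : x ∈ A <;> simp [hx]

theorem isingCondProb_eq_mass (β : ℝ) (Q : Matrix (Fin n) (Fin n) ℝ)
    (A B : Set (Spins (Fin n))) :
    isingCondProb β Q 0 A B = mass β Q (A ∩ B) / mass β Q B := by
  rw [isingCondProb, isingProb_eq_mass, isingProb_eq_mass,
    div_div_div_cancel_right₀ (isingZ_pos β Q 0).ne']

theorem abs_sum_spin_le {ι : Type*} [Fintype ι] (b : Spins ι) :
    |∑ i, spin (b i)| ≤ Fintype.card ι := by
  refine (Finset.abs_sum_le_sum_abs _ _).trans ?_
  simp [abs_spin]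

theorem tiltedLaw_pos {ι : Type*} [Fintype ι] [DecidableEq ι] (θ : ℝ) (b : Spins ι) :
    0 < tiltedLaw θ b :=
  div_pos (Real.exp_pos _) (Finset.sum_pos (fun _ _ => Real.exp_pos _) Finset.univ_nonempty)

theorem tiltedLaw_ge {ι : Type*} [Fintype ι] [DecidableEq ι] {θ : ℝ} (hθ : 0 ≤ θ) (b : Spins ι) :
    Real.exp (-((2 * θ + 1) * Fintype.card ι)) ≤ tiltedLaw θ b := by
  have hb := (abs_le.1 (abs_sum_spin_le b)).1
  have hZ : ∑ b : Spins ι, Real.exp (θ * ∑ i, spin (b i))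
      ≤ Real.exp ((θ + 1) * Fintype.card ι) := by
    calc ∑ b : Spins ι, Real.exp (θ * ∑ i, spin (b i))
        ≤ ∑ _b : Spins ι, Real.exp (θ * Fintype.card ι) := by
          refine Finset.sum_le_sum fun b _ => Real.exp_le_exp.2 ?_
          exact mul_le_mul_of_nonneg_left (abs_le.1 (abs_sum_spin_le b)).2 hθ
      _ = 2 ^ Fintype.card ι * Real.exp (θ * Fintype.card ι) := by
          simp
      _ ≤ Real.exp 1 ^ Fintype.card ι * Real.exp (θ * Fintype.card ι) := by
          have := Real.add_one_le_exp 1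
          gcongr
          linarith
      _ = _ := by
          rw [← Real.exp_nat_mul, ← Real.exp_add]; congr 1; ring
  rw [tiltedLaw, le_div_iff₀ (Finset.sum_pos (fun _ _ => Real.exp_pos _) Finset.univ_nonempty)]
  calc _ ≤ Real.exp (-((2 * θ + 1) * Fintype.card ι)) * Real.exp ((θ + 1) * Fintype.card ι) := by
        gcongr
    _ = Real.exp (-(θ * Fintype.card ι)) := by rw [← Real.exp_add]; congr 1; ring
    _ ≤ _ := by
        refine Real.exp_le_exp.2 ?_
        nlinarith

theorem tiltedLaw_zero {ι : Type*} [Fintype ι] [DecidableEq ι] (b : Spins ι) :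
    tiltedLaw 0 b = (2 : ℝ)⁻¹ ^ Fintype.card ι := by
  simp [tiltedLaw]

/-- If on most of `A` all local fields are within `ρ` of `t`, then the conditional law of few
spins given `A` is close to the product law tilted by `β t`. -/
theorem abs_isingCondProb_div_sub_one_le {β : ℝ} (hβ : 0 ≤ β) {Q : Matrix (Fin n) (Fin n) ℝ}
    {q : ℝ} (hQ : IsFerromagnetic Q q) (hq : 0 ≤ q) {t ρ ζ : ℝ} (ht : 0 ≤ t) (hρ : 0 ≤ ρ)
    {S : Finset (Fin n)} {A G : Set (Spins (Fin n))} (hGA : G ⊆ A) (hpos : 0 < mass β Q A)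
    (hG : ∀ x ∈ G, ∀ i, |localField Q x i - t| ≤ ρ)
    (hA : ∀ x ∈ G, ∀ b : Spins S, setOn S b x ∈ A)
    (hζ : mass β Q (A \ G) ≤ ζ * mass β Q A) (b : Spins S) :
    |isingCondProb β Q 0 (eqOnEvent S b) A / tiltedLaw (β * t) b - 1|
      ≤ (Real.exp (2 * β * S.card * ρ + 2 * β * S.card ^ 2 * q) - 1)
        + ζ * Real.exp ((2 * (β * t) + 1) * S.card) := by
  set κ := 2 * β * S.card * ρ + 2 * β * S.card ^ 2 * q with hκ
  have hκ0 : 0 ≤ κ := by positivity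
  set g := tiltedLaw (β * t) b with hg
  have hg0 : 0 < g := tiltedLaw_pos _ _
  have hζ0 : 0 ≤ ζ := by
    by_contra h
    have := mass_nonneg β Q (A \ G)
    nlinarith
  set Zs := ∑ a : Spins S, Real.exp (β * t * ∑ i, spin (a i)) with hZs
  have hZs0 : 0 < Zs := Finset.sum_pos (fun _ _ => Real.exp_pos _) Finset.univ_nonempty
  set eb := Real.exp (β * t * ∑ i, spin (b i)) with heb
  have hgZ : eb = g * Zs := by rw [hg, tiltedLaw, div_mul_cancel₀ _ hZs0.ne']
  -- The exceptional mass is an additive error, while the target probability g is exponentially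
  -- small in |S|. This bound converts it into a relative error.
  have hginv : 1 ≤ g * Real.exp ((2 * (β * t) + 1) * S.card) := by
    have := tiltedLaw_ge (mul_nonneg hβ ht) b
    rw [Fintype.card_coe] at this
    calc (1 : ℝ) = Real.exp (-((2 * (β * t) + 1) * S.card)) *
          Real.exp ((2 * (β * t) + 1) * S.card) := by rw [← Real.exp_add]; simp
      _ ≤ _ := by gcongr
  have hsplit : mass β Q A ≤ mass β Q G + mass β Q (A \ G) := by
    refine (mass_mono β Q ?_).trans (mass_union_le β Q _ _)
    intro x hx
    by_cases h : x ∈ G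
    · exact Or.inl h
    · exact Or.inr ⟨hx, h⟩
  have hle : mass β Q G ≤ mass β Q A := mass_mono β Q hGA
  -- Sum over the pattern a being overwritten: the sources exhaust G and the tilts add up to the
  -- normaliser.
  have lower : mass β Q G * g ≤ Real.exp κ * mass β Q (eqOnEvent S b ∩ A) := by
    have h := Finset.sum_le_sum (s := Finset.univ) fun a (_ : a ∈ Finset.univ) =>
      mass_inter_eqOn_le hβ hQ hG hA a b
    rw [← Finset.sum_mul, sum_mass_eqOn, ← Finset.mul_sum, ← Finset.sum_mul, ← heb, ← hZs, hgZ]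
      at h
    have : mass β Q G * g * Zs ≤ Real.exp κ * mass β Q (eqOnEvent S b ∩ A) * Zs := by linarith
    exact le_of_mul_le_mul_right this hZs0
  -- The same comparison summed over the pattern being written.
  have upper : mass β Q (G ∩ eqOnEvent S b) ≤ Real.exp κ * (g * mass β Q A) := by
    have h := Finset.sum_le_sum (s := Finset.univ) fun a (_ : a ∈ Finset.univ) =>
      mass_inter_eqOn_le hβ hQ hG hA b a
    have e : ∑ a : Spins S, mass β Q (eqOnEvent S a ∩ A) = mass β Q A := by
      rw [← sum_mass_eqOn β Q S A]
      exact Finset.sum_congr rfl fun a _ => by rw [Set.inter_comm]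
    rw [← Finset.mul_sum, ← Finset.mul_sum, ← Finset.mul_sum, e, ← heb, ← hZs, hgZ] at h
    have : mass β Q (G ∩ eqOnEvent S b) * Zs ≤ Real.exp κ * (g * mass β Q A) * Zs := by linarith
    exact le_of_mul_le_mul_right this hZs0
  have upper' : mass β Q (eqOnEvent S b ∩ A)
      ≤ Real.exp κ * (g * mass β Q A) + ζ * mass β Q A := by
    refine le_trans ?_ (add_le_add upper hζ)
    refine (mass_mono β Q ?_).trans (mass_union_le β Q _ _)
    rintro x ⟨hxb, hxA⟩
    by_cases h : x ∈ G
    · exact Or.inl ⟨h, hxb⟩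
    · exact Or.inr ⟨hxA, h⟩
  set E := Real.exp ((2 * (β * t) + 1) * S.card) with hE
  have hE1 : 1 ≤ E := Real.one_le_exp (by positivity)
  have hek : 1 ≤ Real.exp κ := Real.one_le_exp hκ0
  set mA := mass β Q A
  set p := mass β Q (eqOnEvent S b ∩ A)
  have hp0 : 0 ≤ p := mass_nonneg _ _ _
  rw [isingCondProb_eq_mass, div_div, abs_le]
  have hmg : 0 < mA * g := mul_pos hpos hg0
  constructor
  · have h2 : mA * (1 - ζ) * g ≤ Real.exp κ * p := by
      refine le_trans ?_ lower
      gcongr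
      linarith
    have h3 : (1 - ζ) ≤ Real.exp κ * (p / (mA * g)) := by
      rw [← mul_div_assoc, le_div_iff₀ hmg]; linarith
    set r := p / (mA * g)
    have hr0 : 0 ≤ r := by positivity
    have h5 : ζ ≤ ζ * E := le_mul_of_one_le_right hζ0 hE1
    by_cases hr1 : 1 ≤ r
    · have : 0 ≤ ζ * E := by positivity
      linarith
    · push Not at hr1
      nlinarith
  · have : p / (mA * g) ≤ Real.exp κ + ζ * E := by
      rw [div_le_iff₀ hmg]
      refine upper'.trans ?_
      have : ζ * mA ≤ ζ * mA * (g * E) := le_mul_of_one_le_right (by positivity) hginv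
      linarith
    linarith

end Ising

namespace Ising

variable {n : ℕ}

/-! ### Graph couplings -/

theorem vertexDegree_nonneg (G : SimpleGraph (Fin n)) (i : Fin n) : 0 ≤ vertexDegree G i :=
  Nat.cast_nonneg _

theorem avgDegree_nonneg (G : SimpleGraph (Fin n)) : 0 ≤ avgDegree G :=
  div_nonneg (Finset.sum_nonneg fun i _ => vertexDegree_nonneg G i) (Nat.cast_nonneg _)

theorem avgDegree_le (G : SimpleGraph (Fin n)) : avgDegree G ≤ n := by
  classical
  rcases Nat.eq_zero_or_pos n with rfl | hn
  · simp [avgDegree]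
  rw [avgDegree, div_le_iff₀ (by exact_mod_cast hn)]
  calc ∑ i, vertexDegree G i ≤ ∑ _i : Fin n, (n : ℝ) := by
        refine Finset.sum_le_sum fun i _ => ?_
        rw [vertexDegree]
        have := G.degree_lt_card_verts i
        rw [Fintype.card_fin] at this
        exact_mod_cast this.le
    _ = _ := by simp

theorem sum_coupling (G : SimpleGraph (Fin n)) (i : Fin n) :
    ∑ j, coupling G i j = vertexDegree G i / avgDegree G := by
  classical
  simp only [coupling, Matrix.smul_apply, SimpleGraph.adjMatrix_apply, smul_eq_mul]
  rw [← Finset.mul_sum, Finset.sum_boole, div_eq_inv_mul, vertexDegree,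
    ← SimpleGraph.card_neighborFinset_eq_degree, SimpleGraph.neighborFinset_eq_filter]

theorem abs_sum_coupling_sub_one_le (G : SimpleGraph (Fin n)) (i : Fin n) :
    |∑ j, coupling G i j - 1| ≤ degreeDeviation G := by
  rw [sum_coupling]
  exact le_ciSup (f := fun i => |vertexDegree G i / avgDegree G - 1|)
    (Set.finite_range _).bddAbove i

theorem degreeDeviation_nonneg (G : SimpleGraph (Fin n)) : 0 ≤ degreeDeviation G :=
  Real.iSup_nonneg fun _ => abs_nonneg _

theorem isFerromagnetic_coupling {G : SimpleGraph (Fin n)} (hdev : degreeDeviation G ≤ 1) :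
    IsFerromagnetic (coupling G) (avgDegree G)⁻¹ where
  symm i j := by
    simpa using ((coupling_isHermitian G).apply i j).symm
  diag i := by simp [coupling, SimpleGraph.adjMatrix_apply]
  nonneg i j := by
    have := avgDegree_nonneg G
    simp only [coupling, Matrix.smul_apply, SimpleGraph.adjMatrix_apply, smul_eq_mul]
    split_ifs <;> simp [this]
  le i j := by
    have := avgDegree_nonneg G
    simp only [coupling, Matrix.smul_apply, SimpleGraph.adjMatrix_apply, smul_eq_mul]
    split_ifs <;> simp [this]
  row i := by
    have := (abs_le.1 (abs_sum_coupling_sub_one_le G i)).2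
    linarith

/-! ### Reduction to uniform control of the local fields -/

/-- `sup_{|S| = s, a} |P(X_S = a | A) / g(a) - 1|` for the product law `g` tilted by `β t`. -/
noncomputable def condError (β t : ℝ) (Q : Matrix (Fin n) (Fin n) ℝ) (A : Set (Spins (Fin n)))
    (s : ℕ) : ℝ :=
  ⨆ p : (S : {S : Finset (Fin n) // S.card = s}) × Spins S.1,
    |isingCondProb β Q 0 (eqOnEvent p.1.1 p.2) A / tiltedLaw (β * t) p.2 - 1|

theorem uniformError_eq_condError (β : ℝ) (G : SimpleGraph (Fin n)) (s : ℕ) :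
    uniformError β G s = condError β 0 (coupling G) Set.univ s := by
  unfold uniformError condError
  congr 1
  funext p
  rw [isingCondProb_eq_mass, isingProb_eq_mass, mass_univ, Set.inter_univ, mul_zero,
    tiltedLaw_zero, Fintype.card_coe, p.1.2]

/-- With s ≤ c log n, a field tolerance ε/log n costs O(ε) in the exponent, and the second-order
term costs s²/d̄ = o(1). Product probabilities are at least n^{-(2βt+1)c}, so an exceptional
fraction n^{-K} with K large is negligible. -/
theorem tendsto_condError (G : ∀ n : ℕ, SimpleGraph (Fin n))
    (hreg : Tendsto (fun n => degreeDeviation (G n)) atTop (𝓝 0))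
    {c : ℝ} (hc : 0 < c) {s : ℕ → ℕ} (hs : ∀ᶠ n : ℕ in atTop, (s n : ℝ) ≤ c * Real.log n)
    {β : ℝ} (hβ : 0 ≤ β) {t : ℝ} (ht : 0 ≤ t)
    (hd : (fun n : ℕ => Real.log n ^ 2) =o[atTop] (fun n => avgDegree (G n)))
    (A : ∀ n, Set (Spins (Fin n)))
    (H : ∀ ε > 0, ∀ K > 0, ∀ᶠ n : ℕ in atTop, 0 < mass β (coupling (G n)) (A n) ∧
      ∃ B ⊆ A n, (∀ x ∈ B, ∀ i, |localField (coupling (G n)) x i - t| ≤ ε / Real.log n) ∧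
        (∀ x ∈ B, ∀ S : Finset (Fin n), S.card = s n → ∀ b : Spins S, setOn S b x ∈ A n) ∧
        mass β (coupling (G n)) (A n \ B)
          ≤ Real.exp (-(K * Real.log n)) * mass β (coupling (G n)) (A n)) :
    Tendsto (fun n => condError β t (coupling (G n)) (A n) (s n)) atTop (𝓝 0) := by
  have hnn : ∀ n, 0 ≤ condError β t (coupling (G n)) (A n) (s n) := fun n =>
    Real.iSup_nonneg fun _ => abs_nonneg _
  rw [Metric.tendsto_atTop']
  suffices h : ∀ η > 0, ∀ᶠ n in atTop, condError β t (coupling (G n)) (A n) (s n) ≤ η by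
    intro η hη
    obtain ⟨N, hN⟩ := eventually_atTop.1 (h (η / 2) (by positivity))
    refine ⟨N, fun n hn => ?_⟩
    rw [Real.dist_eq, sub_zero, abs_of_nonneg (hnn n)]
    linarith [hN n hn.le]
  intro η hη
  -- Budget: each of the two exponent terms gets δ/2, so that the multiplicative error is at most
  -- η/2. The extra 1 in K leaves an error 1/n for the exceptional event.
  set δ := Real.log (1 + η / 2) with hδ
  have hδ0 : 0 < δ := Real.log_pos (by linarith)
  set ε := δ / (4 * β * c + 1) with hε
  have hε0 : 0 < ε := by positivity
  set K := (2 * (β * t) + 1) * c + 1 with hK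
  have hlog : Tendsto (fun n : ℕ => Real.log n) atTop atTop :=
    Real.tendsto_log_atTop.comp tendsto_natCast_atTop_atTop
  have hinv : Tendsto (fun n : ℕ => ((n : ℝ))⁻¹) atTop (𝓝 0) := tendsto_inv_atTop_nhds_zero_nat
  have hd' := hd.bound (show 0 < δ / (4 * β * c ^ 2 + 1) by positivity)
  filter_upwards [hs, H ε hε0 K (by positivity), hreg.eventually (eventually_le_nhds one_pos),
    hlog.eventually_ge_atTop 1, hd', hinv.eventually (eventually_le_nhds (half_pos hη)),
    eventually_gt_atTop 0] with n hs ⟨hA, B, hBA, hB1, hB2, hB3⟩ hdev hl hd' hinv hn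
  refine Real.iSup_le (fun p => ?_) hη.le
  have hFe := isFerromagnetic_coupling hdev
  set d := avgDegree (G n)
  have hd0 : 0 ≤ d := avgDegree_nonneg _
  have hcard : p.1.1.card = s n := p.1.2
  refine (abs_isingCondProb_div_sub_one_le hβ hFe (by positivity) ht (by positivity) hBA hA hB1
    (fun x hx b => hB2 x hx p.1.1 hcard b) hB3 p.2).trans ?_
  rw [hcard]
  rw [Real.norm_of_nonneg (by positivity), Real.norm_of_nonneg hd0] at hd'
  have hdpos : 0 < d := by
    rcases hd0.lt_or_eq with h | h
    · exact h
    · rw [← h, mul_zero] at hd'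
      have : (0 : ℝ) < Real.log n ^ 2 := by positivity
      linarith
  have hs0 : (0 : ℝ) ≤ s n := Nat.cast_nonneg _
  have k1 : 2 * β * s n * (ε / Real.log n) ≤ δ / 2 := by
    calc 2 * β * s n * (ε / Real.log n) ≤ 2 * β * (c * Real.log n) * (ε / Real.log n) := by
          gcongr
      _ = 2 * β * c * ε := by field_simp
      _ ≤ δ / 2 := by
          rw [hε, ← mul_div_assoc, div_le_iff₀ (by positivity)]
          nlinarith
  have k2 : 2 * β * (s n : ℝ) ^ 2 * d⁻¹ ≤ δ / 2 := by
    rw [← div_eq_mul_inv, div_le_iff₀ hdpos]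
    calc 2 * β * (s n : ℝ) ^ 2 ≤ 2 * β * (c * Real.log n) ^ 2 := by gcongr
      _ = 2 * β * c ^ 2 * Real.log n ^ 2 := by ring
      _ ≤ 2 * β * c ^ 2 * (δ / (4 * β * c ^ 2 + 1) * d) := by gcongr
      _ ≤ δ / 2 * d := by
          rw [← mul_assoc]
          gcongr
          rw [← mul_div_assoc, div_le_iff₀ (by positivity)]
          nlinarith
  have k3 : Real.exp (2 * β * s n * (ε / Real.log n) + 2 * β * (s n : ℝ) ^ 2 * d⁻¹)
      ≤ 1 + η / 2 := by
    rw [← Real.exp_log (show 0 < 1 + η / 2 by positivity)]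
    exact Real.exp_le_exp.2 (by linarith)
  have k4 : Real.exp (-(K * Real.log n)) * Real.exp ((2 * (β * t) + 1) * s n) ≤ η / 2 := by
    rw [← Real.exp_add]
    refine le_trans ?_ hinv
    rw [← Real.exp_log (show (0 : ℝ) < n by exact_mod_cast hn), ← Real.exp_neg,
      Real.log_exp]
    refine Real.exp_le_exp.2 ?_
    have : (2 * (β * t) + 1) * s n ≤ (2 * (β * t) + 1) * (c * Real.log n) := by gcongr
    rw [hK]; linarith
  linarith

/-- Configurations for which all mean-field equations hold up to `r`. -/
def nearMeanField (β : ℝ) (Q : Matrix (Fin n) (Fin n) ℝ) (r : ℝ) : Set (Spins (Fin n)) :=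
  {x | ∀ i, |localField Q x i - ∑ j, Q i j * Real.tanh (β * localField Q x j)| < r}

/-- At tolerance a/(log n)^k the tail exponent is of order d̄/(log n)^{2k}. It must beat every
multiple of log n, hence d̄ ≫ (log n)^{2k+1}. -/
theorem eventually_mass_nearMeanField (G : ∀ n : ℕ, SimpleGraph (Fin n))
    (hreg : Tendsto (fun n => degreeDeviation (G n)) atTop (𝓝 0))
    {β : ℝ} (hβ : 0 ≤ β) {k m : ℕ} (hkm : 2 * k + 1 ≤ m)
    (hd : (fun n : ℕ => Real.log n ^ m) =o[atTop] (fun n => avgDegree (G n)))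
    {a : ℝ} (ha : 0 < a) {K : ℝ} (hK : 0 < K) :
    ∀ᶠ n : ℕ in atTop, mass β (coupling (G n))
        (nearMeanField β (coupling (G n)) (a / Real.log n ^ k))ᶜ
      ≤ Real.exp (-(K * Real.log n)) * isingZ β (coupling (G n)) 0 := by
  have hlog : Tendsto (fun n : ℕ => Real.log n) atTop atTop :=
    Real.tendsto_log_atTop.comp tendsto_natCast_atTop_atTop
  have hd' := hd.bound (show 0 < a ^ 2 / ((K + 2) * (16 * (1 + 2 * β))) by positivity)
  filter_upwards [hreg.eventually (eventually_le_nhds one_pos), hlog.eventually_ge_atTop 1, hd',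
    eventually_ge_atTop 2] with n hdev hl hd' hn
  have hn' : (2 : ℝ) ≤ n := by exact_mod_cast hn
  set L := Real.log n
  set d := avgDegree (G n)
  have hd0 : 0 ≤ d := avgDegree_nonneg _
  rw [Real.norm_of_nonneg (by positivity), Real.norm_of_nonneg hd0] at hd'
  have hdpos : 0 < d := by
    rcases hd0.lt_or_eq with h | h
    · exact h
    · rw [← h, mul_zero] at hd'
      have : (0 : ℝ) < L ^ m := by positivity
      linarith
  have hLm : L ^ (2 * k + 1) ≤ L ^ m := pow_le_pow_right₀ hl hkm
  have hF := isFerromagnetic_coupling hdev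
  have h1 := mass_localField_le hβ hF (inv_pos.2 hdpos)
    (show 0 ≤ a / L ^ k by positivity)
  have hset : (nearMeanField β (coupling (G n)) (a / L ^ k))ᶜ =
      {x | ∃ i, a / L ^ k ≤ |localField (coupling (G n)) x i
        - ∑ j, coupling (G n) i j * Real.tanh (β * localField (coupling (G n)) x j)|} := by
    ext x
    simp [nearMeanField]
  rw [hset]
  refine h1.trans ?_
  have hZ := isingZ_pos β (coupling (G n)) 0
  refine mul_le_mul_of_nonneg_right ?_ hZ.le
  -- The surplus 2 absorbs two factors n: one from the union over vertices, one bounding the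
  -- constant 2.
  have h2 : (K + 2) * L ≤ (a / L ^ k) ^ 2 / (16 * (1 + 2 * β) * d⁻¹) := by
    rw [le_div_iff₀ (by positivity), div_pow, le_div_iff₀ (by positivity)]
    have h3 : L ^ (2 * k + 1) * ((K + 2) * (16 * (1 + 2 * β))) ≤ a ^ 2 * d := by
      have := hLm.trans hd'
      rw [div_mul_eq_mul_div, le_div_iff₀ (by positivity)] at this
      exact this
    calc (K + 2) * L * (16 * (1 + 2 * β) * d⁻¹) * (L ^ k) ^ 2
        = L ^ (2 * k + 1) * ((K + 2) * (16 * (1 + 2 * β))) * d⁻¹ := by ring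
      _ ≤ a ^ 2 * d * d⁻¹ := by gcongr
      _ = a ^ 2 := by field_simp
  have hnexp : (n : ℝ) = Real.exp L := (Real.exp_log (by linarith)).symm
  calc (n : ℝ) * (2 * Real.exp (-((a / L ^ k) ^ 2 / (16 * (1 + 2 * β) * d⁻¹))))
      ≤ n * (n * Real.exp (-((K + 2) * L))) := by gcongr
    _ = Real.exp (-(K * L)) := by
        rw [hnexp, ← Real.exp_add, ← Real.exp_add]; congr 1; ring

/-- The largest local field satisfies the scalar mean-field inequality. -/
theorem exists_max_localField {β : ℝ} (hβ : 0 ≤ β) {Q : Matrix (Fin n) (Fin n) ℝ} {q e r : ℝ}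
    (hQ : IsFerromagnetic Q q) (hrow : ∀ i, ∑ j, Q i j ≤ 1 + e)
    {x : Spins (Fin n)} (hx : x ∈ nearMeanField β Q r) (hn : 0 < n) :
    ∃ M, 0 ≤ M ∧ M ≤ 2 ∧ (∀ i, |localField Q x i| ≤ M) ∧ M ≤ (1 + e) * Real.tanh (β * M) + r := by
  have : Nonempty (Fin n) := ⟨⟨0, hn⟩⟩
  obtain ⟨i, hi⟩ := Finite.exists_max fun i => |localField Q x i|
  refine ⟨|localField Q x i|, abs_nonneg _, ?_, hi, ?_⟩
  · calc |localField Q x i| ≤ ∑ j, |Q i j * spin (x j)| := Finset.abs_sum_le_sum_abs _ _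
      _ = ∑ j, Q i j := Finset.sum_congr rfl fun j _ => by
          rw [abs_mul, abs_spin, mul_one, abs_of_nonneg (hQ.nonneg i j)]
      _ ≤ 2 := hQ.row i
  · set T := Real.tanh (β * |localField Q x i|)
    have hT : 0 ≤ T := tanh_nonneg (by positivity)
    have h1 : |∑ j, Q i j * Real.tanh (β * localField Q x j)| ≤ (1 + e) * T := by
      calc |∑ j, Q i j * Real.tanh (β * localField Q x j)|
          ≤ ∑ j, |Q i j * Real.tanh (β * localField Q x j)| := Finset.abs_sum_le_sum_abs _ _
        _ ≤ ∑ j, Q i j * T := by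
            refine Finset.sum_le_sum fun j _ => ?_
            rw [abs_mul, abs_of_nonneg (hQ.nonneg i j)]
            refine mul_le_mul_of_nonneg_left ?_ (hQ.nonneg i j)
            refine (abs_tanh_le_tanh_abs _).trans (tanh_monotone ?_)
            rw [abs_mul, abs_of_nonneg hβ]
            exact mul_le_mul_of_nonneg_left (hi j) hβ
        _ = (∑ j, Q i j) * T := by rw [Finset.sum_mul]
        _ ≤ _ := by gcongr; exact hrow i
    have h2 := (hx i).le
    have h3 := abs_sub_abs_le_abs_sub (localField Q x i)
      (∑ j, Q i j * Real.tanh (β * localField Q x j))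
    linarith

/-! ### High temperature and criticality -/

theorem isBigO_log_pow {k m : ℕ} (h : k ≤ m) :
    (fun n : ℕ => Real.log n ^ k) =O[atTop] (fun n : ℕ => Real.log n ^ m) := by
  have hlog : Tendsto (fun n : ℕ => Real.log n) atTop atTop :=
    Real.tendsto_log_atTop.comp tendsto_natCast_atTop_atTop
  refine IsBigO.of_bound 1 ?_
  filter_upwards [hlog.eventually_ge_atTop 1] with n hl
  rw [Real.norm_of_nonneg (by positivity), Real.norm_of_nonneg (by positivity), one_mul]
  exact pow_le_pow_right₀ hl h

/-- Case t = 0 of the reduction: the tilted law is uniform, and with nothing to condition on,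
resetting spins cannot leave the event. -/
theorem tendsto_uniformError_of_localField (G : ∀ n : ℕ, SimpleGraph (Fin n))
    (hreg : Tendsto (fun n => degreeDeviation (G n)) atTop (𝓝 0))
    {c : ℝ} (hc : 0 < c) {s : ℕ → ℕ} (hs : ∀ᶠ n : ℕ in atTop, (s n : ℝ) ≤ c * Real.log n)
    {β : ℝ} (hβ : 0 ≤ β) {k m : ℕ} (hkm : 2 * k + 1 ≤ m) (hm : 2 ≤ m)
    (hd : (fun n : ℕ => Real.log n ^ m) =o[atTop] (fun n => avgDegree (G n)))
    (H : ∀ ε > 0, ∃ a > 0, ∀ᶠ n : ℕ in atTop,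
      ∀ x ∈ nearMeanField β (coupling (G n)) (a / Real.log n ^ k),
        ∀ i, |localField (coupling (G n)) x i| ≤ ε / Real.log n) :
    Tendsto (fun n => uniformError β (G n) (s n)) atTop (𝓝 0) := by
  simp_rw [uniformError_eq_condError]
  refine tendsto_condError G hreg hc hs hβ le_rfl ((isBigO_log_pow hm).trans_isLittleO hd)
    (fun _ => Set.univ) fun ε hε K hK => ?_
  obtain ⟨a, ha, h⟩ := H ε hε
  filter_upwards [h, eventually_mass_nearMeanField G hreg hβ hkm hd ha hK] with n h h'
  rw [mass_univ]
  refine ⟨isingZ_pos _ _ _, nearMeanField β (coupling (G n)) (a / Real.log n ^ k),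
    Set.subset_univ _, fun x hx i => ?_, fun _ _ _ _ _ => Set.mem_univ _, ?_⟩
  · rw [sub_zero]; exact h x hx i
  · rwa [← Set.compl_eq_univ_sdiff]

/-- Since tanh x ≤ x, the largest field satisfies M ≤ (1 + e)βM + r. For e ≤ (1 - β)/2 the slope is
at most 1 - (1 - β)/2, so M ≤ 2r/(1 - β). -/
theorem tendsto_uniformError_of_lt_one (G : ∀ n : ℕ, SimpleGraph (Fin n))
    (hreg : Tendsto (fun n => degreeDeviation (G n)) atTop (𝓝 0))
    {c : ℝ} (hc : 0 < c) {s : ℕ → ℕ} (hs : ∀ᶠ n : ℕ in atTop, (s n : ℝ) ≤ c * Real.log n)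
    {β : ℝ} (hβ : 0 ≤ β) (hβ1 : β < 1)
    (hd : (fun n : ℕ => Real.log n ^ 4) =o[atTop] (fun n => avgDegree (G n))) :
    Tendsto (fun n => uniformError β (G n) (s n)) atTop (𝓝 0) := by
  refine tendsto_uniformError_of_localField G hreg hc hs hβ (k := 1) (by norm_num) (by norm_num)
    hd fun ε hε => ⟨ε * ((1 - β) / 2), by have := sub_pos.2 hβ1; positivity, ?_⟩
  have hlog : Tendsto (fun n : ℕ => Real.log n) atTop atTop :=
    Real.tendsto_log_atTop.comp tendsto_natCast_atTop_atTop
  have h0 : 0 < (1 - β) / 2 := by linarith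
  filter_upwards [hreg.eventually (eventually_le_nhds h0), eventually_gt_atTop 0,
    hreg.eventually (eventually_le_nhds one_pos), hlog.eventually_ge_atTop 1]
    with n hdev hn hdev1 hl x hx i
  have hF := isFerromagnetic_coupling hdev1
  obtain ⟨M, hM0, -, hM, hM'⟩ := exists_max_localField (e := degreeDeviation (G n)) hβ hF
    (fun i => by linarith [(abs_le.1 (abs_sum_coupling_sub_one_le (G n) i)).2]) hx hn
  refine (hM i).trans ?_
  rw [pow_one] at hM'
  set e := degreeDeviation (G n)
  have he : 0 ≤ e := degreeDeviation_nonneg _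
  have h1 : (1 + e) * Real.tanh (β * M) ≤ (1 + (1 - β) / 2) * (β * M) :=
    mul_le_mul (by linarith) (tanh_le_self (by positivity)) (tanh_nonneg (by positivity))
      (by linarith)
  have h2 : M * ((1 - β) / 2) ≤ ε * ((1 - β) / 2) / Real.log n := by
    have : 0 ≤ M * (1 - β) * (1 - β) := by
      have : 0 ≤ 1 - β := by linarith
      positivity
    nlinarith
  rw [mul_div_right_comm] at h2
  exact le_of_mul_le_mul_right h2 h0

theorem tanh_ge_quarter {x : ℝ} (hx0 : 0 ≤ x) (hx : x ≤ 2) : x / 4 ≤ Real.tanh x := by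
  rw [Real.tanh_eq_sinh_div_cosh, le_div_iff₀ (Real.cosh_pos x)]
  rcases le_total x 1 with h1 | h1
  · have h2 : Real.cosh x ≤ 2 := by
      refine (Real.cosh_le_exp_half_sq x).trans ?_
      have : Real.exp (x ^ 2 / 2) ≤ Real.exp (1 / 2) := Real.exp_le_exp.2 (by nlinarith)
      refine this.trans ?_
      have h3 : Real.exp (1 / 2) ^ 2 = Real.exp 1 := by
        rw [← Real.exp_nat_mul]; norm_num
      have := Real.exp_one_lt_d9
      nlinarith [Real.exp_pos (1 / 2)]
    have := Real.self_le_sinh_iff.2 hx0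
    nlinarith
  · have h2 : Real.cosh x ≤ 2 * Real.sinh x := by
      rw [Real.cosh_eq, Real.sinh_eq]
      have h3 : Real.exp x * Real.exp (-x) = 1 := by rw [← Real.exp_add]; simp
      have h4 := Real.add_one_le_exp x
      have h5 := Real.exp_pos (-x)
      nlinarith
    have := Real.sinh_nonneg_iff.2 hx0
    nlinarith

/-- The gap has derivative tanh² y - y²/16, nonnegative by the crude linear lower bound for tanh. At
criticality this cubic term is the only restoring force. -/
theorem tanh_le_sub_cube {x : ℝ} (hx0 : 0 ≤ x) (hx : x ≤ 2) :
    Real.tanh x ≤ x - x ^ 3 / 48 := by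
  have hd : ∀ y, HasDerivAt (fun y => y - y ^ 3 / 48 - Real.tanh y)
      (1 - y ^ 2 / 16 - (1 - Real.tanh y ^ 2)) y := by
    intro y
    have := (((hasDerivAt_id y).sub (((hasDerivAt_id y).pow 3).div_const 48))).sub
      (hasDerivAt_tanh y)
    convert! this using 1
    push_cast
    simp only [id]
    ring
  have hm : MonotoneOn (fun y => y - y ^ 3 / 48 - Real.tanh y) (Set.Icc 0 2) := by
    refine monotoneOn_of_deriv_nonneg (convex_Icc 0 2)
      (fun y _ => (hd y).continuousAt.continuousWithinAt)
      (fun y _ => (hd y).differentiableAt.differentiableWithinAt) fun y hy => ?_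
    rw [interior_Icc] at hy
    rw [(hd y).deriv]
    have := tanh_ge_quarter hy.1.le hy.2.le
    nlinarith [hy.1]
  have := hm ⟨le_rfl, by norm_num⟩ ⟨hx0, hx⟩ hx0
  simp only [Real.tanh_zero] at this
  norm_num at this
  linarith

/-- α_n (log n)^k is the square root of (log n)^{2k+1}/d̄. -/
theorem alphaRate_pow_tendsto (G : ∀ n : ℕ, SimpleGraph (Fin n)) {k m : ℕ} (hm : 2 * k + 1 ≤ m)
    (hO : (fun n => degreeDeviation (G n)) =O[atTop] (fun n => alphaRate (G n)))
    (hd : (fun n : ℕ => Real.log n ^ m) =o[atTop] (fun n => avgDegree (G n))) :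
    Tendsto (fun n : ℕ => degreeDeviation (G n) * Real.log n ^ k) atTop (𝓝 0) := by
  have hd' : (fun n : ℕ => Real.log n ^ (2 * k + 1)) =o[atTop] (fun n => avgDegree (G n)) :=
    (isBigO_log_pow hm).trans_isLittleO hd
  have h1 : (fun n : ℕ => degreeDeviation (G n) * Real.log n ^ k) =O[atTop]
      (fun n : ℕ => alphaRate (G n) * Real.log n ^ k) := hO.mul (isBigO_refl _ _)
  refine h1.trans_tendsto ?_
  have h2 := hd'.tendsto_div_nhds_zero
  have h3 : Tendsto (fun n : ℕ => Real.sqrt (Real.log n ^ (2 * k + 1) / avgDegree (G n))) atTop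
      (𝓝 0) := by
    have := (Real.continuous_sqrt.tendsto 0).comp h2
    rwa [Real.sqrt_zero] at this
  refine h3.congr' ?_
  filter_upwards [eventually_ge_atTop 1] with n hn
  have hl : 0 ≤ Real.log n := Real.log_natCast_nonneg n
  rw [alphaRate, show Real.log n ^ (2 * k + 1) / avgDegree (G n)
    = Real.log n / avgDegree (G n) * (Real.log n ^ k) ^ 2 by ring,
    Real.sqrt_mul (div_nonneg hl (avgDegree_nonneg _)), Real.sqrt_sq (by positivity)]

theorem tendsto_uniformError_of_eq_one (G : ∀ n : ℕ, SimpleGraph (Fin n))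
    (hreg : Tendsto (fun n => degreeDeviation (G n)) atTop (𝓝 0))
    {c : ℝ} (hc : 0 < c) {s : ℕ → ℕ} (hs : ∀ᶠ n : ℕ in atTop, (s n : ℝ) ≤ c * Real.log n)
    (hO : (fun n => degreeDeviation (G n)) =O[atTop] (fun n => alphaRate (G n)))
    (hd : (fun n : ℕ => Real.log n ^ 10) =o[atTop] (fun n => avgDegree (G n))) :
    Tendsto (fun n => uniformError 1 (G n) (s n)) atTop (𝓝 0) := by
  -- The critical inequality reads M³/48 ≤ 2e + r. To get M ≤ ε/log n both errors must be of order
  -- (log n)^{-3}, hence k = 3; r = ε³/96 and e ≤ ε³/192, in these units, each use half of ε³/48.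
  refine tendsto_uniformError_of_localField G hreg hc hs zero_le_one (k := 3) (by norm_num)
    (by norm_num) hd fun ε hε => ⟨ε ^ 3 / 96, by positivity, ?_⟩
  have hlog : Tendsto (fun n : ℕ => Real.log n) atTop atTop :=
    Real.tendsto_log_atTop.comp tendsto_natCast_atTop_atTop
  have hdl := alphaRate_pow_tendsto G (k := 3) (by norm_num) hO hd
  filter_upwards [hdl.eventually (eventually_le_nhds (show 0 < ε ^ 3 / 192 by positivity)),
    eventually_gt_atTop 0, hreg.eventually (eventually_le_nhds one_pos),
    hlog.eventually_ge_atTop 1] with n hdev hn hdev1 hl x hx i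
  have hF := isFerromagnetic_coupling hdev1
  obtain ⟨M, hM0, hM2, hM, hM'⟩ := exists_max_localField (e := degreeDeviation (G n))
    zero_le_one hF
    (fun i => by linarith [(abs_le.1 (abs_sum_coupling_sub_one_le (G n) i)).2]) hx hn
  refine (hM i).trans ?_
  set e := degreeDeviation (G n)
  have he : 0 ≤ e := degreeDeviation_nonneg _
  set L := Real.log n
  rw [one_mul] at hM'
  have h1 := tanh_le_sub_cube hM0 hM2
  have h2 : e ≤ ε ^ 3 / 192 / L ^ 3 := by rw [le_div_iff₀ (by positivity)]; exact hdev
  have h3 : e * Real.tanh M ≤ e * 2 := by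
    gcongr
    exact (Real.tanh_lt_one M).le.trans (by norm_num)
  have h4 : M ^ 3 ≤ (ε / L) ^ 3 := by
    rw [div_pow]
    have e1 : ε ^ 3 / 192 / L ^ 3 = ε ^ 3 / L ^ 3 / 192 := by ring
    have e2 : ε ^ 3 / 96 / L ^ 3 = ε ^ 3 / L ^ 3 / 96 := by ring
    rw [e1] at h2
    rw [e2] at hM'
    linarith
  exact le_of_pow_le_pow_left₀ (by norm_num) (by positivity) h4

end Ising

namespace Ising

open MeasureTheory Matrix

variable {ι : Type*} [Fintype ι] [DecidableEq ι]

/-! ### Eigenbases in coordinates -/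

/-- `w` is an orthonormal basis in which the real symmetric matrix `A` is diagonal, with
eigenvalues `ev`. -/
structure IsEigenbasis (A : Matrix ι ι ℝ) (ev : ι → ℝ) (w : ι → ι → ℝ) : Prop where
  ortho : ∀ k l, w k ⬝ᵥ w l = if k = l then 1 else 0
  complete : ∀ i j, ∑ k, w k i * w k j = if i = j then 1 else 0
  repr : ∀ i j, A i j = ∑ k, ev k * w k i * w k j

theorem exists_isEigenbasis {A : Matrix ι ι ℝ} (hA : A.IsHermitian) :
    ∃ w, IsEigenbasis A hA.eigenvalues w := by
  set U : Matrix ι ι ℝ := hA.eigenvectorUnitary.1 with hU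
  have h1 : Uᵀ * U = 1 := by
    have := Unitary.coe_star_mul_self hA.eigenvectorUnitary
    rwa [star_eq_conjTranspose, conjTranspose_eq_transpose_of_trivial] at this
  have h2 : U * Uᵀ = 1 := mul_eq_one_comm.1 h1
  have h3 : A = U * diagonal hA.eigenvalues * Uᵀ := by
    have := hA.spectral_theorem
    rw [Unitary.conjStarAlgAut_apply] at this
    rw [star_eq_conjTranspose, conjTranspose_eq_transpose_of_trivial] at this
    exact this
  refine ⟨fun k i => U i k, ⟨fun k l => ?_, fun i j => ?_, fun i j => ?_⟩⟩
  · have := congrFun (congrFun h1 k) l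
    rw [mul_apply, one_apply] at this
    exact this
  · have := congrFun (congrFun h2 i) j
    rw [mul_apply, one_apply] at this
    exact this
  · have := congrFun (congrFun h3 i) j
    rw [mul_apply] at this
    rw [this]
    refine Finset.sum_congr rfl fun k _ => ?_
    rw [mul_diagonal, transpose_apply]
    ring

namespace IsEigenbasis

variable {A : Matrix ι ι ℝ} {ev : ι → ℝ} {w : ι → ι → ℝ}

theorem sum_mul_mul (h : IsEigenbasis A ev w) (u v : ι → ℝ) :
    u ⬝ᵥ (A *ᵥ v) = ∑ k, ev k * (w k ⬝ᵥ u) * (w k ⬝ᵥ v) := by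
  simp only [dotProduct, mulVec, h.repr]
  simp_rw [Finset.mul_sum, Finset.sum_mul, Finset.mul_sum]
  rw [Finset.sum_comm]
  conv_rhs => rw [Finset.sum_comm]
  conv_lhs => enter [2, j]; rw [Finset.sum_comm]
  refine Finset.sum_congr rfl fun j _ => ?_
  refine Finset.sum_congr rfl fun k _ => ?_
  refine Finset.sum_congr rfl fun i _ => ?_
  ring

theorem one (h : IsEigenbasis A ev w) : IsEigenbasis 1 (fun _ => 1) w where
  ortho := h.ortho
  complete := h.complete
  repr i j := by simp [h.complete, one_apply]

/-- Parseval, read off as the quadratic-form identity for the identity matrix. -/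
theorem dot_eq (h : IsEigenbasis A ev w) (u v : ι → ℝ) :
    u ⬝ᵥ v = ∑ k, (w k ⬝ᵥ u) * (w k ⬝ᵥ v) := by
  have := h.one.sum_mul_mul u v
  simpa using this

theorem dot_self (h : IsEigenbasis A ev w) (v : ι → ℝ) : v ⬝ᵥ v = ∑ k, (w k ⬝ᵥ v) ^ 2 := by
  rw [h.dot_eq v v]
  exact Finset.sum_congr rfl fun k _ => by ring

theorem quad (h : IsEigenbasis A ev w) (v : ι → ℝ) :
    v ⬝ᵥ (A *ᵥ v) = ∑ k, ev k * (w k ⬝ᵥ v) ^ 2 := by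
  rw [h.sum_mul_mul v v]
  exact Finset.sum_congr rfl fun k _ => by ring

theorem dot_mulVec (h : IsEigenbasis A ev w) (k : ι) (v : ι → ℝ) :
    w k ⬝ᵥ (A *ᵥ v) = ev k * (w k ⬝ᵥ v) := by
  rw [h.sum_mul_mul, Finset.sum_eq_single k]
  · simp [h.ortho]
  · intro l _ hl
    simp [h.ortho, hl]
  · simp

theorem sq_mulVec (h : IsEigenbasis A ev w) (v : ι → ℝ) :
    (A *ᵥ v) ⬝ᵥ (A *ᵥ v) = ∑ k, ev k ^ 2 * (w k ⬝ᵥ v) ^ 2 := by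
  rw [h.dot_self]
  exact Finset.sum_congr rfl fun k _ => by rw [h.dot_mulVec, mul_pow]

theorem trace_eq (h : IsEigenbasis A ev w) : ∑ i, A i i = ∑ k, ev k := by
  simp_rw [h.repr]
  rw [Finset.sum_comm]
  refine Finset.sum_congr rfl fun k _ => ?_
  have := h.ortho k k
  rw [if_pos rfl, dotProduct] at this
  simp_rw [mul_assoc]
  rw [← Finset.mul_sum, this, mul_one]

theorem symm (h : IsEigenbasis A ev w) (i j : ι) : A i j = A j i := by
  rw [h.repr, h.repr]
  exact Finset.sum_congr rfl fun k _ => by ring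

theorem mulVec_eigenvector (h : IsEigenbasis A ev w) (k : ι) : A *ᵥ w k = ev k • w k := by
  funext i
  have e := h.sum_mul_mul (Pi.single i 1) (w k)
  rw [single_one_dotProduct] at e
  rw [e, Finset.sum_eq_single k]
  · simp [h.ortho]
  · intro l _ hl
    simp [h.ortho, hl]
  · simp

/-- Both sides are the trace of A². -/
theorem frobenius (h : IsEigenbasis A ev w) : ∑ i, ∑ j, A i j ^ 2 = ∑ k, ev k ^ 2 := by
  have e : ∀ i, ∑ j, A i j ^ 2 = (A *ᵥ (A *ᵥ Pi.single i 1)) i := by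
    intro i
    rw [mulVec, dotProduct]
    refine Finset.sum_congr rfl fun j _ => ?_
    rw [mulVec_single_one, col_apply, h.symm j i, sq]
  have h2 : IsEigenbasis (A * A) (fun k => ev k ^ 2) w := by
    refine ⟨h.ortho, h.complete, fun i j => ?_⟩
    have e := h.sum_mul_mul (Pi.single i 1) (A *ᵥ Pi.single j 1)
    rw [single_one_dotProduct, mulVec_mulVec, mulVec_single_one, col_apply] at e
    rw [e]
    refine Finset.sum_congr rfl fun k _ => ?_
    rw [h.dot_mulVec, dotProduct_single_one, dotProduct_single_one]
    ring
  rw [← h2.trace_eq]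
  refine Finset.sum_congr rfl fun i _ => ?_
  rw [e, mulVec_mulVec, mulVec_single_one, col_apply]

/-- Restrict the spectrum to a set of eigenvalues. -/
theorem truncate (h : IsEigenbasis A ev w) (ev' : ι → ℝ) :
    IsEigenbasis (of fun i j => ∑ k, ev' k * w k i * w k j) ev' w :=
  ⟨h.ortho, h.complete, fun _ _ => rfl⟩

end IsEigenbasis

/-! ### Gaussian domination of quadratic forms -/

theorem integrable_exp_linear_sub_sq (u : ℝ) :
    Integrable fun g : ℝ => Real.exp (u * g - g ^ 2 / 2) := by
  have h := (integrable_exp_neg_mul_sq (b := 1 / 2) (by norm_num)).comp_sub_right u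
  have := h.const_mul (Real.exp (u ^ 2 / 2))
  refine this.congr (Eventually.of_forall fun g => ?_)
  simp only
  rw [← Real.exp_add]; congr 1; ring

theorem integral_exp_linear_sub_sq (u : ℝ) :
    ∫ g : ℝ, Real.exp (u * g - g ^ 2 / 2) = Real.sqrt (2 * Real.pi) * Real.exp (u ^ 2 / 2) := by
  have e : ∀ g : ℝ, Real.exp (u * g - g ^ 2 / 2)
      = Real.exp (u ^ 2 / 2) * Real.exp (-(1 / 2) * (g - u) ^ 2) := by
    intro g
    rw [← Real.exp_add]; congr 1; ring
  simp_rw [e]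
  rw [integral_const_mul, integral_sub_right_eq_self (fun g => Real.exp (-(1 / 2) * g ^ 2)) u,
    integral_gaussian, mul_comm]
  congr 2
  ring

/-- The family `y` of random vectors is subgaussian with variance proxy `v` with respect to the
finite measure `ω` of mass at most `W`. -/
def IsSubgaussian {Ω : Type*} [Fintype Ω] (ω : Ω → ℝ) (y : Ω → ι → ℝ) (W v : ℝ) : Prop :=
  ∀ θ : ι → ℝ, ∑ x, ω x * Real.exp (θ ⬝ᵥ y x) ≤ W * Real.exp (v / 2 * (θ ⬝ᵥ θ))

/-- Hubbard-Stratonovich, one eigendirection at a time: exp(λz²/2) is a Gaussian average over g of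
exp(√λ g z). This shifts θ by √λ g w_a, and the subgaussian bound leaves a Gaussian integral equal
to (1 - vλ)^{-1/2}. Keeping a general θ orthogonal to the remaining directions makes the induction
close. -/
theorem IsSubgaussian.sum_exp_quad_le {Ω : Type*} [Fintype Ω] {ω : Ω → ℝ}
    {y : Ω → ι → ℝ} {W v : ℝ} (hy : IsSubgaussian ω y W v)
    {w : ι → ι → ℝ} (hw : ∀ k l, w k ⬝ᵥ w l = if k = l then 1 else 0) (F : Finset ι)
    {ev : ι → ℝ} (h0 : ∀ k ∈ F, 0 ≤ ev k) (h1 : ∀ k ∈ F, v * ev k < 1)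
    (θ : ι → ℝ) (hθ : ∀ k ∈ F, w k ⬝ᵥ θ = 0) :
    ∑ x, ω x * Real.exp (θ ⬝ᵥ y x + (∑ k ∈ F, ev k * (w k ⬝ᵥ y x) ^ 2) / 2)
      ≤ W * Real.exp (v / 2 * (θ ⬝ᵥ θ)) * ∏ k ∈ F, (Real.sqrt (1 - v * ev k))⁻¹ := by
  induction F using Finset.induction_on generalizing θ with
  | empty => simpa using hy θ
  | insert a F ha ih =>
    have h0' : ∀ k ∈ F, 0 ≤ ev k := fun k hk => h0 k (Finset.mem_insert_of_mem hk)
    have h1' : ∀ k ∈ F, v * ev k < 1 := fun k hk => h1 k (Finset.mem_insert_of_mem hk)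
    have hθ' : ∀ k ∈ F, w k ⬝ᵥ θ = 0 := fun k hk => hθ k (Finset.mem_insert_of_mem hk)
    have hθa := hθ a (Finset.mem_insert_self a F)
    have hl0 := h0 a (Finset.mem_insert_self a F)
    have hl1 := h1 a (Finset.mem_insert_self a F)
    set l := ev a
    set P := ∏ k ∈ F, (Real.sqrt (1 - v * ev k))⁻¹
    -- Rate of decay in g left after the subgaussian cost v l g²/2 is set against the Gaussian
    -- density; positive exactly because v l < 1.
    set b := (1 - v * l) / 2 with hb
    have hb0 : 0 < b := by rw [hb]; linarith
    have hpi : 0 < Real.sqrt (2 * Real.pi) := by positivity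
    let Θ : ℝ → ι → ℝ := fun g => θ + (Real.sqrt l * g) • w a
    have step : ∀ g : ℝ, ∑ x, ω x * (Real.exp (θ ⬝ᵥ y x + (∑ k ∈ F, ev k * (w k ⬝ᵥ y x) ^ 2) / 2)
          * Real.exp (Real.sqrt l * (w a ⬝ᵥ y x) * g - g ^ 2 / 2))
        ≤ W * Real.exp (v / 2 * (θ ⬝ᵥ θ)) * P * Real.exp (-b * g ^ 2) := by
      intro g
      have hΘ : ∀ k ∈ F, w k ⬝ᵥ Θ g = 0 := by
        intro k hk
        have : k ≠ a := fun h => ha (h ▸ hk)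
        simp [Θ, dotProduct_add, hθ' k hk, dotProduct_smul, hw, this]
      have h2 := ih h0' h1' (Θ g) hΘ
      have e1 : ∀ x, Θ g ⬝ᵥ y x = θ ⬝ᵥ y x + Real.sqrt l * (w a ⬝ᵥ y x) * g := by
        intro x
        simp only [Θ, add_dotProduct, smul_dotProduct, smul_eq_mul]
        ring
      have e2 : Θ g ⬝ᵥ Θ g = θ ⬝ᵥ θ + l * g ^ 2 := by
        simp only [Θ, add_dotProduct, smul_dotProduct, smul_eq_mul, dotProduct_add,
          dotProduct_smul, hθa, dotProduct_comm θ (w a), hw, if_true]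
        have := Real.mul_self_sqrt hl0
        linear_combination g ^ 2 * this
      rw [e2] at h2
      have h3 := mul_le_mul_of_nonneg_right h2 (Real.exp_pos (-(g ^ 2 / 2))).le
      calc _ = (∑ x, ω x * Real.exp (Θ g ⬝ᵥ y x + (∑ k ∈ F, ev k * (w k ⬝ᵥ y x) ^ 2) / 2))
            * Real.exp (-(g ^ 2 / 2)) := by
            rw [Finset.sum_mul]
            refine Finset.sum_congr rfl fun x _ => ?_
            rw [← Real.exp_add, mul_assoc (ω x), ← Real.exp_add, e1]
            congr 2; ring
        _ ≤ _ := h3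
        _ = W * P * (Real.exp (v / 2 * (θ ⬝ᵥ θ + l * g ^ 2)) * Real.exp (-(g ^ 2 / 2))) := by
            ring
        _ = W * P * (Real.exp (v / 2 * (θ ⬝ᵥ θ)) * Real.exp (-b * g ^ 2)) := by
            rw [← Real.exp_add, ← Real.exp_add]
            congr 2
            rw [hb]; ring
        _ = _ := by ring
    have hint := integral_mono (μ := volume)
      (f := fun g : ℝ => ∑ x, ω x * (Real.exp (θ ⬝ᵥ y x +
          (∑ k ∈ F, ev k * (w k ⬝ᵥ y x) ^ 2) / 2)
          * Real.exp (Real.sqrt l * (w a ⬝ᵥ y x) * g - g ^ 2 / 2)))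
      (integrable_finsetSum _ fun x _ =>
        ((integrable_exp_linear_sub_sq _).const_mul _).const_mul _)
      ((integrable_exp_neg_mul_sq hb0).const_mul _) step
    rw [integral_finsetSum _ fun x _ =>
        ((integrable_exp_linear_sub_sq _).const_mul _).const_mul _,
      integral_const_mul, integral_gaussian] at hint
    simp_rw [integral_const_mul, integral_exp_linear_sub_sq] at hint
    have e3 : Real.sqrt (Real.pi / b)
        = Real.sqrt (2 * Real.pi) * (Real.sqrt (1 - v * l))⁻¹ := by
      rw [← Real.sqrt_inv, ← Real.sqrt_mul (by positivity)]
      congr 1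
      rw [hb]
      have : 1 - v * l ≠ 0 := by linarith
      field_simp
    rw [Finset.prod_insert ha]
    refine le_of_mul_le_mul_left ?_ hpi
    calc _ = ∑ x, ω x * (Real.exp (θ ⬝ᵥ y x + (∑ k ∈ F, ev k * (w k ⬝ᵥ y x) ^ 2) / 2) *
          (Real.sqrt (2 * Real.pi) * Real.exp ((Real.sqrt l * (w a ⬝ᵥ y x)) ^ 2 / 2))) := by
          rw [Finset.mul_sum]
          refine Finset.sum_congr rfl fun x _ => ?_
          rw [Finset.sum_insert ha, mul_pow, Real.sq_sqrt hl0, add_div, add_comm (_ / 2),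
            ← add_assoc, Real.exp_add]
          ring
      _ ≤ _ := hint
      _ = _ := by rw [e3]; ring

theorem inv_sqrt_one_sub_le {μ : ℝ} (h0 : 0 ≤ μ) (h1 : μ ≤ 1 / 2) :
    (Real.sqrt (1 - μ))⁻¹ ≤ Real.exp μ := by
  rw [← Real.sqrt_inv, Real.sqrt_le_iff]
  refine ⟨(Real.exp_pos _).le, ?_⟩
  rw [inv_le_comm₀ (by linarith) (by positivity), ← Real.exp_nat_mul, ← Real.exp_neg]
  have h := Real.add_one_le_exp (2 * μ)
  rw [Real.exp_neg]
  rw [inv_le_comm₀ (by positivity) (by linarith)]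
  push_cast
  refine le_trans ?_ h
  rw [inv_eq_one_div, div_le_iff₀ (by linarith)]
  nlinarith

/-- Diagonalise BᵀB: its eigenvalues μ_k are at most 1/2, each contributes (1 - μ_k)^{-1/2} ≤ exp
μ_k, and they sum to the squared Frobenius norm. -/
theorem IsSubgaussian.sum_exp_sq_le {Ω : Type*} [Fintype Ω] {ω : Ω → ℝ}
    {y : Ω → ι → ℝ} {W : ℝ} (hW : 0 ≤ W) (hy : IsSubgaussian ω y W 1) (B : Matrix ι ι ℝ)
    (hB : ∀ v, (B *ᵥ v) ⬝ᵥ (B *ᵥ v) ≤ (v ⬝ᵥ v) / 2) :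
    ∑ x, ω x * Real.exp (((B *ᵥ y x) ⬝ᵥ (B *ᵥ y x)) / 2)
      ≤ W * Real.exp (∑ i, ∑ j, B i j ^ 2) := by
  have hH : (Bᵀ * B).IsHermitian := by
    rw [IsHermitian, conjTranspose_eq_transpose_of_trivial, transpose_mul, transpose_transpose]
  obtain ⟨w, hw⟩ := exists_isEigenbasis hH
  set μ := hH.eigenvalues
  have hq : ∀ v, (B *ᵥ v) ⬝ᵥ (B *ᵥ v) = ∑ k, μ k * (w k ⬝ᵥ v) ^ 2 := by
    intro v
    rw [← hw.quad, ← mulVec_mulVec, dotProduct_mulVec v, vecMul_transpose]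
  have hμ : ∀ k, (B *ᵥ w k) ⬝ᵥ (B *ᵥ w k) = μ k := by
    intro k
    rw [hq, Finset.sum_eq_single k]
    · simp [hw.ortho]
    · intro l _ hl
      simp [hw.ortho, hl]
    · simp
  have h0 : ∀ k, 0 ≤ μ k := fun k => by
    rw [← hμ]; exact Finset.sum_nonneg fun i _ => mul_self_nonneg _
  have h1 : ∀ k, μ k ≤ 1 / 2 := fun k => by
    rw [← hμ]
    have := hB (w k)
    rwa [hw.ortho, if_pos rfl] at this
  have hs : ∑ k, μ k = ∑ i, ∑ j, B i j ^ 2 := by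
    rw [← hw.trace_eq, Finset.sum_comm]
    refine Finset.sum_congr rfl fun i _ => ?_
    rw [mul_apply]
    exact Finset.sum_congr rfl fun j _ => by rw [transpose_apply, sq]
  have := hy.sum_exp_quad_le hw.ortho Finset.univ (fun k _ => h0 k)
    (fun k _ => by linarith [h1 k]) 0 (by simp)
  simp only [zero_dotProduct, zero_add, mul_zero, Real.exp_zero, mul_one, one_mul] at this
  simp_rw [hq]
  refine this.trans (mul_le_mul_of_nonneg_left ?_ hW)
  rw [← hs, Real.exp_sum]
  exact Finset.prod_le_prod (fun k _ => by positivity) fun k _ => inv_sqrt_one_sub_le (h0 k) (h1 k)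

/-! ### Product laws -/

/-- The weight of the product law with constant field `h`. -/
noncomputable def fieldWeight (h : ℝ) (x : Spins ι) : ℝ := Real.exp (h * ∑ i, spin (x i))

/-- The spins centred at `τ`. -/
def centred (τ : ℝ) (x : Spins ι) : ι → ℝ := fun i => spin (x i) - τ

theorem fieldWeight_pos {κ : Type*} [Fintype κ] (h : ℝ) (x : Spins κ) :
    0 < fieldWeight h x := Real.exp_pos _

/-- Independence tensorises a one-spin bound. The proxy v is left free: v = 1 serves every field,
and v = 1/β the field βt. -/
theorem isSubgaussian_of_cosh {h τ v : ℝ}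
    (hc : ∀ θ, Real.cosh (h + θ) ≤ Real.cosh h * Real.exp (θ * τ + v / 2 * θ ^ 2)) :
    IsSubgaussian (fieldWeight (ι := ι) h) (centred τ)
      ((2 * Real.cosh h) ^ Fintype.card ι) v := by
  intro θ
  have e : ∀ x : Spins ι, fieldWeight h x * Real.exp (θ ⬝ᵥ centred τ x)
      = Real.exp (∑ i, -(θ i * τ)) * Real.exp (∑ i, (h + θ i) * spin (x i)) := by
    intro x
    rw [fieldWeight, ← Real.exp_add, ← Real.exp_add, dotProduct, Finset.mul_sum,
      ← Finset.sum_add_distrib, ← Finset.sum_add_distrib]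
    congr 1
    exact Finset.sum_congr rfl fun i _ => by rw [centred]; ring
  simp_rw [e]
  rw [← Finset.mul_sum, sum_exp_field, Real.exp_sum, ← Finset.prod_mul_distrib, dotProduct,
    Finset.mul_sum, Real.exp_sum, ← Finset.card_univ, ← Finset.prod_const,
    ← Finset.prod_mul_distrib]
  refine Finset.prod_le_prod (fun i _ => ?_) fun i _ => ?_
  · have := Real.cosh_pos (h + θ i)
    positivity
  · have h1 := mul_le_mul_of_nonneg_left (hc (θ i)) (Real.exp_pos (-(θ i * τ))).le
    calc Real.exp (-(θ i * τ)) * (2 * Real.cosh (h + θ i))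
        ≤ 2 * (Real.exp (-(θ i * τ)) *
          (Real.cosh h * Real.exp (θ i * τ + v / 2 * θ i ^ 2))) := by linarith
      _ = 2 * Real.cosh h * (Real.exp (-(θ i * τ)) *
          Real.exp (θ i * τ + v / 2 * θ i ^ 2)) := by ring
      _ = _ := by rw [← Real.exp_add]; congr 2; ring

theorem isSubgaussian_centred_tanh (h : ℝ) :
    IsSubgaussian (fieldWeight (ι := ι) h) (centred (Real.tanh h))
      ((2 * Real.cosh h) ^ Fintype.card ι) 1 :=
  isSubgaussian_of_cosh fun θ => by
    have := cosh_add_le h θ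
    rwa [show θ * Real.tanh h + 1 / 2 * θ ^ 2 = θ * Real.tanh h + θ ^ 2 / 2 by ring]

/-- Hoeffding's lemma for spin j conditionally on the others. -/
theorem fieldWeight_flip_add_le (h : ℝ) (j : ι) (x : Spins ι) (c : ℝ) :
    fieldWeight h x * Real.exp (c * centred (Real.tanh h) x j)
      + fieldWeight h (flip j x) * Real.exp (c * centred (Real.tanh h) (flip j x) j)
      ≤ (fieldWeight h x + fieldWeight h (flip j x)) * Real.exp (c ^ 2 / 2) := by
  set k := Real.exp (h * (∑ i, spin (x i) - spin (x j))) with hk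
  have hsum : ∑ i, spin (flip j x i) = ∑ i, spin (x i) - 2 * spin (x j) := by
    have : ∑ i, (spin (flip j x i) - spin (x i)) = -2 * spin (x j) := by
      simp_rw [spin_flip_sub]
      simp
    rw [Finset.sum_sub_distrib] at this
    linarith
  have w1 : fieldWeight h x = k * Real.exp (h * spin (x j)) := by
    rw [fieldWeight, hk, ← Real.exp_add]; congr 1; ring
  have w2 : fieldWeight h (flip j x) = k * Real.exp (-(h * spin (x j))) := by
    rw [fieldWeight, hk, ← Real.exp_add, hsum]; congr 1; ring
  have c1 : centred (Real.tanh h) (flip j x) j = -spin (x j) - Real.tanh h := by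
    rw [centred, flip_same, spin_neg]
  have key := cosh_add_le h c
  have hk0 : 0 < k := Real.exp_pos _
  rw [w1, w2, c1, centred]
  have e : ∀ s : ℝ, s = 1 ∨ s = -1 →
      Real.exp (h * s) * Real.exp (c * (s - Real.tanh h))
        + Real.exp (-(h * s)) * Real.exp (c * (-s - Real.tanh h))
      ≤ (Real.exp (h * s) + Real.exp (-(h * s))) * Real.exp (c ^ 2 / 2) := by
    intro s hs
    have e1 : Real.exp (h * s) * Real.exp (c * (s - Real.tanh h))
        + Real.exp (-(h * s)) * Real.exp (c * (-s - Real.tanh h))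
        = 2 * Real.cosh (h + c) * Real.exp (-(c * Real.tanh h)) := by
      rw [Real.cosh_eq, mul_div_cancel₀ _ two_ne_zero, add_mul, ← Real.exp_add, ← Real.exp_add,
        ← Real.exp_add, ← Real.exp_add]
      rcases hs with rfl | rfl
      · congr 2 <;> ring
      · rw [add_comm]; congr 2 <;> ring
    have e2 : Real.exp (h * s) + Real.exp (-(h * s)) = 2 * Real.cosh h := by
      rw [Real.cosh_eq]
      rcases hs with rfl | rfl
      · ring_nf
      · ring_nf
    rw [e1, e2]
    calc 2 * Real.cosh (h + c) * Real.exp (-(c * Real.tanh h))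
        ≤ 2 * (Real.cosh h * Real.exp (c * Real.tanh h + c ^ 2 / 2)) *
          Real.exp (-(c * Real.tanh h)) := by gcongr
      _ = 2 * Real.cosh h * (Real.exp (c * Real.tanh h + c ^ 2 / 2) *
          Real.exp (-(c * Real.tanh h))) := by ring
      _ = _ := by rw [← Real.exp_add]; congr 2; ring
  have := e (spin (x j)) (by
    rcases Int.units_eq_one_or (x j) with h | h <;> simp [h, spin_one, spin_neg_one])
  nlinarith

/-- Integrating out a block of coordinates of a product law in a bipartite quadratic form. -/
theorem sum_fieldWeight_bipartite_le (h : ℝ) (B : Matrix ι ι ℝ)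
    (hB : ∀ j, (∀ l, B l j = 0) ∨ ∀ i, B j i = 0) :
    ∑ x : Spins ι, fieldWeight h x * Real.exp
        ((B *ᵥ centred (Real.tanh h) x) ⬝ᵥ centred (Real.tanh h) x)
      ≤ ∑ x : Spins ι, fieldWeight h x * Real.exp
        (((B *ᵥ centred (Real.tanh h) x) ⬝ᵥ (B *ᵥ centred (Real.tanh h) x)) / 2) := by
  set y : Spins ι → ι → ℝ := centred (Real.tanh h)
  set z : Spins ι → ι → ℝ := fun x => B *ᵥ y x with hz
  -- The coordinates in J have been integrated out one by one, each replacing z_j y_j by z_j²/2.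
  have main : ∀ J : Finset ι, ∑ x : Spins ι, fieldWeight h x * Real.exp (z x ⬝ᵥ y x)
      ≤ ∑ x : Spins ι, fieldWeight h x *
        Real.exp (∑ j ∈ Jᶜ, z x j * y x j + ∑ j ∈ J, z x j ^ 2 / 2) := by
    intro J
    induction J using Finset.induction_on with
    | empty => simp [dotProduct]
    | insert a J ha ih =>
      refine ih.trans ?_
      have hsplit : ∀ x, ∑ j ∈ Jᶜ, z x j * y x j
          = z x a * y x a + ∑ j ∈ (insert a J)ᶜ, z x j * y x j := by
        intro x
        rw [Finset.compl_insert]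
        exact (Finset.add_sum_erase _ _ (by simpa using ha)).symm
      simp_rw [Finset.sum_insert ha, hsplit]
      -- If column a vanishes, z does not depend on x_a and Hoeffding applies with coefficient z_a;
      -- if row a vanishes, z_a = 0.
      rcases hB a with hb | hb
      · refine sum_le_sum_of_flip a fun x => ?_
        have hzf : ∀ l, z (flip a x) l = z x l := by
          intro l
          simp only [hz, mulVec, dotProduct]
          refine Finset.sum_congr rfl fun i _ => ?_
          by_cases hi : i = a
          · subst hi; simp [hb]
          · simp only [y, centred, flip_of_ne hi]
        have hyf : ∀ l, l ≠ a → y (flip a x) l = y x l := by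
          intro l hl
          simp only [y, centred, flip_of_ne hl]
        have hs : ∑ j ∈ (insert a J)ᶜ, z x j * y (flip a x) j
            = ∑ j ∈ (insert a J)ᶜ, z x j * y x j := by
          refine Finset.sum_congr rfl fun j hj => ?_
          rw [hyf j]
          rintro rfl
          simp at hj
        simp_rw [hzf, hs]
        have key := fieldWeight_flip_add_le h a x (z x a)
        set s1 := ∑ j ∈ (insert a J)ᶜ, z x j * y x j
        set s2 := ∑ j ∈ J, z x j ^ 2 / 2
        have := mul_le_mul_of_nonneg_right key (Real.exp_pos (s1 + s2)).le
        have e1 : ∀ u, Real.exp (u + s1 + s2) = Real.exp u * Real.exp (s1 + s2) := by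
          intro u; rw [← Real.exp_add]; congr 1; ring
        have e2 : Real.exp (s1 + (z x a ^ 2 / 2 + s2))
            = Real.exp (z x a ^ 2 / 2) * Real.exp (s1 + s2) := by
          rw [← Real.exp_add]; congr 1; ring
        rw [e1, e1, e2]
        linarith
      · have hza : ∀ x, z x a = 0 := by
          intro x
          simp [hz, mulVec, dotProduct, hb]
        simp_rw [hza]
        simp
  have := main Finset.univ
  simp only [Finset.compl_univ, Finset.sum_empty, zero_add] at this
  refine this.trans_eq ?_
  refine Finset.sum_congr rfl fun x _ => ?_
  rw [dotProduct, Finset.sum_div]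
  congr 2
  exact Finset.sum_congr rfl fun j _ => by rw [sq]

/-- For a uniform random bipartition ε, the factor (1 + ε_i)(1 - ε_j) has mean 1 off the diagonal;
on the diagonal it is 0. -/
theorem sum_spin_mul (i j : ι) (hij : i ≠ j) :
    ∑ ε : Spins ι, (1 + spin (ε i)) * (1 - spin (ε j)) = 2 ^ Fintype.card ι := by
  have h1 : ∑ ε : Spins ι, spin (ε i) = 0 :=
    sum_eq_zero_of_flip i fun x => by rw [flip_same, spin_neg]; ring
  have h2 : ∑ ε : Spins ι, spin (ε j) = 0 :=
    sum_eq_zero_of_flip j fun x => by rw [flip_same, spin_neg]; ring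
  have h3 : ∑ ε : Spins ι, spin (ε i) * spin (ε j) = 0 :=
    sum_eq_zero_of_flip i fun x => by rw [flip_same, spin_neg, flip_of_ne hij.symm]; ring
  have e : ∀ ε : Spins ι, (1 + spin (ε i)) * (1 - spin (ε j))
      = 1 + spin (ε i) - spin (ε j) - spin (ε i) * spin (ε j) := fun ε => by ring
  simp_rw [e]
  rw [Finset.sum_sub_distrib, Finset.sum_sub_distrib, Finset.sum_add_distrib, h1, h2, h3]
  simp

/-- A Hanson-Wright bound: the exponential moment of an off-diagonal quadratic form with small
operator norm under a product law. -/
theorem sum_fieldWeight_offDiag_le (h : ℝ) (T : Matrix ι ι ℝ) (hs : ∀ i j, T i j = T j i)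
    (hT : ∀ v, (T *ᵥ v) ⬝ᵥ (T *ᵥ v) ≤ (v ⬝ᵥ v) / 32) :
    ∑ x : Spins ι, fieldWeight h x * Real.exp (∑ i, ∑ j, if i = j then 0 else
        T i j * centred (Real.tanh h) x i * centred (Real.tanh h) x j)
      ≤ (2 * Real.cosh h) ^ Fintype.card ι * Real.exp (16 * ∑ i, ∑ j, T i j ^ 2) := by
  set y : Spins ι → ι → ℝ := centred (Real.tanh h)
  set N : ℝ := 2 ^ Fintype.card ι with hN
  have hN0 : 0 < N := by positivity
  -- Decoupling: B ε keeps, multiplied by 4, only the entries of T between the two classes of ε. The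
  -- off-diagonal form is the average of these bipartite forms, so Jensen reduces the bound to one
  -- ε.
  let B : Spins ι → Matrix ι ι ℝ := fun ε => of fun j i =>
    (1 + spin (ε i)) * (1 - spin (ε j)) * T i j
  have hsp : ∀ u : ℤˣ, spin u = 1 ∨ spin u = -1 := by
    intro u
    rcases Int.units_eq_one_or u with h | h <;> simp [h, spin_one, spin_neg_one]
  have havg : ∀ x, (∑ i, ∑ j, if i = j then 0 else T i j * y x i * y x j)
      = ∑ ε : Spins ι, N⁻¹ • ((B ε *ᵥ y x) ⬝ᵥ y x) := by
    intro x
    have e : ∀ ε, (B ε *ᵥ y x) ⬝ᵥ y x = ∑ i, ∑ j,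
        (1 + spin (ε i)) * (1 - spin (ε j)) * (T i j * y x i * y x j) := by
      intro ε
      simp only [B, dotProduct, mulVec, of_apply]
      rw [Finset.sum_comm]
      refine Finset.sum_congr rfl fun j _ => ?_
      rw [Finset.sum_mul]
      exact Finset.sum_congr rfl fun i _ => by ring
    have e' : ∑ ε : Spins ι, N⁻¹ • ((B ε *ᵥ y x) ⬝ᵥ y x) = ∑ i, ∑ j, ∑ ε : Spins ι,
        N⁻¹ * ((1 + spin (ε i)) * (1 - spin (ε j)) * (T i j * y x i * y x j)) := by
      simp_rw [e, smul_eq_mul, Finset.mul_sum]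
      rw [Finset.sum_comm]
      exact Finset.sum_congr rfl fun i _ => Finset.sum_comm
    rw [e']
    refine Finset.sum_congr rfl fun i _ => Finset.sum_congr rfl fun j _ => ?_
    rw [← Finset.mul_sum, ← Finset.sum_mul]
    split_ifs with hij
    · subst hij
      have : ∑ ε : Spins ι, (1 + spin (ε i)) * (1 - spin (ε i)) = 0 :=
        Finset.sum_eq_zero fun ε _ => by
          have := spin_sq (ε i)
          linear_combination -this
      rw [this]; ring
    · rw [sum_spin_mul i j hij, ← hN]
      field_simp
  have hjensen : ∀ x, Real.exp (∑ i, ∑ j, if i = j then 0 else T i j * y x i * y x j)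
      ≤ ∑ ε : Spins ι, N⁻¹ • Real.exp ((B ε *ᵥ y x) ⬝ᵥ y x) := by
    intro x
    rw [havg]
    refine convexOn_exp.map_sum_le (fun _ _ => by positivity) ?_ fun _ _ => Set.mem_univ _
    simp [hN]
  -- Masking each side costs at most 4 in squared norm, so 16/32 = 1/2, the threshold of the
  -- Gaussian bound.
  have hBf : ∀ ε : Spins ι, ∀ v, (B ε *ᵥ v) ⬝ᵥ (B ε *ᵥ v) ≤ (v ⬝ᵥ v) / 2 := by
    intro ε v
    set u : ι → ℝ := fun i => (1 + spin (ε i)) * v i with hu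
    have e : ∀ j, (B ε *ᵥ v) j = (1 - spin (ε j)) * (T *ᵥ u) j := by
      intro j
      simp only [B, mulVec, dotProduct, of_apply, hu]
      rw [Finset.mul_sum]
      exact Finset.sum_congr rfl fun i _ => by rw [hs i j]; ring
    have h1 : (B ε *ᵥ v) ⬝ᵥ (B ε *ᵥ v) ≤ 4 * ((T *ᵥ u) ⬝ᵥ (T *ᵥ u)) := by
      rw [dotProduct, dotProduct, Finset.mul_sum]
      refine Finset.sum_le_sum fun j _ => ?_
      rw [e]
      have := mul_self_nonneg ((T *ᵥ u) j)
      rcases hsp (ε j) with h | h <;> rw [h] <;> nlinarith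
    have h2 : u ⬝ᵥ u ≤ 4 * (v ⬝ᵥ v) := by
      rw [dotProduct, dotProduct, Finset.mul_sum]
      refine Finset.sum_le_sum fun j _ => ?_
      rw [hu]
      have := mul_self_nonneg (v j)
      simp only
      rcases hsp (ε j) with h | h <;> rw [h] <;> nlinarith
    have h3 := hT u
    linarith
  have hfrob : ∀ ε : Spins ι, ∑ i, ∑ j, B ε i j ^ 2 ≤ 16 * ∑ i, ∑ j, T i j ^ 2 := by
    intro ε
    rw [Finset.mul_sum]
    refine Finset.sum_le_sum fun i _ => ?_
    rw [Finset.mul_sum]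
    refine Finset.sum_le_sum fun j _ => ?_
    simp only [B, of_apply]
    rw [hs j i]
    have := sq_nonneg (T i j)
    rcases hsp (ε j) with h | h <;> rcases hsp (ε i) with h' | h' <;> rw [h, h'] <;> nlinarith
  have hε : ∀ ε : Spins ι, ∑ x : Spins ι, fieldWeight h x * Real.exp ((B ε *ᵥ y x) ⬝ᵥ y x)
      ≤ (2 * Real.cosh h) ^ Fintype.card ι * Real.exp (16 * ∑ i, ∑ j, T i j ^ 2) := by
    intro ε
    have hc := Real.cosh_pos h
    refine (sum_fieldWeight_bipartite_le h (B ε) fun j => ?_).trans ?_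
    · rcases hsp (ε j) with h | h
      · right; intro i; simp [B, h]
      · left; intro i; simp [B, h]
    · refine ((isSubgaussian_centred_tanh h).sum_exp_sq_le (by positivity) (B ε) (hBf ε)).trans ?_
      gcongr
      exact hfrob ε
  calc _ ≤ ∑ x : Spins ι, fieldWeight h x *
        ∑ ε : Spins ι, N⁻¹ • Real.exp ((B ε *ᵥ y x) ⬝ᵥ y x) :=
        Finset.sum_le_sum fun x _ => mul_le_mul_of_nonneg_left (hjensen x) (fieldWeight_pos h x).le
    _ = ∑ ε : Spins ι, N⁻¹ * ∑ x : Spins ι, fieldWeight h x *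
        Real.exp ((B ε *ᵥ y x) ⬝ᵥ y x) := by
        simp_rw [Finset.mul_sum]
        rw [Finset.sum_comm]
        refine Finset.sum_congr rfl fun ε _ => Finset.sum_congr rfl fun x _ => ?_
        rw [smul_eq_mul]; ring
    _ ≤ ∑ _ε : Spins ι, N⁻¹ * ((2 * Real.cosh h) ^ Fintype.card ι *
        Real.exp (16 * ∑ i, ∑ j, T i j ^ 2)) := by
        refine Finset.sum_le_sum fun ε _ => mul_le_mul_of_nonneg_left (hε ε) (by positivity)
    _ = _ := by
        rw [Finset.sum_const, nsmul_eq_mul, ← mul_assoc]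
        simp [hN]

end Ising

namespace Ising

/-! ### The mean-field free energy -/

/-- The mean-field free energy `log (2 cosh (β m)) - β m² / 2`. -/
noncomputable def freeEnergy (β m : ℝ) : ℝ := Real.log (2 * Real.cosh (β * m)) - β / 2 * m ^ 2

theorem freeEnergy_abs (β m : ℝ) : freeEnergy β |m| = freeEnergy β m := by
  rcases abs_cases m with ⟨h, _⟩ | ⟨h, _⟩ <;> rw [h]
  simp [freeEnergy]

theorem hasDerivAt_freeEnergy (β m : ℝ) :
    HasDerivAt (freeEnergy β) (β * (Real.tanh (β * m) - m)) m := by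
  have e : freeEnergy β = fun m => Real.log 2 + Real.log (Real.cosh (β * m)) - β / 2 * m ^ 2 := by
    funext m
    rw [freeEnergy, Real.log_mul two_ne_zero (Real.cosh_pos _).ne']
  rw [e]
  have h1 := (hasDerivAt_log_cosh (β * m)).comp m ((hasDerivAt_id m).const_mul β)
  have h2 := ((hasDerivAt_id m).pow 2).const_mul (β / 2)
  have h3 := ((hasDerivAt_const m (Real.log 2)).add h1).sub h2
  convert! h3 using 1
  push_cast
  simp only [id]
  ring

theorem exp_freeEnergy (β m : ℝ) (n : ℕ) :
    (2 * Real.cosh (β * m)) ^ n = Real.exp (n * (freeEnergy β m + β / 2 * m ^ 2)) := by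
  have := Real.cosh_pos (β * m)
  rw [freeEnergy, sub_add_cancel, Real.exp_nat_mul, Real.exp_log (by positivity)]

/-- Quantitative strict concavity of tanh on the positive axis. It yields both the quadratic gap of
the free energy and the contraction at the fixed point. -/
theorem exists_cube_le_tanh_sub {b : ℝ} (hb : 0 < b) :
    ∃ κ > 0, ∀ z, 0 ≤ z → z ≤ b → κ * z ^ 3 ≤ Real.tanh z - z * (1 - Real.tanh z ^ 2) := by
  set τ := 1 - Real.tanh b ^ 2 with hτ
  have hτ0 : 0 < τ := by have := Real.tanh_sq_lt_one b; rw [hτ]; linarith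
  have hτle : ∀ z, 0 ≤ z → z ≤ b → τ ≤ 1 - Real.tanh z ^ 2 := by
    intro z h0 h1
    have a := tanh_monotone h1
    have b := tanh_nonneg h0
    rw [hτ]; nlinarith
  have hT : ∀ z, 0 ≤ z → z ≤ b → τ * z ≤ Real.tanh z := by
    have hd : ∀ y, HasDerivAt (fun y => Real.tanh y - τ * y) ((1 - Real.tanh y ^ 2) - τ) y := by
      intro y
      have := (hasDerivAt_tanh y).sub ((hasDerivAt_id y).const_mul τ)
      convert! this using 1
      simp
    have hm : MonotoneOn (fun y => Real.tanh y - τ * y) (Set.Icc 0 b) := by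
      refine monotoneOn_of_deriv_nonneg (convex_Icc 0 b)
        (fun y _ => (hd y).continuousAt.continuousWithinAt)
        (fun y _ => (hd y).differentiableAt.differentiableWithinAt) fun y hy => ?_
      rw [interior_Icc] at hy
      rw [(hd y).deriv]
      linarith [hτle y hy.1.le hy.2.le]
    intro z h0 h1
    have := hm ⟨le_rfl, hb.le⟩ ⟨h0, h1⟩ h0
    simp only [Real.tanh_zero, mul_zero, sub_zero] at this
    linarith
  -- The difference has derivative 2 z tanh z (1 - tanh² z) ≥ 2τ²z², which integrates to this cubic.
  refine ⟨2 / 3 * τ ^ 2, by positivity, ?_⟩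
  have hd : ∀ y, HasDerivAt
      (fun y => Real.tanh y - y * (1 - Real.tanh y ^ 2) - 2 / 3 * τ ^ 2 * y ^ 3)
      (2 * y * Real.tanh y * (1 - Real.tanh y ^ 2) - 2 * τ ^ 2 * y ^ 2) y := by
    intro y
    have h1 := hasDerivAt_tanh y
    have h2 := (hasDerivAt_id y).mul ((hasDerivAt_const y 1).sub (h1.pow 2))
    have := (h1.sub h2).sub (((hasDerivAt_id y).pow 3).const_mul (2 / 3 * τ ^ 2))
    convert! this using 1
    push_cast
    simp only [id, Pi.sub_apply, Pi.pow_apply]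
    ring
  have hm : MonotoneOn (fun y => Real.tanh y - y * (1 - Real.tanh y ^ 2) - 2 / 3 * τ ^ 2 * y ^ 3)
      (Set.Icc 0 b) := by
    refine monotoneOn_of_deriv_nonneg (convex_Icc 0 b)
      (fun y _ => (hd y).continuousAt.continuousWithinAt)
      (fun y _ => (hd y).differentiableAt.differentiableWithinAt) fun y hy => ?_
    rw [interior_Icc] at hy
    rw [(hd y).deriv]
    have h1 := hT y hy.1.le hy.2.le
    have h2 := hτle y hy.1.le hy.2.le
    have h3 : (τ * y) * τ ≤ Real.tanh y * (1 - Real.tanh y ^ 2) :=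
      mul_le_mul h1 h2 hτ0.le (tanh_nonneg hy.1.le)
    have := mul_le_mul_of_nonneg_left h3 (show 0 ≤ 2 * y by linarith [hy.1])
    linarith
  intro z h0 h1
  have := hm ⟨le_rfl, hb.le⟩ ⟨h0, h1⟩ h0
  simp only [Real.tanh_zero] at this
  norm_num at this
  linarith

/-- For f(m) = F(t) - F(m) - c(m² - t²)² one has f'(m) = m(b(m) - b(t)), where b(m) = -β tanh(βm)/m
- 4cm². Strict concavity of tanh makes b increasing for small c, so f is minimal at t, where it
vanishes. -/
theorem exists_freeEnergy_le {β t : ℝ} (hβ : 0 < β) (ht : 0 < t) (hfix : t = Real.tanh (β * t)) :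
    ∃ c > 0, ∀ m, |m| ≤ 1 → freeEnergy β m ≤ freeEnergy β t - c * (|m| - t) ^ 2 := by
  have ht1 : t < 1 := by rw [hfix]; exact Real.tanh_lt_one _
  obtain ⟨κ, hκ, hκ'⟩ := exists_cube_le_tanh_sub hβ
  -- Largest c for which the cubic bound still covers the slope 8cm of the subtracted term.
  set c := β * κ * β ^ 3 / 8 with hc
  have hc0 : 0 < c := by positivity
  set b : ℝ → ℝ := fun m => -(β * Real.tanh (β * m) / m) - 4 * c * m ^ 2 with hb
  have hbd : ∀ m, m ≠ 0 → HasDerivAt b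
      (-((β * ((1 - Real.tanh (β * m) ^ 2) * β) * m - β * Real.tanh (β * m)) / m ^ 2)
        - 8 * c * m) m := by
    intro m hm
    have h1 := (hasDerivAt_tanh (β * m)).comp m ((hasDerivAt_id m).const_mul β)
    have h2 := ((h1.const_mul β).div (hasDerivAt_id m) hm).neg
    have := h2.sub (((hasDerivAt_id m).pow 2).const_mul (4 * c))
    convert! this using 1
    push_cast
    simp only [id, Function.comp]
    ring
  have hmono : MonotoneOn b (Set.Ioc 0 1) := by
    refine monotoneOn_of_deriv_nonneg (convex_Ioc 0 1)
      (fun y hy => (hbd y hy.1.ne').continuousAt.continuousWithinAt)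
      (fun y hy => ?_) fun y hy => ?_
    · rw [interior_Ioc] at hy
      exact (hbd y hy.1.ne').differentiableAt.differentiableWithinAt
    · rw [interior_Ioc] at hy
      rw [(hbd y hy.1.ne').deriv]
      have hy0 := hy.1
      have h1 := hκ' (β * y) (by positivity) (by nlinarith [hy.2])
      rw [← neg_div, sub_nonneg, le_div_iff₀ (by positivity)]
      have := mul_le_mul_of_nonneg_left h1 hβ.le
      rw [hc]
      calc 8 * (β * κ * β ^ 3 / 8) * y * y ^ 2 = β * (κ * (β * y) ^ 3) := by ring
        _ ≤ _ := this
        _ = _ := by ring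
  have hbt : b t = -β - 4 * c * t ^ 2 := by
    simp only [hb]
    rw [← hfix, mul_div_cancel_right₀ _ ht.ne']
  set f : ℝ → ℝ := fun m => freeEnergy β t - freeEnergy β m - c * (m ^ 2 - t ^ 2) ^ 2 with hf
  have hfd : ∀ m, HasDerivAt f
      (-(β * (Real.tanh (β * m) - m)) - 4 * c * m * (m ^ 2 - t ^ 2)) m := by
    intro m
    have h1 := (hasDerivAt_const m (freeEnergy β t)).sub (hasDerivAt_freeEnergy β m)
    have h2 := ((((hasDerivAt_id m).pow 2).sub_const (t ^ 2)).pow 2).const_mul c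
    have := h1.sub h2
    convert! this using 1
    push_cast
    simp only [id, Pi.pow_apply]
    ring
  have hfb : ∀ m, m ≠ 0 → -(β * (Real.tanh (β * m) - m)) - 4 * c * m * (m ^ 2 - t ^ 2)
      = m * (b m - b t) := by
    intro m hm
    rw [hbt]
    simp only [hb]
    field_simp
    ring
  have hft : f t = 0 := by simp [hf]
  have hfpos : ∀ m, 0 ≤ m → m ≤ 1 → 0 ≤ f m := by
    intro m hm0 hm1
    rw [← hft]
    rcases le_total t m with h | h
    · have : MonotoneOn f (Set.Icc t 1) := by
        refine monotoneOn_of_deriv_nonneg (convex_Icc t 1)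
          (fun y _ => (hfd y).continuousAt.continuousWithinAt)
          (fun y _ => (hfd y).differentiableAt.differentiableWithinAt) fun y hy => ?_
        rw [interior_Icc] at hy
        have hy0 := ht.trans hy.1
        rw [(hfd y).deriv, hfb y hy0.ne']
        refine mul_nonneg hy0.le (sub_nonneg.2 ?_)
        exact hmono ⟨ht, ht1.le⟩ ⟨hy0, hy.2.le⟩ hy.1.le
      exact this ⟨le_rfl, ht1.le⟩ ⟨h, hm1⟩ h
    · have : AntitoneOn f (Set.Icc 0 t) := by
        refine antitoneOn_of_deriv_nonpos (convex_Icc 0 t)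
          (fun y _ => (hfd y).continuousAt.continuousWithinAt)
          (fun y _ => (hfd y).differentiableAt.differentiableWithinAt) fun y hy => ?_
        rw [interior_Icc] at hy
        rw [(hfd y).deriv, hfb y hy.1.ne']
        refine mul_nonpos_of_nonneg_of_nonpos hy.1.le (sub_nonpos.2 ?_)
        exact hmono ⟨hy.1, (hy.2.trans ht1).le⟩ ⟨ht, ht1.le⟩ hy.2.le
      exact this ⟨hm0, h⟩ ⟨ht.le, le_rfl⟩ h
  refine ⟨c * t ^ 2, by positivity, fun m hm => ?_⟩
  have h1 := hfpos |m| (abs_nonneg m) hm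
  simp only [hf] at h1
  rw [freeEnergy_abs] at h1
  have h2 : t ^ 2 * (|m| - t) ^ 2 ≤ (|m| ^ 2 - t ^ 2) ^ 2 := by
    have e : (|m| ^ 2 - t ^ 2) ^ 2 = (|m| + t) ^ 2 * (|m| - t) ^ 2 := by ring
    rw [e]
    gcongr
    linarith [abs_nonneg m]
  have := mul_le_mul_of_nonneg_left h2 hc0.le
  linarith

/-- Beyond |m| = 1 the free energy decreases since tanh < 1. Unbounded m is needed to obtain a
subgaussian bound for all θ. -/
theorem freeEnergy_le {β t : ℝ} (hβ : 0 < β) (ht : 0 < t) (hfix : t = Real.tanh (β * t)) (m : ℝ) :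
    freeEnergy β m ≤ freeEnergy β t := by
  obtain ⟨c, hc, h⟩ := exists_freeEnergy_le hβ ht hfix
  rw [← freeEnergy_abs]
  have small : ∀ m, |m| ≤ 1 → freeEnergy β m ≤ freeEnergy β t := fun m hm => by
    have := h m hm
    have : 0 ≤ c * (|m| - t) ^ 2 := by positivity
    linarith
  rcases le_total |m| 1 with hm | hm
  · exact small |m| (by rwa [abs_abs])
  · refine le_trans ?_ (small 1 (by simp))
    have : AntitoneOn (freeEnergy β) (Set.Ici 1) := by
      refine antitoneOn_of_deriv_nonpos (convex_Ici 1)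
        (fun y _ => (hasDerivAt_freeEnergy β y).continuousAt.continuousWithinAt)
        (fun y _ => (hasDerivAt_freeEnergy β y).differentiableAt.differentiableWithinAt)
        fun y hy => ?_
      rw [interior_Ici] at hy
      rw [(hasDerivAt_freeEnergy β y).deriv]
      have := Real.tanh_lt_one (β * y)
      have : 1 < y := hy
      exact mul_nonpos_of_nonneg_of_nonpos hβ.le (by linarith)
    exact this Set.self_mem_Ici hm hm

/-- A spin with mean `t = tanh (β t)` has variance proxy exactly `β⁻¹`. -/
theorem cosh_add_le_of_fixed {β t : ℝ} (hβ : 0 < β) (ht : 0 < t) (hfix : t = Real.tanh (β * t))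
    (θ : ℝ) : Real.cosh (β * t + θ)
      ≤ Real.cosh (β * t) * Real.exp (θ * t + β⁻¹ / 2 * θ ^ 2) := by
  -- After completing the square, global maximality of F at t is exactly the claimed bound at the
  -- point t + θ/β.
  have h := freeEnergy_le hβ ht hfix (t + θ / β)
  have hb := hβ.ne'
  rw [freeEnergy, freeEnergy, mul_add, mul_div_cancel₀ _ hb,
    Real.log_mul two_ne_zero (Real.cosh_pos _).ne',
    Real.log_mul two_ne_zero (Real.cosh_pos _).ne'] at h
  have e : β / 2 * (t + θ / β) ^ 2 = β / 2 * t ^ 2 + (θ * t + β⁻¹ / 2 * θ ^ 2) := by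
    field_simp
    ring
  rw [e] at h
  rw [← Real.exp_log (Real.cosh_pos (β * t + θ))]
  conv_rhs => rw [← Real.exp_log (Real.cosh_pos (β * t))]
  rw [← Real.exp_add]
  refine Real.exp_le_exp.2 ?_
  linarith

/-- The mean-field map is a contraction near its positive fixed point. -/
theorem exists_contraction {β t : ℝ} (hβ : 0 < β) (ht : 0 < t) (hfix : t = Real.tanh (β * t)) :
    ∃ κ η, 0 ≤ κ ∧ κ < 1 ∧ 0 < η ∧ ∀ m, |m - t| ≤ η → |Real.tanh (β * m) - t| ≤ κ * |m - t| := by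
  obtain ⟨k, hk, hk'⟩ := exists_cube_le_tanh_sub (mul_pos hβ ht)
  have h1 := hk' (β * t) (by positivity) le_rfl
  rw [← hfix] at h1
  have ht1 : t < 1 := by rw [hfix]; exact Real.tanh_lt_one _
  set D := β * (1 - t ^ 2) with hD
  have hD0 : 0 < D := mul_pos hβ (by nlinarith)
  -- D is the slope of m ↦ tanh(βm) at t. Strict concavity gives βt(1 - tanh²(βt)) < tanh(βt), that
  -- is tD < t.
  have hD1 : D < 1 := by
    have : 0 < k * (β * t) ^ 3 := by positivity
    have h2 : t * D < t * 1 := by rw [hD]; linarith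
    exact lt_of_mul_lt_mul_left h2 ht.le
  have hd : HasDerivAt (fun m => Real.tanh (β * m)) D t := by
    have := (hasDerivAt_tanh (β * t)).comp t ((hasDerivAt_id t).const_mul β)
    convert! this using 1
    rw [hD, ← hfix]
    ring
  have ho := (hasDerivAt_iff_isLittleO.1 hd).bound (show 0 < (1 - D) / 2 by linarith)
  obtain ⟨η, hη, hball⟩ := Metric.eventually_nhds_iff.1 ho
  refine ⟨(1 + D) / 2, η / 2, by linarith, by linarith, by linarith, fun m hm => ?_⟩
  have := hball (y := m) (by rw [Real.dist_eq]; linarith)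
  rw [← hfix, Real.norm_eq_abs, Real.norm_eq_abs, smul_eq_mul] at this
  have e : Real.tanh (β * m) - t = (Real.tanh (β * m) - t - (m - t) * D) + (m - t) * D := by ring
  rw [e]
  refine (abs_add_le _ _).trans ?_
  rw [abs_mul (m - t), abs_of_pos hD0]
  linarith

end Ising

namespace Ising

open Matrix

variable {n : ℕ}

/-! ### The centred coupling -/

/-- The deviation of the `i`-th row sum from `1`. -/
noncomputable def rowDev (Q : Matrix (Fin n) (Fin n) ℝ) (i : Fin n) : ℝ := ∑ j, Q i j - 1

/-- The coupling compressed to the orthogonal complement of the constant vectors (when the entries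
of `Q` sum to `n`). -/
noncomputable def centredCoupling (Q : Matrix (Fin n) (Fin n) ℝ) : Matrix (Fin n) (Fin n) ℝ :=
  of fun i j => Q i j - (1 + rowDev Q i + rowDev Q j) / n

/-- The vector of real spin values. -/
def spinVec (x : Spins (Fin n)) : Fin n → ℝ := fun i => spin (x i)

/-- The average spin. -/
noncomputable def meanSpin (x : Spins (Fin n)) : ℝ := (∑ i, spin (x i)) / n

theorem abs_meanSpin_le (x : Spins (Fin n)) : |meanSpin x| ≤ 1 := by
  rcases Nat.eq_zero_or_pos n with rfl | hn
  · simp [meanSpin]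
  have hn' : (0 : ℝ) < n := by exact_mod_cast hn
  have := abs_sum_spin_le x
  rw [Fintype.card_fin] at this
  rw [meanSpin, abs_div, abs_of_pos hn', div_le_one hn']
  exact this

theorem sum_spin_eq (hn : 0 < n) (x : Spins (Fin n)) : ∑ i, spin (x i) = n * meanSpin x := by
  rw [meanSpin, mul_div_cancel₀]
  exact_mod_cast hn.ne'

theorem centredCoupling_symm {Q : Matrix (Fin n) (Fin n) ℝ} (hQ : ∀ i j, Q i j = Q j i) :
    (centredCoupling Q).IsHermitian := by
  ext i j
  simp only [centredCoupling, conjTranspose_apply, of_apply, star_trivial]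
  rw [hQ j i]; ring

theorem sum_mulVec_centred (Q : Matrix (Fin n) (Fin n) ℝ) (v : Fin n → ℝ) (i : Fin n) :
    (centredCoupling Q *ᵥ v) i = ∑ j, Q i j * v j - (∑ j, v j) / n * (1 + rowDev Q i)
      - (∑ j, rowDev Q j * v j) / n := by
  simp only [centredCoupling, mulVec, dotProduct, of_apply]
  have e : ∀ j, (Q i j - (1 + rowDev Q i + rowDev Q j) / n) * v j
      = Q i j * v j - v j * ((1 + rowDev Q i) / n) - rowDev Q j * v j / n := fun j => by ring
  simp_rw [e]
  rw [Finset.sum_sub_distrib, Finset.sum_sub_distrib, ← Finset.sum_mul, ← Finset.sum_div]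
  ring

/-- This makes R insensitive to the centring of the spins, so its quadratic form can be studied
under product laws of any mean. -/
theorem centredCoupling_mulVec_one (hn : 0 < n) {Q : Matrix (Fin n) (Fin n) ℝ}
    (hδ : ∑ i, rowDev Q i = 0) : centredCoupling Q *ᵥ (fun _ => 1) = 0 := by
  have hn' : (n : ℝ) ≠ 0 := by exact_mod_cast hn.ne'
  funext i
  rw [sum_mulVec_centred]
  simp only [mul_one, hδ, Finset.sum_const, Finset.card_univ, Fintype.card_fin, nsmul_eq_mul,
    Pi.zero_apply]
  rw [rowDev]
  field_simp
  ring

/-- Separates magnetisation, degree irregularity and the part acting on mean-zero vectors. At fixed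
magnetisation the first term is constant and the second linear. -/
theorem energy_eq (hn : 0 < n) (Q : Matrix (Fin n) (Fin n) ℝ) (x : Spins (Fin n)) :
    energy Q x = n * meanSpin x ^ 2 + 2 * meanSpin x * (rowDev Q ⬝ᵥ spinVec x)
      + spinVec x ⬝ᵥ (centredCoupling Q *ᵥ spinVec x) := by
  have hn' : (n : ℝ) ≠ 0 := by exact_mod_cast hn.ne'
  have e : ∀ i, spinVec x i * (centredCoupling Q *ᵥ spinVec x) i
      = spin (x i) * localField Q x i - meanSpin x * (rowDev Q i * spin (x i))
        - spin (x i) * (meanSpin x + (rowDev Q ⬝ᵥ spinVec x) / n) := by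
    intro i
    rw [sum_mulVec_centred]
    simp only [spinVec, localField, dotProduct, meanSpin]
    ring
  rw [energy_eq_sum_localField]
  conv_rhs => rw [dotProduct, dotProduct]
  simp_rw [e]
  rw [Finset.sum_sub_distrib, Finset.sum_sub_distrib, ← Finset.mul_sum, ← Finset.sum_mul,
    sum_spin_eq hn]
  simp only [dotProduct, spinVec]
  field_simp
  ring

theorem centred_eq (τ : ℝ) (x : Spins (Fin n)) : centred τ x = spinVec x - τ • (fun _ => 1) := by
  funext i; simp [centred, spinVec]

/-! ### Bounds on slices of constant magnetisation -/

/-- Configurations with average spin `m`. -/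
noncomputable def slice (n : ℕ) (m : ℝ) : Finset (Spins (Fin n)) :=
  Finset.univ.filter fun x => ∑ i, spin (x i) = n * m

theorem fieldWeight_of_mem_slice {m h : ℝ} {x : Spins (Fin n)} (hx : x ∈ slice n m) :
    fieldWeight h x = Real.exp (h * (n * m)) := by
  rw [fieldWeight, (Finset.mem_filter.1 hx).2]

/-- On a slice the tilt by field βm is the constant exp(nβm²), so a bound under the product law
transfers to the slice, and (2 cosh βm)^n exp(-nβm²) is the stated free-energy factor. -/
theorem sum_slice_le_of_tilt {β m X : ℝ} (f : Spins (Fin n) → ℝ)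
    (hf : ∑ x, fieldWeight (β * m) x * Real.exp (f x)
      ≤ (2 * Real.cosh (β * m)) ^ n * Real.exp X) :
    ∑ x ∈ slice n m, Real.exp (f x)
      ≤ Real.exp (n * (freeEnergy β m - β / 2 * m ^ 2) + X) := by
  have h1 : Real.exp (n * (β * m ^ 2)) * ∑ x ∈ slice n m, Real.exp (f x)
      ≤ (2 * Real.cosh (β * m)) ^ n * Real.exp X := by
    refine le_trans ?_ hf
    rw [Finset.mul_sum]
    calc _ = ∑ x ∈ slice n m, fieldWeight (β * m) x * Real.exp (f x) := by
          refine Finset.sum_congr rfl fun x hx => ?_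
          rw [fieldWeight_of_mem_slice hx]
          congr 2; ring
      _ ≤ _ := Finset.sum_le_sum_of_subset_of_nonneg (Finset.subset_univ _) fun x _ _ =>
          mul_nonneg (fieldWeight_pos _ x).le (Real.exp_pos _).le
  rw [exp_freeEnergy, ← Real.exp_add] at h1
  have h2 := mul_le_mul_of_nonneg_left h1 (Real.exp_pos (-(n * (β * m ^ 2)))).le
  rw [← mul_assoc, ← Real.exp_add, ← Real.exp_add, neg_add_cancel, Real.exp_zero, one_mul] at h2
  refine h2.trans_eq ?_
  congr 1; ring

/-- The tilt uses field βt rather than βm: at t the variance proxy is 1/β, so p β ev stays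
subcritical as soon as p ev < 1. The mismatch m - t is corrected by a shift along constants, which
is orthogonal to the eigenvectors involved. The outcome carries F(t) in place of F(m). -/
theorem sum_slice_big_le {β t : ℝ} (hβ : 0 < β) (ht : 0 < t) (hfix : t = Real.tanh (β * t))
    {A : Matrix (Fin n) (Fin n) ℝ} {ev : Fin n → ℝ} {w : Fin n → Fin n → ℝ}
    (hA : IsEigenbasis A ev w) (h1 : A *ᵥ (fun _ => 1) = 0) {p c δ : ℝ} (hp : 0 ≤ p) (hc : 0 < c)
    (hδ : 0 < δ) (hδ1 : δ ≤ 1) (hev : ∀ k, p * ev k ≤ 1 - δ) (m : ℝ) :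
    ∑ x ∈ slice n m, Real.exp
        (p * (β / 2 * ∑ k ∈ Finset.univ.filter (fun k => c ≤ ev k),
          ev k * (w k ⬝ᵥ spinVec x) ^ 2))
      ≤ Real.exp (n * (freeEnergy β t - β / 2 * m ^ 2)
        + Real.log δ⁻¹ / (2 * c ^ 2) * ∑ k, ev k ^ 2) := by
  set F := Finset.univ.filter (fun k => c ≤ ev k)
  have hF : ∀ k ∈ F, c ≤ ev k := fun k hk => (Finset.mem_filter.1 hk).2
  have hw1 : ∀ k ∈ F, w k ⬝ᵥ (fun _ => (1 : ℝ)) = 0 := by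
    intro k hk
    have := hA.dot_mulVec k (fun _ => 1)
    rw [h1, dotProduct_zero] at this
    rcases mul_eq_zero.1 this.symm with h | h
    · have := hF k hk; linarith
    · exact h
  set a := m - t with ha
  set θ : Fin n → ℝ := (β * a) • (fun _ => 1) with hθ
  have hsub := isSubgaussian_of_cosh (ι := Fin n) (cosh_add_le_of_fixed hβ ht hfix)
  have hb := hβ.ne'
  have key := hsub.sum_exp_quad_le hA.ortho F (ev := fun k => p * β * ev k)
    (fun k hk => mul_nonneg (mul_nonneg hp hβ.le) (hc.le.trans (hF k hk)))
    (fun k _ => by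
      have := hev k
      rw [← mul_assoc, mul_comm p β, ← mul_assoc, inv_mul_cancel₀ hb, one_mul]
      linarith) θ (fun k hk => by rw [hθ, dotProduct_smul, hw1 k hk, smul_zero])
  have hprod : ∏ k ∈ F, (Real.sqrt (1 - β⁻¹ * (p * β * ev k)))⁻¹
      ≤ Real.exp (Real.log δ⁻¹ / (2 * c ^ 2) * ∑ k, ev k ^ 2) := by
    have hl : 0 ≤ Real.log δ⁻¹ := Real.log_nonneg ((one_le_inv₀ hδ).2 hδ1)
    calc ∏ k ∈ F, (Real.sqrt (1 - β⁻¹ * (p * β * ev k)))⁻¹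
        ≤ ∏ k ∈ F, Real.exp (Real.log δ⁻¹ / (2 * c ^ 2) * ev k ^ 2) := by
          refine Finset.prod_le_prod (fun k _ => by positivity) fun k hk => ?_
          have e : β⁻¹ * (p * β * ev k) = p * ev k := by field_simp
          rw [e]
          have h2 : δ ≤ 1 - p * ev k := by linarith [hev k]
          have h3 : (Real.sqrt (1 - p * ev k))⁻¹ ≤ (Real.sqrt δ)⁻¹ := by gcongr
          refine h3.trans ?_
          have h4 : (Real.sqrt δ)⁻¹ = Real.exp (Real.log δ⁻¹ / 2) := by
            rw [← Real.sqrt_inv, ← Real.exp_log (Real.sqrt_pos.2 (inv_pos.2 hδ)),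
              Real.log_sqrt (inv_pos.2 hδ).le]
          rw [h4]
          refine Real.exp_le_exp.2 ?_
          -- Chebyshev count of large eigenvalues: each factor δ^{-1/2} is charged to ev²/c², so the
          -- product is controlled by the Frobenius norm.
          have h5 : 1 ≤ ev k ^ 2 / c ^ 2 := by
            rw [one_le_div (by positivity)]
            have := hF k hk
            gcongr
          calc Real.log δ⁻¹ / 2 ≤ Real.log δ⁻¹ / 2 * (ev k ^ 2 / c ^ 2) :=
                le_mul_of_one_le_right (by positivity) h5
            _ = _ := by field_simp
      _ = Real.exp (Real.log δ⁻¹ / (2 * c ^ 2) * ∑ k ∈ F, ev k ^ 2) := by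
          rw [← Real.exp_sum, Finset.mul_sum]
      _ ≤ _ := by
          refine Real.exp_le_exp.2 (mul_le_mul_of_nonneg_left ?_ (by positivity))
          exact Finset.sum_le_sum_of_subset_of_nonneg (Finset.subset_univ _)
            fun k _ _ => sq_nonneg _
  have hθθ : θ ⬝ᵥ θ = n * (β * a) ^ 2 := by
    simp only [hθ, dotProduct, Pi.smul_apply, smul_eq_mul, mul_one, Finset.sum_const,
      Finset.card_univ, Fintype.card_fin, nsmul_eq_mul]
    ring
  rw [hθθ, Fintype.card_fin, exp_freeEnergy] at key
  have hslice : ∀ x ∈ slice n m, fieldWeight (β * t) x * Real.exp (θ ⬝ᵥ centred t x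
      + (∑ k ∈ F, p * β * ev k * (w k ⬝ᵥ centred t x) ^ 2) / 2)
      = Real.exp (β * t * (n * m) + n * (β * a ^ 2)) *
        Real.exp (p * (β / 2 * ∑ k ∈ F, ev k * (w k ⬝ᵥ spinVec x) ^ 2)) := by
    intro x hx
    have hs := (Finset.mem_filter.1 hx).2
    have e1 : θ ⬝ᵥ centred t x = n * (β * a ^ 2) := by
      have : θ ⬝ᵥ centred t x = β * a * (∑ i, spin (x i) - n * t) := by
        simp [hθ, dotProduct, centred, ← Finset.mul_sum, Finset.sum_sub_distrib]
      rw [this, hs, ha]; ring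
    have e2 : ∀ k ∈ F, w k ⬝ᵥ centred t x = w k ⬝ᵥ spinVec x := by
      intro k hk
      rw [centred_eq, dotProduct_sub, dotProduct_smul, hw1 k hk]; simp
    have e3 : (∑ k ∈ F, p * β * ev k * (w k ⬝ᵥ centred t x) ^ 2) / 2
        = p * (β / 2 * ∑ k ∈ F, ev k * (w k ⬝ᵥ spinVec x) ^ 2) := by
      rw [Finset.mul_sum, Finset.mul_sum, Finset.sum_div]
      refine Finset.sum_congr rfl fun k hk => ?_
      rw [e2 k hk]; ring
    rw [fieldWeight_of_mem_slice hx, e1, e3, ← Real.exp_add, ← Real.exp_add]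
    congr 1; ring
  have h5 : Real.exp (β * t * (n * m) + n * (β * a ^ 2)) * ∑ x ∈ slice n m, Real.exp
      (p * (β / 2 * ∑ k ∈ F, ev k * (w k ⬝ᵥ spinVec x) ^ 2))
      ≤ Real.exp (n * (freeEnergy β t + β / 2 * t ^ 2)) *
        Real.exp (β⁻¹ / 2 * (n * (β * a) ^ 2)) *
        Real.exp (Real.log δ⁻¹ / (2 * c ^ 2) * ∑ k, ev k ^ 2) := by
    rw [Finset.mul_sum, ← Finset.sum_congr rfl hslice]
    refine (Finset.sum_le_sum_of_subset_of_nonneg (Finset.subset_univ _) fun x _ _ =>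
          mul_nonneg (fieldWeight_pos _ x).le (Real.exp_pos _).le).trans (key.trans ?_)
    gcongr
  rw [← Real.exp_add, ← Real.exp_add] at h5
  have h6 := mul_le_mul_of_nonneg_left h5
    (Real.exp_pos (-(β * t * (n * m) + n * (β * a ^ 2)))).le
  rw [← mul_assoc, ← Real.exp_add, ← Real.exp_add, neg_add_cancel, Real.exp_zero, one_mul] at h6
  refine h6.trans_eq ?_
  congr 1
  rw [ha]
  field_simp
  ring

theorem sum_slice_linear_le {β m : ℝ} (hm : |m| ≤ 1) {δ : Fin n → ℝ} (hδ : ∑ i, δ i = 0)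
    (b : ℝ) :
    ∑ x ∈ slice n m, Real.exp (b * m * (δ ⬝ᵥ spinVec x))
      ≤ Real.exp (n * (freeEnergy β m - β / 2 * m ^ 2) + b ^ 2 * ∑ i, δ i ^ 2) := by
  refine sum_slice_le_of_tilt _ ?_
  have key := isSubgaussian_centred_tanh (ι := Fin n) (β * m) ((b * m) • δ)
  have e : ∀ x : Spins (Fin n), ((b * m) • δ) ⬝ᵥ centred (Real.tanh (β * m)) x
      = b * m * (δ ⬝ᵥ spinVec x) := by
    intro x
    have : δ ⬝ᵥ (fun _ => (1 : ℝ)) = 0 := by simp [dotProduct, hδ]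
    rw [centred_eq, smul_dotProduct, dotProduct_sub, dotProduct_smul, this]
    simp
  simp_rw [e] at key
  rw [Fintype.card_fin] at key
  refine key.trans ?_
  have hc := Real.cosh_pos (β * m)
  refine mul_le_mul_of_nonneg_left (Real.exp_le_exp.2 ?_) (by positivity)
  have e2 : ((b * m) • δ) ⬝ᵥ ((b * m) • δ) = (b * m) ^ 2 * ∑ i, δ i ^ 2 := by
    simp only [dotProduct, Pi.smul_apply, smul_eq_mul]
    rw [Finset.mul_sum]
    exact Finset.sum_congr rfl fun i _ => by ring
  rw [e2]
  have h1 : m ^ 2 ≤ 1 := by rw [← sq_abs]; exact pow_le_one₀ (abs_nonneg _) hm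
  have h2 : 0 ≤ ∑ i, δ i ^ 2 := Finset.sum_nonneg fun i _ => sq_nonneg _
  have h3 : (b * m) ^ 2 ≤ b ^ 2 := by
    rw [mul_pow]; exact mul_le_of_le_one_right (sq_nonneg b) h1
  have h4 := mul_le_mul_of_nonneg_right h3 h2
  have h5 : 0 ≤ b ^ 2 * ∑ i, δ i ^ 2 := by positivity
  linarith

/-- Applies the Gaussian bound to √(2b) A; b ≤ 1/36 turns the norm bound 9 into 18/36 = 1/2. -/
theorem sum_slice_norm_le {β m : ℝ} {A : Matrix (Fin n) (Fin n) ℝ}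
    (h1 : A *ᵥ (fun _ => 1) = 0) (hop : ∀ v, (A *ᵥ v) ⬝ᵥ (A *ᵥ v) ≤ 9 * (v ⬝ᵥ v))
    {b : ℝ} (hb : 0 ≤ b) (hb1 : b ≤ 1 / 36) :
    ∑ x ∈ slice n m, Real.exp (b * ((A *ᵥ spinVec x) ⬝ᵥ (A *ᵥ spinVec x)))
      ≤ Real.exp (n * (freeEnergy β m - β / 2 * m ^ 2) + ∑ i, ∑ j, A i j ^ 2) := by
  refine sum_slice_le_of_tilt _ ?_
  set B : Matrix (Fin n) (Fin n) ℝ := Real.sqrt (2 * b) • A with hB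
  have hsq := Real.mul_self_sqrt (show 0 ≤ 2 * b by positivity)
  have e : ∀ v, (B *ᵥ v) ⬝ᵥ (B *ᵥ v) = 2 * b * ((A *ᵥ v) ⬝ᵥ (A *ᵥ v)) := by
    intro v
    rw [hB, smul_mulVec, smul_dotProduct, dotProduct_smul, smul_eq_mul, smul_eq_mul, ← mul_assoc,
      hsq]
  have hc := Real.cosh_pos (β * m)
  have key := (isSubgaussian_centred_tanh (ι := Fin n) (β * m)).sum_exp_sq_le (by positivity) B
    (fun v => by
      rw [e]
      have := hop v
      have h0 : 0 ≤ v ⬝ᵥ v := Finset.sum_nonneg fun i _ => mul_self_nonneg _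
      nlinarith)
  rw [Fintype.card_fin] at key
  have e2 : ∀ x : Spins (Fin n), A *ᵥ centred (Real.tanh (β * m)) x = A *ᵥ spinVec x := by
    intro x
    rw [centred_eq, mulVec_sub, mulVec_smul, h1, smul_zero, sub_zero]
  simp_rw [e, e2] at key
  have e3 : ∀ r : ℝ, 2 * b * r / 2 = b * r := fun r => by ring
  simp_rw [e3] at key
  refine key.trans ?_
  refine mul_le_mul_of_nonneg_left (Real.exp_le_exp.2 ?_) (by positivity)
  refine Finset.sum_le_sum fun i _ => Finset.sum_le_sum fun j _ => ?_
  rw [hB, Matrix.smul_apply, smul_eq_mul, mul_pow, Real.sq_sqrt (by positivity)]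
  exact mul_le_of_le_one_left (sq_nonneg _) (by linarith)

/-- Truncation to |ev| < c makes b A small in operator norm, so Hanson-Wright applies off the
diagonal under any field, with no need for variance proxy 1/β. -/
theorem sum_slice_small_le {β m : ℝ} {A : Matrix (Fin n) (Fin n) ℝ} {ev : Fin n → ℝ}
    {w : Fin n → Fin n → ℝ} (hA : IsEigenbasis A ev w) (h1 : A *ᵥ (fun _ => 1) = 0)
    {b c : ℝ} (hb : 0 ≤ b) (hc : 0 < c) (hbc : b * c ≤ 1 / 6) :
    ∑ x ∈ slice n m, Real.exp (b * ∑ k ∈ Finset.univ.filter (fun k => |ev k| < c),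
          ev k * (w k ⬝ᵥ spinVec x) ^ 2)
      ≤ Real.exp (n * (freeEnergy β m - β / 2 * m ^ 2)
        + (4 * b * ∑ i, |A i i| + (16 * b ^ 2 + 4 * b / c) * ∑ k, ev k ^ 2)) := by
  refine sum_slice_le_of_tilt _ ?_
  set F := Finset.univ.filter (fun k => |ev k| < c) with hF
  set ev' : Fin n → ℝ := fun k => if |ev k| < c then b * ev k else 0 with hev'
  have hT := hA.truncate ev'
  set T : Matrix (Fin n) (Fin n) ℝ := of fun i j => ∑ k, ev' k * w k i * w k j with hTdef
  set y : Spins (Fin n) → Fin n → ℝ := centred (Real.tanh (β * m)) with hy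
  have hw1 : ∀ k, ev k ≠ 0 → w k ⬝ᵥ (fun _ => (1 : ℝ)) = 0 := by
    intro k hk
    have := hA.dot_mulVec k (fun _ => 1)
    rw [h1, dotProduct_zero] at this
    exact (mul_eq_zero.1 this.symm).resolve_left hk
  have hquad : ∀ x, b * ∑ k ∈ F, ev k * (w k ⬝ᵥ spinVec x) ^ 2 = y x ⬝ᵥ (T *ᵥ y x) := by
    intro x
    rw [hT.quad, hF, Finset.sum_filter, Finset.mul_sum]
    refine Finset.sum_congr rfl fun k _ => ?_
    simp only [hev']
    split_ifs with h
    · rcases eq_or_ne (ev k) 0 with h0 | h0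
      · simp [h0]
      · rw [hy, centred_eq, dotProduct_sub, dotProduct_smul, hw1 k h0, smul_zero, sub_zero]
        ring
    · simp
  have hev'le : ∀ k, ev' k ^ 2 ≤ b ^ 2 * ev k ^ 2 := by
    intro k
    simp only [hev']
    split_ifs
    · rw [mul_pow]
    · have : 0 ≤ b ^ 2 * ev k ^ 2 := by positivity
      simpa using this
  have hop : ∀ v, (T *ᵥ v) ⬝ᵥ (T *ᵥ v) ≤ (v ⬝ᵥ v) / 32 := by
    intro v
    rw [hT.sq_mulVec, hT.dot_self, Finset.sum_div]
    refine Finset.sum_le_sum fun k _ => ?_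
    have h2 : ev' k ^ 2 ≤ 1 / 36 := by
      simp only [hev']
      split_ifs with h
      · rw [← sq_abs, abs_mul, abs_of_nonneg hb]
        have : b * |ev k| ≤ 1 / 6 := (mul_le_mul_of_nonneg_left h.le hb).trans hbc
        have h3 : 0 ≤ b * |ev k| := by positivity
        nlinarith
      · norm_num
    have := mul_le_mul_of_nonneg_right h2 (sq_nonneg (w k ⬝ᵥ v))
    have := sq_nonneg (w k ⬝ᵥ v)
    linarith
  -- The diagonal of T is that of bA minus the removed spectral part, where |ev| ≥ c gives |ev| ≤
  -- ev²/c.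
  have hdiag : ∑ i, |T i i| ≤ b * ∑ i, |A i i| + b / c * ∑ k, ev k ^ 2 := by
    have e : ∀ i, T i i = b * A i i - ∑ k, (b * ev k - ev' k) * (w k i * w k i) := by
      intro i
      rw [hA.repr, hTdef, of_apply, Finset.mul_sum, ← Finset.sum_sub_distrib]
      exact Finset.sum_congr rfl fun k _ => by ring
    have h2 : ∀ k, |b * ev k - ev' k| ≤ b / c * ev k ^ 2 := by
      intro k
      simp only [hev']
      split_ifs with h
      · simp only [sub_self, abs_zero]; positivity
      · push Not at h
        rw [sub_zero, abs_mul, abs_of_nonneg hb, div_mul_eq_mul_div, le_div_iff₀ hc, mul_assoc,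
          ← sq_abs (ev k), sq]
        gcongr
    calc ∑ i, |T i i| ≤ ∑ i, (b * |A i i| + ∑ k, b / c * ev k ^ 2 * (w k i * w k i)) := by
          refine Finset.sum_le_sum fun i _ => ?_
          rw [e]
          refine (abs_sub _ _).trans (add_le_add ?_ ?_)
          · rw [abs_mul, abs_of_nonneg hb]
          · refine (Finset.abs_sum_le_sum_abs _ _).trans (Finset.sum_le_sum fun k _ => ?_)
            rw [abs_mul, abs_mul_self]
            exact mul_le_mul_of_nonneg_right (h2 k) (mul_self_nonneg _)
      _ = _ := by
          rw [Finset.sum_add_distrib, ← Finset.mul_sum, Finset.sum_comm]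
          congr 1
          rw [Finset.mul_sum]
          refine Finset.sum_congr rfl fun k _ => ?_
          have := hA.ortho k k
          rw [if_pos rfl, dotProduct] at this
          rw [← Finset.mul_sum, this, mul_one]
  have hysq : ∀ x i, y x i * y x i ≤ 4 := by
    intro x i
    have h2 := abs_sub (spin (x i)) (Real.tanh (β * m))
    rw [abs_spin] at h2
    have h3 := Real.abs_tanh_lt_one (β * m)
    have h4 : |y x i| ≤ 2 := by simp only [hy, centred]; linarith
    rw [← abs_mul_abs_self]
    nlinarith [abs_nonneg (y x i)]
  have hsplit : ∀ x, y x ⬝ᵥ (T *ᵥ y x) ≤ (∑ i, ∑ j, if i = j then 0 else T i j * y x i * y x j)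
      + 4 * ∑ i, |T i i| := by
    intro x
    have e : y x ⬝ᵥ (T *ᵥ y x) = (∑ i, ∑ j, if i = j then 0 else T i j * y x i * y x j)
        + ∑ i, T i i * (y x i * y x i) := by
      rw [← Finset.sum_add_distrib, dotProduct]
      refine Finset.sum_congr rfl fun i _ => ?_
      have e2 : T i i * (y x i * y x i) = ∑ j, if i = j then T i j * y x i * y x j else 0 := by
        rw [Finset.sum_ite_eq]
        simp [mul_assoc]
      rw [e2, ← Finset.sum_add_distrib, mulVec, dotProduct, Finset.mul_sum]
      refine Finset.sum_congr rfl fun j _ => ?_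
      split_ifs <;> ring
    rw [e]
    have : ∑ i, T i i * (y x i * y x i) ≤ 4 * ∑ i, |T i i| := by
      rw [Finset.mul_sum]
      refine Finset.sum_le_sum fun i _ => ?_
      have h2 := le_abs_self (T i i)
      have h3 := mul_le_mul_of_nonneg_right h2 (mul_self_nonneg (y x i))
      have h4 := mul_le_mul_of_nonneg_left (hysq x i) (abs_nonneg (T i i))
      linarith
    linarith
  have hHW := sum_fieldWeight_offDiag_le (β * m) T hT.symm hop
  rw [Fintype.card_fin, hT.frobenius] at hHW
  have hcosh := Real.cosh_pos (β * m)
  calc ∑ x, fieldWeight (β * m) x * Real.exp (b * ∑ k ∈ F, ev k * (w k ⬝ᵥ spinVec x) ^ 2)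
      ≤ ∑ x, fieldWeight (β * m) x * Real.exp
        (∑ i, ∑ j, if i = j then 0 else T i j * y x i * y x j) * Real.exp (4 * ∑ i, |T i i|) := by
        refine Finset.sum_le_sum fun x _ => ?_
        rw [mul_assoc, ← Real.exp_add, hquad]
        exact mul_le_mul_of_nonneg_left (Real.exp_le_exp.2 (hsplit x)) (fieldWeight_pos _ x).le
    _ ≤ ((2 * Real.cosh (β * m)) ^ n * Real.exp (16 * ∑ k, ev' k ^ 2)) *
        Real.exp (4 * ∑ i, |T i i|) := by
        rw [← Finset.sum_mul]
        exact mul_le_mul_of_nonneg_right hHW (Real.exp_pos _).le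
    _ ≤ _ := by
        rw [mul_assoc, ← Real.exp_add]
        refine mul_le_mul_of_nonneg_left (Real.exp_le_exp.2 ?_) (by positivity)
        have h2 : ∑ k, ev' k ^ 2 ≤ b ^ 2 * ∑ k, ev k ^ 2 := by
          rw [Finset.mul_sum]; exact Finset.sum_le_sum fun k _ => hev'le k
        have e : 4 * b / c = 4 * (b / c) := by ring
        rw [e]
        linarith

/-- Young's inequality for sums of exponentials. -/
theorem sum_exp_add_le {Ω : Type*} (s : Finset Ω) (f g : Ω → ℝ) {p q α γ : ℝ} (hp : 0 < p)
    (hq : 0 < q) (hpq : 1 / p + 1 / q = 1) (hf : ∑ x ∈ s, Real.exp (p * f x) ≤ Real.exp α)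
    (hg : ∑ x ∈ s, Real.exp (q * g x) ≤ Real.exp γ) :
    ∑ x ∈ s, Real.exp (f x + g x) ≤ Real.exp (α / p + γ / q) := by
  have hp' := hp.ne'
  have hq' := hq.ne'
  have hx : ∀ x, Real.exp (f x + g x) ≤ Real.exp (α / p + γ / q) *
      (1 / p * (Real.exp (p * f x) * Real.exp (-α)) +
        1 / q * (Real.exp (q * g x) * Real.exp (-γ))) := by
    intro x
    have h := convexOn_exp.2 (Set.mem_univ (p * f x - α)) (Set.mem_univ (q * g x - γ))
      (show 0 ≤ 1 / p by positivity) (show 0 ≤ 1 / q by positivity) hpq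
    simp only [smul_eq_mul] at h
    rw [← Real.exp_add, ← Real.exp_add, ← sub_eq_add_neg, ← sub_eq_add_neg]
    refine le_trans (le_of_eq ?_) (mul_le_mul_of_nonneg_left h (Real.exp_pos _).le)
    rw [← Real.exp_add]
    congr 1
    field_simp
    ring
  refine (Finset.sum_le_sum fun x _ => hx x).trans ?_
  rw [← Finset.mul_sum, Finset.sum_add_distrib, ← Finset.mul_sum, ← Finset.mul_sum,
    ← Finset.sum_mul, ← Finset.sum_mul]
  have h1 : (∑ x ∈ s, Real.exp (p * f x)) * Real.exp (-α) ≤ 1 := by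
    rw [Real.exp_neg, ← div_eq_mul_inv, div_le_one (Real.exp_pos _)]; exact hf
  have h2 : (∑ x ∈ s, Real.exp (q * g x)) * Real.exp (-γ) ≤ 1 := by
    rw [Real.exp_neg, ← div_eq_mul_inv, div_le_one (Real.exp_pos _)]; exact hg
  have h3 := mul_le_mul_of_nonneg_left h1 (show 0 ≤ 1 / p by positivity)
  have h4 := mul_le_mul_of_nonneg_left h2 (show 0 ≤ 1 / q by positivity)
  refine mul_le_of_le_one_right (Real.exp_pos _).le ?_
  linarith

/-- The sum is at most three times the largest term. This crude Hölder inequality suffices since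
constant factors are harmless. -/
theorem exp_add_three_le (u v w : ℝ) :
    Real.exp (u + v + w) ≤ Real.exp (3 * u) + Real.exp (3 * v) + Real.exp (3 * w) := by
  have hu := Real.exp_pos (3 * u)
  have hv := Real.exp_pos (3 * v)
  have hw := Real.exp_pos (3 * w)
  rcases le_total u v with h1 | h1
  · rcases le_total v w with h2 | h2
    · have := Real.exp_le_exp.2 (show u + v + w ≤ 3 * w by linarith); linarith
    · have := Real.exp_le_exp.2 (show u + v + w ≤ 3 * v by linarith); linarith
  · rcases le_total u w with h2 | h2
    · have := Real.exp_le_exp.2 (show u + v + w ≤ 3 * w by linarith); linarith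
    · have := Real.exp_le_exp.2 (show u + v + w ≤ 3 * u by linarith); linarith

end Ising

namespace Ising

open Matrix

variable {n : ℕ}

/-! ### The exponential moment bound at low temperature -/

/-- The total spin is an integer between -n and n, so there are at most 2n + 1 slices. -/
theorem sum_le_of_slice_le (hn : 0 < n) (f : Spins (Fin n) → ℝ) {U : ℝ}
    (h : ∀ m, |m| ≤ 1 → ∑ x ∈ slice n m, f x ≤ U) : ∑ x, f x ≤ (2 * n + 1) * U := by
  classical
  have hn' : (0 : ℝ) < n := by exact_mod_cast hn
  let M : Spins (Fin n) → ℤ := fun x => ∑ i, ((x i : ℤˣ) : ℤ)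
  have hM : ∀ x, ((M x : ℤ) : ℝ) = ∑ i, spin (x i) := fun x => by simp [M, spin]
  have hmem : ∀ x ∈ (Finset.univ : Finset (Spins (Fin n))), M x ∈ Finset.Icc (-(n : ℤ)) n := by
    intro x _
    have := abs_le.1 (abs_sum_spin_le x)
    rw [Fintype.card_fin, ← hM] at this
    rw [Finset.mem_Icc]
    exact ⟨by exact_mod_cast this.1, by exact_mod_cast this.2⟩
  rw [← Finset.sum_fiberwise_of_maps_to hmem f]
  have hb : ∀ k ∈ Finset.Icc (-(n : ℤ)) n, ∑ x ∈ Finset.univ.filter (fun x => M x = k), f x ≤ U := by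
    intro k hk
    rw [Finset.mem_Icc] at hk
    have hk' : |(k : ℝ) / n| ≤ 1 := by
      rw [abs_div, abs_of_pos hn', div_le_one hn', abs_le]
      exact ⟨by exact_mod_cast hk.1, by exact_mod_cast hk.2⟩
    refine le_trans (le_of_eq ?_) (h _ hk')
    refine Finset.sum_congr ?_ fun _ _ => rfl
    ext x
    simp only [slice, Finset.mem_filter, Finset.mem_univ, true_and]
    rw [mul_div_cancel₀ _ hn'.ne', ← hM]
    exact Int.cast_inj.symm
  refine (Finset.sum_le_card_nsmul _ _ _ hb).trans (le_of_eq ?_)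
  rw [nsmul_eq_mul, Int.card_Icc]
  congr 1
  have : ((n : ℤ) + 1 - -(n : ℤ)).toNat = 2 * n + 1 := by omega
  rw [this]; push_cast; ring

/-- Eigenvalues at most -c contribute negatively and are dropped: only an upper bound on the energy
is needed. -/
theorem IsEigenbasis.quad_le_big_add_small {A : Matrix (Fin n) (Fin n) ℝ} {ev : Fin n → ℝ}
    {w : Fin n → Fin n → ℝ} (hA : IsEigenbasis A ev w) (c : ℝ) (v : Fin n → ℝ) :
    v ⬝ᵥ (A *ᵥ v) ≤ ∑ k ∈ Finset.univ.filter (fun k => c ≤ ev k), ev k * (w k ⬝ᵥ v) ^ 2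
      + ∑ k ∈ Finset.univ.filter (fun k => |ev k| < c), ev k * (w k ⬝ᵥ v) ^ 2 := by
  rw [hA.quad, Finset.sum_filter, Finset.sum_filter, ← Finset.sum_add_distrib]
  refine Finset.sum_le_sum fun k _ => ?_
  have h0 := sq_nonneg (w k ⬝ᵥ v)
  by_cases h1 : c ≤ ev k
  · have h2 : ¬ |ev k| < c := not_lt.2 (h1.trans (le_abs_self _))
    rw [if_pos h1, if_neg h2, add_zero]
  · rw [if_neg h1, zero_add]
    split_ifs with h2
    · exact le_rfl
    · push Not at h1 h2
      have : ev k ≤ 0 := by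
        by_contra h3
        push Not at h3
        rw [abs_of_pos h3] at h2
        linarith
      exact mul_nonpos_of_nonpos_of_nonneg this h0

/-- Everything except the large positive eigenvalues, tilted at βm so that the bound carries F(m)
and retains the free-energy gap. -/
theorem sum_slice_rest_le {β m : ℝ} (hm : |m| ≤ 1) {A : Matrix (Fin n) (Fin n) ℝ} {ev : Fin n → ℝ}
    {w : Fin n → Fin n → ℝ} (hA : IsEigenbasis A ev w) (h1 : A *ᵥ (fun _ => 1) = 0)
    (hop : ∀ v, (A *ᵥ v) ⬝ᵥ (A *ᵥ v) ≤ 9 * (v ⬝ᵥ v)) (hdiag : ∑ i, |A i i| ≤ 3)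
    {δ : Fin n → ℝ} (hδ : ∑ i, δ i = 0) {a b c κ : ℝ} (hb : 0 ≤ b) (hc : 0 < c)
    (hbc : 3 * b * c ≤ 1 / 6) (hκ : 0 ≤ κ) (hκ1 : 3 * κ ≤ 1 / 36) :
    ∑ x ∈ slice n m, Real.exp (b * ∑ k ∈ Finset.univ.filter (fun k => |ev k| < c),
          ev k * (w k ⬝ᵥ spinVec x) ^ 2 + a * m * (δ ⬝ᵥ spinVec x)
          + κ * ((A *ᵥ spinVec x) ⬝ᵥ (A *ᵥ spinVec x)))
      ≤ Real.exp (n * (freeEnergy β m - β / 2 * m ^ 2)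
        + (36 * b + 144 * b ^ 2 + 12 * b / c + 9 * a ^ 2 + 3) *
          (1 + ∑ i, ∑ j, A i j ^ 2 + ∑ i, δ i ^ 2)) := by
  have e1 := sum_slice_small_le (β := β) (m := m) hA h1 (b := 3 * b) (by positivity) hc hbc
  have e2 := sum_slice_linear_le (β := β) hm hδ (3 * a)
  have e3 := sum_slice_norm_le (β := β) (m := m) h1 hop (show 0 ≤ 3 * κ by positivity) hκ1
  rw [← hA.frobenius] at e1
  have hFr0 : 0 ≤ ∑ i, ∑ j, A i j ^ 2 :=
    Finset.sum_nonneg fun i _ => Finset.sum_nonneg fun j _ => sq_nonneg _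
  have hdl0 : 0 ≤ ∑ i, δ i ^ 2 := Finset.sum_nonneg fun i _ => sq_nonneg _
  generalize (∑ i, ∑ j, A i j ^ 2) = Fr at *
  generalize (∑ i, δ i ^ 2) = dl at *
  generalize n * (freeEnergy β m - β / 2 * m ^ 2) = X at *
  generalize (∑ i, |A i i|) = dg at *
  have hbc0 : 0 ≤ 12 * b / c := by positivity
  have hD1 : 0 ≤ b * Fr := by positivity
  have r1 : 4 * (3 * b) * dg + (16 * (3 * b) ^ 2 + 4 * (3 * b) / c) * Fr
      ≤ (36 * b + 144 * b ^ 2 + 12 * b / c + 9 * a ^ 2 + 1) * (1 + Fr + dl) := by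
    have i1 : 4 * (3 * b) * dg ≤ 4 * (3 * b) * 3 := by gcongr
    have i2 : 0 ≤ (36 * b) * (Fr + dl) := by positivity
    have i3 : 0 ≤ (144 * b ^ 2 + 12 * b / c) * (1 + dl) := by positivity
    have i4 : 0 ≤ (9 * a ^ 2 + 1) * (1 + Fr + dl) := by positivity
    have i5 : 4 * (3 * b) / c = 12 * b / c := by ring
    rw [i5]
    linarith
  have r2 : (3 * a) ^ 2 * dl
      ≤ (36 * b + 144 * b ^ 2 + 12 * b / c + 9 * a ^ 2 + 1) * (1 + Fr + dl) := by
    have i3 : 0 ≤ (36 * b + 144 * b ^ 2 + 12 * b / c + 1) * (1 + Fr + dl) := by positivity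
    have i4 : 0 ≤ 9 * a ^ 2 * (1 + Fr) := by positivity
    linarith
  have r3 : Fr ≤ (36 * b + 144 * b ^ 2 + 12 * b / c + 9 * a ^ 2 + 1) * (1 + Fr + dl) := by
    have i3 : 0 ≤ (36 * b + 144 * b ^ 2 + 12 * b / c + 9 * a ^ 2) * (1 + Fr + dl) := by positivity
    linarith
  have hE : 0 ≤ 2 * (Fr + dl) := by positivity
  set E := (36 * b + 144 * b ^ 2 + 12 * b / c + 9 * a ^ 2 + 1) * (1 + Fr + dl) with hEdef
  calc _ ≤ ∑ x ∈ slice n m, (Real.exp (3 * b * ∑ k ∈ Finset.univ.filter (fun k => |ev k| < c),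
          ev k * (w k ⬝ᵥ spinVec x) ^ 2) + Real.exp (3 * a * m * (δ ⬝ᵥ spinVec x))
          + Real.exp (3 * κ * ((A *ᵥ spinVec x) ⬝ᵥ (A *ᵥ spinVec x)))) := by
        refine Finset.sum_le_sum fun x _ => (exp_add_three_le _ _ _).trans (le_of_eq ?_)
        simp only [← mul_assoc]
    _ ≤ Real.exp (X + E) + Real.exp (X + E) + Real.exp (X + E) := by
        rw [Finset.sum_add_distrib, Finset.sum_add_distrib]
        refine add_le_add (add_le_add (e1.trans ?_) (e2.trans ?_)) (e3.trans ?_) <;>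
        exact Real.exp_le_exp.2 (by linarith)
    _ = 3 * Real.exp (X + E) := by ring
    _ ≤ Real.exp 2 * Real.exp (X + E) := by
        refine mul_le_mul_of_nonneg_right ?_ (Real.exp_pos _).le
        have := Real.add_one_le_exp 2
        linarith
    _ = Real.exp (2 + (X + E)) := (Real.exp_add _ _).symm
    _ ≤ _ := by
        refine Real.exp_le_exp.2 ?_
        rw [hEdef]
        linarith

/-- Young combines a bound with F(t) and one with F(m); the weight 1/q on the second retains the gap
c0 Y/q, which absorbs η Y. The slice terms involving B cancel. -/
theorem young_exponent_le {N Ft Fm B Y η c0 p q C1 C2 D : ℝ} (hN : 0 ≤ N) (hY : 0 ≤ Y) (hp : 1 ≤ p)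
    (hq : 1 ≤ q) (hpq : 1 / p + 1 / q = 1) (hη : η ≤ c0 / q) (hF : Fm ≤ Ft - c0 * Y)
    (hC1 : 0 ≤ C1 * D) (hC2 : 0 ≤ C2 * D) :
    N * B + η * (N * Y) + ((N * (Ft - B) + C1 * D) / p + (N * (Fm - B) + C2 * D) / q)
      ≤ N * Ft + (C1 + C2) * D := by
  have hp' : 1 / p = 1 - 1 / q := by linarith
  have hq0 : 0 < q := by linarith
  have k1 : N * Fm / q ≤ N * (Ft - c0 * Y) / q := by gcongr
  have k2 : η * (N * Y) ≤ c0 / q * (N * Y) := by gcongr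
  have k3 : C1 * D / p ≤ C1 * D := div_le_self hC1 hp
  have k4 : C2 * D / q ≤ C2 * D := div_le_self hC2 hq
  have e1 : (N * (Ft - B) + C1 * D) / p = N * (Ft - B) * (1 - 1 / q) + C1 * D / p := by
    rw [← hp']; ring
  have e2 : (N * (Fm - B) + C2 * D) / q = N * Fm / q - N * B * (1 / q) + C2 * D / q := by ring
  have e3 : N * (Ft - c0 * Y) / q = N * Ft * (1 / q) - c0 / q * (N * Y) := by ring
  rw [e1, e2]
  rw [e3] at k1
  linarith

theorem sum_abs_diag_centredCoupling_le (hn : 0 < n) {Q : Matrix (Fin n) (Fin n) ℝ}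
    (hd : ∀ i, Q i i = 0) (hδ : ∀ i, |rowDev Q i| ≤ 1) :
    ∑ i, |centredCoupling Q i i| ≤ 3 := by
  have hn' : (0 : ℝ) < n := by exact_mod_cast hn
  calc ∑ i, |centredCoupling Q i i| ≤ ∑ _i : Fin n, 3 / (n : ℝ) := by
        refine Finset.sum_le_sum fun i _ => ?_
        have h1 := abs_le.1 (hδ i)
        rw [centredCoupling, of_apply, hd, zero_sub, abs_neg, abs_div, abs_of_pos hn']
        refine div_le_div_of_nonneg_right ?_ hn'.le
        rw [abs_le]; constructor <;> linarith
    _ = 3 := by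
        rw [Finset.sum_const, Finset.card_univ, Fintype.card_fin, nsmul_eq_mul]
        field_simp

/-- Exponential moments of the fluctuations of a low-temperature Ising model with a spectral
gap. -/
theorem exists_exponential_moment {β t δ : ℝ} (hβ : 0 < β) (ht : 0 < t)
    (hfix : t = Real.tanh (β * t)) (hδ : 0 < δ) (hδ1 : δ ≤ 1) :
    ∃ η > 0, ∃ C ≥ 0, ∀ n : ℕ, 0 < n → ∀ Q : Matrix (Fin n) (Fin n) ℝ,
      (∀ i j, Q i j = Q j i) → (∀ i, Q i i = 0) → ∑ i, rowDev Q i = 0 →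
      (∀ i, |rowDev Q i| ≤ 1) →
      (∀ v, v ⬝ᵥ (centredCoupling Q *ᵥ v) ≤ (1 - δ) * (v ⬝ᵥ v)) →
      (∀ v, (centredCoupling Q *ᵥ v) ⬝ᵥ (centredCoupling Q *ᵥ v) ≤ 9 * (v ⬝ᵥ v)) →
      ∑ x, Real.exp (β / 2 * energy Q x + η *
        ((centredCoupling Q *ᵥ spinVec x) ⬝ᵥ (centredCoupling Q *ᵥ spinVec x)
          + n * (|meanSpin x| - t) ^ 2))
      ≤ (2 * n + 1) * Real.exp (n * freeEnergy β t
          + C * (1 + ∑ i, ∑ j, centredCoupling Q i j ^ 2 + ∑ i, rowDev Q i ^ 2)) := by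
  obtain ⟨c0, hc0, hfree⟩ := exists_freeEnergy_le hβ ht hfix
  -- Conjugate exponents with p close enough to 1 to keep the spectral gap: (1 + δ/2)(1 - δ) ≤ 1 -
  -- δ/2.
  obtain ⟨p, hp⟩ : ∃ p, p = 1 + δ / 2 := ⟨_, rfl⟩
  obtain ⟨q, hq⟩ : ∃ q, q = 2 / δ + 1 := ⟨_, rfl⟩
  have hp1 : 1 ≤ p := by rw [hp]; linarith
  have hp0 : 0 < p := by linarith
  have hq1 : 1 ≤ q := by
    have : 0 ≤ 2 / δ := by positivity
    rw [hq]; linarith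
  have hq0 : 0 < q := by linarith
  have hpq : 1 / p + 1 / q = 1 := by
    rw [hp, hq]; field_simp
  -- Spectral cutoff at which the small part satisfies the Hanson-Wright condition 3bc = 1/6.
  obtain ⟨c, hc⟩ : ∃ c, c = 1 / (9 * q * β) := ⟨_, rfl⟩
  have hcpos : 0 < c := by rw [hc]; positivity
  obtain ⟨b, hb⟩ : ∃ b, b = q * (β / 2) := ⟨_, rfl⟩
  have hb0 : 0 < b := by rw [hb]; positivity
  have hbc : 3 * b * c ≤ 1 / 6 := by rw [hb, hc]; field_simp; norm_num
  -- The first bound keeps the moment of |Rx|² finite, the second fits inside the free-energy gap.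
  obtain ⟨η, hη⟩ : ∃ η, η = min (1 / (108 * q)) (c0 / q) := ⟨_, rfl⟩
  have hη0 : 0 < η := by rw [hη]; positivity
  have hη1 : 3 * (q * η) ≤ 1 / 36 := by
    have : η ≤ 1 / (108 * q) := hη ▸ min_le_left _ _
    calc 3 * (q * η) ≤ 3 * (q * (1 / (108 * q))) := by gcongr
      _ = 1 / 36 := by field_simp; norm_num
  have hη2 : η ≤ c0 / q := hη ▸ min_le_right _ _
  obtain ⟨C1, hC1⟩ : ∃ C1, C1 = Real.log (δ / 2)⁻¹ / (2 * c ^ 2) := ⟨_, rfl⟩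
  have hC1' : 0 ≤ C1 := by
    have : 0 ≤ Real.log (δ / 2)⁻¹ :=
      Real.log_nonneg ((one_le_inv₀ (by positivity)).2 (by linarith))
    rw [hC1]; positivity
  obtain ⟨C2, hC2⟩ : ∃ C2, C2 = 36 * b + 144 * b ^ 2 + 12 * b / c + 9 * (q * β) ^ 2 + 3 := ⟨_, rfl⟩
  have hC2' : 0 ≤ C2 := by rw [hC2]; positivity
  refine ⟨η, hη0, C1 + C2, by positivity, fun n hn Q hs hd hδ0 hδle hR hop => ?_⟩
  have hn' : (0 : ℝ) < n := by exact_mod_cast hn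
  have hdiag := sum_abs_diag_centredCoupling_le hn hd hδle
  have hR1 := centredCoupling_mulVec_one hn hδ0
  have hH := centredCoupling_symm hs
  have hen := energy_eq hn Q
  generalize centredCoupling Q = R at *
  obtain ⟨w, hw⟩ := exists_isEigenbasis hH
  generalize hH.eigenvalues = ev at *
  have hev : ∀ k, ev k ≤ 1 - δ := by
    intro k
    have := hR (w k)
    rw [hw.mulVec_eigenvector, dotProduct_smul, hw.ortho, if_pos rfl] at this
    simpa using this
  have hFr0 : 0 ≤ ∑ i, ∑ j, R i j ^ 2 :=
    Finset.sum_nonneg fun i _ => Finset.sum_nonneg fun j _ => sq_nonneg _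
  have hdl0 : 0 ≤ ∑ i, rowDev Q i ^ 2 := Finset.sum_nonneg fun i _ => sq_nonneg _
  refine sum_le_of_slice_le hn _ fun m hm => ?_
  have hfsum := sum_slice_big_le hβ ht hfix hw hR1 hp0.le hcpos (show 0 < δ / 2 by positivity)
      (by linarith) (fun k => by
        have := mul_le_mul_of_nonneg_left (hev k) hp0.le
        rw [hp] at this ⊢
        nlinarith) m
  rw [← hw.frobenius, ← hC1] at hfsum
  have hgsum := sum_slice_rest_le (β := β) (a := q * β) hm hw hR1 hop hdiag hδ0 hb0.le hcpos hbc
    (show 0 ≤ q * η by positivity) hη1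
  rw [← hC2] at hgsum
  generalize (∑ i, ∑ j, R i j ^ 2) = Fr at *
  generalize (∑ i, rowDev Q i ^ 2) = dl at *
  have hfsum' := hfsum.trans (Real.exp_le_exp.2 (show
    n * (freeEnergy β t - β / 2 * m ^ 2) + C1 * Fr
      ≤ n * (freeEnergy β t - β / 2 * m ^ 2) + C1 * (1 + Fr + dl) by
    have : C1 * Fr ≤ C1 * (1 + Fr + dl) := mul_le_mul_of_nonneg_left (by linarith) hC1'
    linarith))
  have hg : ∀ x : Spins (Fin n), q * (β / 2 * ∑ k ∈ Finset.univ.filter (fun k => |ev k| < c),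
      ev k * (w k ⬝ᵥ spinVec x) ^ 2 + β * m * (rowDev Q ⬝ᵥ spinVec x)
      + η * ((R *ᵥ spinVec x) ⬝ᵥ (R *ᵥ spinVec x)))
      = b * ∑ k ∈ Finset.univ.filter (fun k => |ev k| < c),
      ev k * (w k ⬝ᵥ spinVec x) ^ 2 + q * β * m * (rowDev Q ⬝ᵥ spinVec x)
      + q * η * ((R *ᵥ spinVec x) ⬝ᵥ (R *ᵥ spinVec x)) := by
    intro x; rw [hb]; ring
  simp_rw [← hg] at hgsum
  have hY := sum_exp_add_le (slice n m) _ _ hp0 hq0 hpq hfsum' hgsum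
  have hpt : ∀ x ∈ slice n m, Real.exp (β / 2 * energy Q x + η *
        ((R *ᵥ spinVec x) ⬝ᵥ (R *ᵥ spinVec x) + n * (|meanSpin x| - t) ^ 2))
      ≤ Real.exp (n * (β / 2 * m ^ 2) + η * (n * (|m| - t) ^ 2)) *
        Real.exp (β / 2 * ∑ k ∈ Finset.univ.filter (fun k => c ≤ ev k),
          ev k * (w k ⬝ᵥ spinVec x) ^ 2 +
          (β / 2 * ∑ k ∈ Finset.univ.filter (fun k => |ev k| < c),
      ev k * (w k ⬝ᵥ spinVec x) ^ 2 + β * m * (rowDev Q ⬝ᵥ spinVec x)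
      + η * ((R *ᵥ spinVec x) ⬝ᵥ (R *ᵥ spinVec x)))) := by
    intro x hx
    have hxm : meanSpin x = m := by
      rw [meanSpin, (Finset.mem_filter.1 hx).2, mul_div_cancel_left₀ _ hn'.ne']
    rw [← Real.exp_add]
    refine Real.exp_le_exp.2 ?_
    rw [hen, hxm]
    have := mul_le_mul_of_nonneg_left (hw.quad_le_big_add_small c (spinVec x))
      (show 0 ≤ β / 2 by positivity)
    linarith
  refine (Finset.sum_le_sum hpt).trans ?_
  rw [← Finset.mul_sum]
  refine (mul_le_mul_of_nonneg_left hY (Real.exp_pos _).le).trans ?_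
  rw [← Real.exp_add]
  refine Real.exp_le_exp.2 ?_
  have hD : 0 ≤ 1 + Fr + dl := by linarith
  exact young_exponent_le hn'.le (sq_nonneg _) hp1 hq1 hpq hη2 (hfree m hm)
    (mul_nonneg hC1' hD) (mul_nonneg hC2' hD)

/-! ### The variational lower bound -/

theorem sum_fieldWeight (h : ℝ) :
    ∑ x : Spins (Fin n), fieldWeight h x = (2 * Real.cosh h) ^ n := by
  have := sum_exp_field (fun _ : Fin n => h)
  rw [Finset.prod_const, Finset.card_univ, Fintype.card_fin] at this
  rw [← this]
  exact Finset.sum_congr rfl fun x _ => by rw [fieldWeight, Finset.mul_sum]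

theorem fieldWeight_flip_mul_add (h : ℝ) (j : Fin n) (x : Spins (Fin n)) :
    fieldWeight h x * centred (Real.tanh h) x j
      + fieldWeight h (flip j x) * centred (Real.tanh h) (flip j x) j = 0 := by
  have hsum : ∑ i, spin (flip j x i) = ∑ i, spin (x i) - 2 * spin (x j) := by
    have : ∑ i, (spin (flip j x i) - spin (x i)) = -2 * spin (x j) := by
      simp_rw [spin_flip_sub]
      simp
    rw [Finset.sum_sub_distrib] at this
    linarith
  have hc := (Real.cosh_pos h).ne'
  have w2 : fieldWeight h (flip j x) = fieldWeight h x * Real.exp (-(2 * h * spin (x j))) := by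
    rw [fieldWeight, fieldWeight, ← Real.exp_add, hsum]; congr 1; ring
  rw [w2, centred, centred, flip_same, spin_neg, Real.tanh_eq_sinh_div_cosh, Real.sinh_eq,
    Real.cosh_eq]
  have hpos : 0 < Real.exp h + Real.exp (-h) := by positivity
  have e0 : Real.exp h * Real.exp (-h) = 1 := by rw [← Real.exp_add]; simp
  have e1 : Real.exp (-(2 * h)) = Real.exp (-h) * Real.exp (-h) := by
    rw [← Real.exp_add]; congr 1; ring
  have e2 : Real.exp (2 * h) = Real.exp h * Real.exp h := by
    rw [← Real.exp_add]; congr 1; ring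
  rcases Int.units_eq_one_or (x j) with hx | hx
  · rw [hx, spin_one, mul_one, e1]
    field_simp
    linear_combination (-2 * fieldWeight h x * Real.exp (-h)) * e0
  · rw [hx, spin_neg_one, mul_neg, mul_one, neg_neg, e2]
    field_simp
    linear_combination (2 * fieldWeight h x * Real.exp h) * e0

/-- Gibbs' variational principle for the product law of mean t. Relative to it the weight is exp G
up to a constant, and G has mean zero because centred spins are independent and Q has zero diagonal;
then exp G ≥ 1 + G. -/
theorem exp_freeEnergy_le_isingZ {β t : ℝ} (hfix : t = Real.tanh (β * t))
    {Q : Matrix (Fin n) (Fin n) ℝ} (hs : ∀ i j, Q i j = Q j i) (hd : ∀ i, Q i i = 0)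
    (hδ : ∑ i, rowDev Q i = 0) :
    Real.exp (n * freeEnergy β t) ≤ isingZ β Q 0 := by
  set y : Spins (Fin n) → Fin n → ℝ := centred t with hy
  set G : Spins (Fin n) → ℝ := fun x =>
    β / 2 * (∑ i, ∑ j, Q i j * y x i * y x j + 2 * t * ∑ i, rowDev Q i * y x i) with hG
  have hrow : ∀ i, ∑ j, Q i j = 1 + rowDev Q i := fun i => by rw [rowDev]; ring
  have hen : ∀ x, energy Q x = ∑ i, ∑ j, Q i j * y x i * y x j
      + 2 * t * ∑ i, rowDev Q i * y x i + 2 * t * ∑ i, spin (x i) - n * t ^ 2 := by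
    intro x
    have e1 : ∀ i j, Q i j * spin (x i) * spin (x j)
        = Q i j * y x i * y x j + t * (Q i j * y x i) + t * (Q j i * y x j) + t ^ 2 * Q i j := by
      intro i j
      simp only [hy, centred]
      rw [hs j i]; ring
    have e2 : ∑ i, ∑ j, Q i j * y x i = ∑ i, y x i + ∑ i, rowDev Q i * y x i := by
      rw [← Finset.sum_add_distrib]
      refine Finset.sum_congr rfl fun i _ => ?_
      rw [← Finset.sum_mul, hrow]; ring
    have e3 : ∑ i, ∑ j, Q j i * y x j = ∑ i, y x i + ∑ i, rowDev Q i * y x i := by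
      rw [Finset.sum_comm, e2]
    have e4 : ∑ i, ∑ j, Q i j = n := by
      simp_rw [hrow]
      rw [Finset.sum_add_distrib, hδ]; simp
    have e5 : ∑ i, y x i = ∑ i, spin (x i) - n * t := by
      simp only [hy, centred]
      rw [Finset.sum_sub_distrib]; simp
    unfold energy
    simp_rw [e1, Finset.sum_add_distrib, ← Finset.mul_sum]
    rw [e2, e3, e4, e5]; ring
  have hfw : ∀ x, isingWeight β Q 0 x
      = fieldWeight (β * t) x * Real.exp (G x) * Real.exp (-(n * (β / 2 * t ^ 2))) := by
    intro x
    rw [isingWeight_zero, fieldWeight, ← Real.exp_add, ← Real.exp_add, hen, hG]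
    congr 1; ring
  have hzero : ∑ x, fieldWeight (β * t) x * G x = 0 := by
    have z1 : ∀ i, ∑ x, fieldWeight (β * t) x * y x i = 0 := fun i =>
      sum_eq_zero_of_flip i fun x => by
        have := fieldWeight_flip_mul_add (β * t) i x
        rwa [← hfix] at this
    have z2 : ∀ i j, i ≠ j → ∑ x, fieldWeight (β * t) x * (y x i * y x j) = 0 := fun i j hij =>
      sum_eq_zero_of_flip i fun x => by
        have := fieldWeight_flip_mul_add (β * t) i x
        rw [← hfix] at this
        have e : y (flip i x) j = y x j := by
          simp only [hy, centred, flip_of_ne hij.symm]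
        rw [e]
        linear_combination (y x j) * this
    have e : ∀ x, fieldWeight (β * t) x * G x
        = β / 2 * (∑ i, ∑ j, Q i j * (fieldWeight (β * t) x * (y x i * y x j))
          + 2 * t * ∑ i, rowDev Q i * (fieldWeight (β * t) x * y x i)) := by
      intro x
      simp only [hG]
      have a1 : fieldWeight (β * t) x * ∑ i, ∑ j, Q i j * y x i * y x j
          = ∑ i, ∑ j, Q i j * (fieldWeight (β * t) x * (y x i * y x j)) := by
        rw [Finset.mul_sum]
        refine Finset.sum_congr rfl fun i _ => ?_
        rw [Finset.mul_sum]
        exact Finset.sum_congr rfl fun j _ => by ring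
      have a2 : fieldWeight (β * t) x * ∑ i, rowDev Q i * y x i
          = ∑ i, rowDev Q i * (fieldWeight (β * t) x * y x i) := by
        rw [Finset.mul_sum]
        exact Finset.sum_congr rfl fun j _ => by ring
      rw [← a1, ← a2]; ring
    simp_rw [e]
    rw [← Finset.mul_sum, Finset.sum_add_distrib, ← Finset.mul_sum, Finset.sum_comm]
    have a1 : ∑ i, ∑ x : Spins (Fin n), ∑ j, Q i j * (fieldWeight (β * t) x * (y x i * y x j))
        = 0 := by
      refine Finset.sum_eq_zero fun i _ => ?_
      rw [Finset.sum_comm]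
      refine Finset.sum_eq_zero fun j _ => ?_
      rw [← Finset.mul_sum]
      rcases eq_or_ne i j with rfl | hij
      · rw [hd, zero_mul]
      · rw [z2 i j hij, mul_zero]
    have a2 : ∑ x : Spins (Fin n), ∑ i, rowDev Q i * (fieldWeight (β * t) x * y x i) = 0 := by
      rw [Finset.sum_comm]
      refine Finset.sum_eq_zero fun i _ => ?_
      rw [← Finset.mul_sum, z1, mul_zero]
    rw [a1, a2]; ring
  rw [isingZ]
  simp_rw [hfw]
  rw [← Finset.sum_mul]
  have hlow : (2 * Real.cosh (β * t)) ^ n ≤ ∑ x, fieldWeight (β * t) x * Real.exp (G x) := by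
    calc (2 * Real.cosh (β * t)) ^ n
        = ∑ x, (fieldWeight (β * t) x * G x + fieldWeight (β * t) x) := by
          rw [Finset.sum_add_distrib, hzero, zero_add, sum_fieldWeight]
      _ ≤ _ := by
          refine Finset.sum_le_sum fun x _ => ?_
          have := mul_le_mul_of_nonneg_left (Real.add_one_le_exp (G x))
            (fieldWeight_pos (β * t) x).le
          linarith
  refine le_trans (le_of_eq ?_) (mul_le_mul_of_nonneg_right hlow (Real.exp_pos _).le)
  rw [exp_freeEnergy, ← Real.exp_add]
  congr 1; ring

end Ising

namespace Ising

open Matrix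

variable {n : ℕ}

/-! ### Spectral bounds for the centred coupling -/

theorem dotProduct_self_nonneg_real (v : Fin n → ℝ) : 0 ≤ v ⬝ᵥ v :=
  Finset.sum_nonneg fun _ _ => mul_self_nonneg _

/-- Schur's test: Cauchy-Schwarz in each row with weights Q i j, then symmetry. -/
theorem IsFerromagnetic.mulVec_dot_self_le {Q : Matrix (Fin n) (Fin n) ℝ} {q : ℝ}
    (hQ : IsFerromagnetic Q q) (v : Fin n → ℝ) : (Q *ᵥ v) ⬝ᵥ (Q *ᵥ v) ≤ 4 * (v ⬝ᵥ v) := by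
  have h1 : ∀ i, (Q *ᵥ v) i * (Q *ᵥ v) i ≤ 2 * ∑ j, Q i j * (v j * v j) := by
    intro i
    have hcs := Finset.sum_sq_le_sum_mul_sum_of_sq_le_mul Finset.univ
      (r := fun j => Q i j * v j) (f := fun j => Q i j) (g := fun j => Q i j * (v j * v j))
      (fun j _ => hQ.nonneg i j) (fun j _ => mul_nonneg (hQ.nonneg i j) (mul_self_nonneg _))
      (fun j _ => le_of_eq (by ring))
    have h0 : 0 ≤ ∑ j, Q i j * (v j * v j) :=
      Finset.sum_nonneg fun j _ => mul_nonneg (hQ.nonneg i j) (mul_self_nonneg _)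
    have h2 := mul_le_mul_of_nonneg_right (hQ.row i) h0
    rw [← sq]
    exact hcs.trans h2
  calc (Q *ᵥ v) ⬝ᵥ (Q *ᵥ v) ≤ ∑ i, 2 * ∑ j, Q i j * (v j * v j) :=
        Finset.sum_le_sum fun i _ => h1 i
    _ = 2 * ∑ j, (∑ i, Q j i) * (v j * v j) := by
        rw [← Finset.mul_sum, Finset.sum_comm]
        congr 1
        refine Finset.sum_congr rfl fun j _ => ?_
        rw [← Finset.sum_mul]
        congr 1
        exact Finset.sum_congr rfl fun i _ => hQ.symm i j
    _ ≤ 2 * ∑ j, 2 * (v j * v j) := by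
        refine mul_le_mul_of_nonneg_left (Finset.sum_le_sum fun j _ => ?_) zero_le_two
        exact mul_le_mul_of_nonneg_right (hQ.row j) (mul_self_nonneg _)
    _ = 4 * (v ⬝ᵥ v) := by rw [← Finset.mul_sum, dotProduct]; ring

/-- The squared Frobenius norm is O(1 + n/d̄) for q = 1/d̄; this is what the exponential moment
pays. -/
theorem IsFerromagnetic.sum_sq_centredCoupling_le (hn : 0 < n) {Q : Matrix (Fin n) (Fin n) ℝ}
    {q : ℝ} (hQ : IsFerromagnetic Q q) (hδ : ∑ i, rowDev Q i = 0) (hδ1 : ∀ i, |rowDev Q i| ≤ 1) :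
    ∑ i, ∑ j, centredCoupling Q i j ^ 2 ≤ 2 * (n * q) + 18 := by
  have hn' : (0 : ℝ) < n := by exact_mod_cast hn
  have h1 : ∀ i j, centredCoupling Q i j ^ 2 ≤ 2 * q * Q i j + 18 / (n : ℝ) ^ 2 := by
    intro i j
    have h2 : Q i j ^ 2 ≤ q * Q i j := by
      rw [sq]; exact mul_le_mul_of_nonneg_right (hQ.le i j) (hQ.nonneg i j)
    have h3 : ((1 + rowDev Q i + rowDev Q j) / (n : ℝ)) ^ 2 ≤ 9 / (n : ℝ) ^ 2 := by
      rw [div_pow]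
      refine div_le_div_of_nonneg_right ?_ (by positivity)
      have a1 := abs_le.1 (hδ1 i)
      have a2 := abs_le.1 (hδ1 j)
      nlinarith
    have h4 : (18 : ℝ) / (n : ℝ) ^ 2 = 2 * (9 / (n : ℝ) ^ 2) := by ring
    rw [centredCoupling, of_apply, h4]
    nlinarith [sq_nonneg (Q i j + (1 + rowDev Q i + rowDev Q j) / (n : ℝ))]
  have h5 : ∑ i, ∑ j, Q i j = n := by
    have : ∀ i, ∑ j, Q i j = rowDev Q i + 1 := fun i => by rw [rowDev]; ring
    simp_rw [this]
    rw [Finset.sum_add_distrib, hδ]; simp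
  calc _ ≤ ∑ i, ∑ j, (2 * q * Q i j + 18 / (n : ℝ) ^ 2) :=
        Finset.sum_le_sum fun i _ => Finset.sum_le_sum fun j _ => h1 i j
    _ = _ := by
        simp_rw [Finset.sum_add_distrib, ← Finset.mul_sum]
        rw [h5]
        simp only [Finset.sum_const, Finset.card_univ, Fintype.card_fin, nsmul_eq_mul]
        field_simp

/-- The centred coupling acts as the compression of `Q` to mean-zero vectors. -/
theorem exists_meanZero_compression (hn : 0 < n) {Q : Matrix (Fin n) (Fin n) ℝ}
    (hs : ∀ i j, Q i j = Q j i) (hδ : ∑ i, rowDev Q i = 0) (v : Fin n → ℝ) :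
    ∃ z : Fin n → ℝ, ∑ i, z i = 0 ∧ z ⬝ᵥ z ≤ v ⬝ᵥ v ∧
      v ⬝ᵥ (centredCoupling Q *ᵥ v) = z ⬝ᵥ (Q *ᵥ z) ∧
      (centredCoupling Q *ᵥ v) ⬝ᵥ (centredCoupling Q *ᵥ v) ≤ (Q *ᵥ z) ⬝ᵥ (Q *ᵥ z) := by
  have hn' : (n : ℝ) ≠ 0 := by exact_mod_cast hn.ne'
  have hn0 : (0 : ℝ) < n := by exact_mod_cast hn
  obtain ⟨a, ha⟩ : ∃ a, a = (∑ i, v i) / n := ⟨_, rfl⟩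
  have hav : ∑ i, v i = n * a := by rw [ha]; field_simp
  -- z is the mean-zero projection of v, and R v is the mean-zero projection of Q z.
  obtain ⟨z, hz⟩ : ∃ z : Fin n → ℝ, z = v - a • (fun _ => 1) := ⟨_, rfl⟩
  have hzi : ∀ i, z i = v i - a := fun i => by simp [hz]
  have hz0 : ∑ i, z i = 0 := by
    simp_rw [hzi]
    rw [Finset.sum_sub_distrib, hav]; simp
  have hRv : centredCoupling Q *ᵥ v = centredCoupling Q *ᵥ z := by
    rw [hz, mulVec_sub, mulVec_smul, centredCoupling_mulVec_one hn hδ, smul_zero, sub_zero]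
  obtain ⟨b, hb⟩ : ∃ b, b = (∑ j, rowDev Q j * z j) / n := ⟨_, rfl⟩
  have hRz : ∀ i, (centredCoupling Q *ᵥ z) i = (Q *ᵥ z) i - b := by
    intro i
    rw [sum_mulVec_centred, hz0, hb]
    simp [mulVec, dotProduct]
  have hQz : ∑ i, (Q *ᵥ z) i = n * b := by
    have : ∑ i, (Q *ᵥ z) i = ∑ j, (1 + rowDev Q j) * z j := by
      simp only [mulVec, dotProduct]
      rw [Finset.sum_comm]
      refine Finset.sum_congr rfl fun j _ => ?_
      rw [← Finset.sum_mul, rowDev]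
      congr 1
      rw [add_sub_cancel]
      exact Finset.sum_congr rfl fun i _ => hs i j
    rw [this, hb]
    simp_rw [add_mul, one_mul]
    rw [Finset.sum_add_distrib, hz0, zero_add]
    field_simp
  refine ⟨z, hz0, ?_, ?_, ?_⟩
  · have e : v ⬝ᵥ v = z ⬝ᵥ z + n * a ^ 2 := by
      have : ∀ i, v i * v i = z i * z i + 2 * a * z i + a ^ 2 := fun i => by rw [hzi]; ring
      simp only [dotProduct]
      simp_rw [this]
      rw [Finset.sum_add_distrib, Finset.sum_add_distrib, ← Finset.mul_sum, hz0]; simp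
    rw [e]
    have : 0 ≤ n * a ^ 2 := by positivity
    linarith
  · rw [hRv]
    have : ∀ i, v i * (centredCoupling Q *ᵥ z) i
        = z i * (Q *ᵥ z) i + a * (Q *ᵥ z) i - b * z i - a * b := fun i => by
      rw [hRz, hzi]; ring
    rw [dotProduct, dotProduct]
    simp_rw [this]
    rw [Finset.sum_sub_distrib, Finset.sum_sub_distrib, Finset.sum_add_distrib, ← Finset.mul_sum,
      ← Finset.mul_sum, hQz, hz0]
    simp
    ring
  · rw [hRv]
    have e : (Q *ᵥ z) ⬝ᵥ (Q *ᵥ z)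
        = (centredCoupling Q *ᵥ z) ⬝ᵥ (centredCoupling Q *ᵥ z) + n * b ^ 2 := by
      have : ∀ i, (centredCoupling Q *ᵥ z) i * (centredCoupling Q *ᵥ z) i
          = (Q *ᵥ z) i * (Q *ᵥ z) i - 2 * b * (Q *ᵥ z) i + b ^ 2 := fun i => by rw [hRz]; ring
      simp only [dotProduct]
      simp_rw [this]
      rw [Finset.sum_add_distrib, Finset.sum_sub_distrib, ← Finset.mul_sum, hQz]
      simp
      ring
    rw [e]
    have : 0 ≤ n * b ^ 2 := by positivity
    linarith

/-- If the constant vector is nearly invariant and all eigenvalues but one are at most `L < 1`,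
then mean-zero vectors are nearly orthogonal to the top eigenvector. -/
theorem IsEigenbasis.sq_dot_top_le (hn : 0 < n) {Q : Matrix (Fin n) (Fin n) ℝ} {ev : Fin n → ℝ}
    {w : Fin n → Fin n → ℝ} (h : IsEigenbasis Q ev w) {i₀ : Fin n} {L ε : ℝ} (hL : L < 1)
    (hε : ε ≤ 1 / 2) (hev : ∀ k, k ≠ i₀ → ev k ≤ L)
    (hδ : ∑ i, rowDev Q i ^ 2 ≤ ε * (1 - L) ^ 2 * n) {z : Fin n → ℝ} (hz : ∑ i, z i = 0) :
    (w i₀ ⬝ᵥ z) ^ 2 ≤ 2 * ε * (z ⬝ᵥ z) := by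
  have hn0 : (0 : ℝ) < n := by exact_mod_cast hn
  obtain ⟨u, hu⟩ : ∃ u : Fin n → ℝ, u = fun _ => 1 := ⟨_, rfl⟩
  have huu : u ⬝ᵥ u = n := by simp [hu, dotProduct]
  have huz : u ⬝ᵥ z = 0 := by simp [hu, dotProduct, hz]
  -- The row deviations form the vector (Q - 1)u, whose components away from i₀ are at least 1 - L
  -- times those of u in size. Hence u lies mostly along the top eigenvector, and a vector
  -- orthogonal to u has little component there.
  have hdev : ∑ i, rowDev Q i ^ 2 = ∑ k, (ev k - 1) ^ 2 * (w k ⬝ᵥ u) ^ 2 := by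
    have e1 : ∑ i, rowDev Q i ^ 2 = (Q *ᵥ u - u) ⬝ᵥ (Q *ᵥ u - u) := by
      rw [dotProduct]
      refine Finset.sum_congr rfl fun i _ => ?_
      simp only [Pi.sub_apply, mulVec, dotProduct, hu, mul_one, rowDev]
      ring
    rw [e1, h.dot_self]
    refine Finset.sum_congr rfl fun k _ => ?_
    rw [dotProduct_sub, h.dot_mulVec]; ring
  rw [hdev] at hδ
  have hrest : ∑ k ∈ Finset.univ.erase i₀, (w k ⬝ᵥ u) ^ 2 ≤ ε * n := by
    have h1 : (1 - L) ^ 2 * ∑ k ∈ Finset.univ.erase i₀, (w k ⬝ᵥ u) ^ 2 ≤ (1 - L) ^ 2 * (ε * n) := by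
      calc _ ≤ ∑ k ∈ Finset.univ.erase i₀, (ev k - 1) ^ 2 * (w k ⬝ᵥ u) ^ 2 := by
            rw [Finset.mul_sum]
            refine Finset.sum_le_sum fun k hk => mul_le_mul_of_nonneg_right ?_ (sq_nonneg _)
            have := hev k (Finset.ne_of_mem_erase hk)
            nlinarith
        _ ≤ ∑ k, (ev k - 1) ^ 2 * (w k ⬝ᵥ u) ^ 2 :=
            Finset.sum_le_sum_of_subset_of_nonneg (Finset.subset_univ _) fun k _ _ => by positivity
        _ ≤ _ := by linarith
    have : 0 < 1 - L := by linarith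
    exact le_of_mul_le_mul_left h1 (by positivity)
  have htop : (n : ℝ) / 2 ≤ (w i₀ ⬝ᵥ u) ^ 2 := by
    have e := h.dot_self u
    rw [huu, ← Finset.add_sum_erase _ _ (Finset.mem_univ i₀)] at e
    have : ε * n ≤ 1 / 2 * n := mul_le_mul_of_nonneg_right hε hn0.le
    linarith
  have hcs : ((w i₀ ⬝ᵥ u) * (w i₀ ⬝ᵥ z)) ^ 2 ≤ ε * n * (z ⬝ᵥ z) := by
    have e := h.dot_eq u z
    rw [huz, ← Finset.add_sum_erase _ _ (Finset.mem_univ i₀)] at e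
    have e2 : (w i₀ ⬝ᵥ u) * (w i₀ ⬝ᵥ z)
        = -∑ k ∈ Finset.univ.erase i₀, (w k ⬝ᵥ u) * (w k ⬝ᵥ z) := by linarith
    rw [e2, neg_sq]
    refine (Finset.sum_mul_sq_le_sq_mul_sq _ _ _).trans ?_
    refine mul_le_mul hrest ?_ (Finset.sum_nonneg fun _ _ => sq_nonneg _)
      ((Finset.sum_nonneg fun _ _ => sq_nonneg _).trans hrest)
    rw [h.dot_self z]
    exact Finset.sum_le_sum_of_subset_of_nonneg (Finset.subset_univ _) fun k _ _ => sq_nonneg _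
  rw [mul_pow] at hcs
  have h3 := mul_le_mul_of_nonneg_right htop (sq_nonneg (w i₀ ⬝ᵥ z))
  have h4 : (n : ℝ) / 2 * (w i₀ ⬝ᵥ z) ^ 2 ≤ n / 2 * (2 * ε * (z ⬝ᵥ z)) := by
    refine h3.trans (hcs.trans (le_of_eq ?_)); ring
  exact le_of_mul_le_mul_left h4 (by positivity)

theorem IsFerromagnetic.sq_eigenvalue_le {Q : Matrix (Fin n) (Fin n) ℝ} {q : ℝ}
    (hQ : IsFerromagnetic Q q) {ev : Fin n → ℝ} {w : Fin n → Fin n → ℝ} (h : IsEigenbasis Q ev w)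
    (k : Fin n) : ev k ^ 2 ≤ 4 := by
  have := hQ.mulVec_dot_self_le (w k)
  rw [h.mulVec_eigenvector, dotProduct_smul, smul_dotProduct, h.ortho, if_pos rfl] at this
  simp only [smul_eq_mul, mul_one] at this
  rw [sq]; exact this

/-- On mean-zero vectors the top eigenvalue, at most 2, meets a squared component of at most 2ε|z|²,
hence the loss 4ε. -/
theorem centredCoupling_quad_le (hn : 0 < n) {Q : Matrix (Fin n) (Fin n) ℝ} {q : ℝ}
    (hQ : IsFerromagnetic Q q) (hδ0 : ∑ i, rowDev Q i = 0) {ev : Fin n → ℝ}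
    {w : Fin n → Fin n → ℝ} (h : IsEigenbasis Q ev w) {i₀ : Fin n} {L ε : ℝ} (hL0 : 0 ≤ L)
    (hL : L < 1) (hε0 : 0 ≤ ε) (hε : ε ≤ 1 / 2) (hev : ∀ k, k ≠ i₀ → ev k ≤ L)
    (hδ : ∑ i, rowDev Q i ^ 2 ≤ ε * (1 - L) ^ 2 * n) (v : Fin n → ℝ) :
    v ⬝ᵥ (centredCoupling Q *ᵥ v) ≤ (L + 4 * ε) * (v ⬝ᵥ v) := by
  obtain ⟨z, hz0, hzv, h1, -⟩ := exists_meanZero_compression hn hQ.symm hδ0 v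
  have htop := h.sq_dot_top_le hn hL hε hev hδ hz0
  rw [h1, h.quad]
  refine le_trans ?_ (mul_le_mul_of_nonneg_left hzv (by positivity))
  rw [← Finset.add_sum_erase _ _ (Finset.mem_univ i₀)]
  have hev0 : ev i₀ ≤ 2 := by have := hQ.sq_eigenvalue_le h i₀; nlinarith
  have h2 : ev i₀ * (w i₀ ⬝ᵥ z) ^ 2 ≤ 2 * (w i₀ ⬝ᵥ z) ^ 2 :=
    mul_le_mul_of_nonneg_right hev0 (sq_nonneg _)
  have h3 : ∑ k ∈ Finset.univ.erase i₀, ev k * (w k ⬝ᵥ z) ^ 2 ≤ L * (z ⬝ᵥ z) := by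
    rw [h.dot_self z, Finset.mul_sum]
    refine (Finset.sum_le_sum fun k hk => mul_le_mul_of_nonneg_right
      (hev k (Finset.ne_of_mem_erase hk)) (sq_nonneg _)).trans ?_
    exact Finset.sum_le_sum_of_subset_of_nonneg (Finset.subset_univ _) fun k _ _ => by positivity
  linarith

theorem centredCoupling_norm_le_nine (hn : 0 < n) {Q : Matrix (Fin n) (Fin n) ℝ} {q : ℝ}
    (hQ : IsFerromagnetic Q q) (hδ0 : ∑ i, rowDev Q i = 0) (v : Fin n → ℝ) :
    (centredCoupling Q *ᵥ v) ⬝ᵥ (centredCoupling Q *ᵥ v) ≤ 9 * (v ⬝ᵥ v) := by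
  obtain ⟨z, -, hzv, -, h1⟩ := exists_meanZero_compression hn hQ.symm hδ0 v
  have := hQ.mulVec_dot_self_le z
  have := dotProduct_self_nonneg_real v
  linarith

/-! ### Row sums and eigenvalues of graph couplings -/

theorem rowDev_coupling (G : SimpleGraph (Fin n)) (i : Fin n) :
    rowDev (coupling G) i = vertexDegree G i / avgDegree G - 1 := by
  rw [rowDev, sum_coupling]

theorem abs_rowDev_coupling_le (G : SimpleGraph (Fin n)) (i : Fin n) :
    |rowDev (coupling G) i| ≤ degreeDeviation G :=
  abs_sum_coupling_sub_one_le G i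

theorem sum_rowDev_coupling {G : SimpleGraph (Fin n)} (hd : 0 < avgDegree G) :
    ∑ i, rowDev (coupling G) i = 0 := by
  have hn : (n : ℝ) ≠ 0 := by
    rintro h
    rw [avgDegree, h, div_zero] at hd
    exact hd.false
  have e : ∑ i, vertexDegree G i = n * avgDegree G := by
    rw [avgDegree]; field_simp
  simp_rw [rowDev_coupling]
  rw [Finset.sum_sub_distrib, ← Finset.sum_div, e, mul_div_assoc, div_self hd.ne']
  simp

theorem sum_sq_rowDev_coupling_le (G : SimpleGraph (Fin n)) :
    ∑ i, rowDev (coupling G) i ^ 2 ≤ n * degreeDeviation G ^ 2 := by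
  calc ∑ i, rowDev (coupling G) i ^ 2 ≤ ∑ _i : Fin n, degreeDeviation G ^ 2 := by
        refine Finset.sum_le_sum fun i _ => ?_
        rw [← sq_abs]
        exact pow_le_pow_left₀ (abs_nonneg _) (abs_rowDev_coupling_le G i) 2
    _ = _ := by simp

/-- `eigenvalues` is a relabelling of the sorted list `eigenvalues₀`; i₀ is the label of position 0,
and position a is the (a + 1)-th largest. -/
theorem exists_eigenvalue_eq_couplingEigenvalue (hn : 0 < n) (G : SimpleGraph (Fin n)) :
    ∃ i₀, ∀ k, k ≠ i₀ → ∃ j ∈ Set.Icc 2 n,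
      (coupling_isHermitian G).eigenvalues k = couplingEigenvalue G j := by
  obtain ⟨e, he⟩ : ∃ e : Fin (Fintype.card (Fin n)) ≃ Fin n,
      ∀ k, (coupling_isHermitian G).eigenvalues k
        = (coupling_isHermitian G).eigenvalues₀ (e.symm k) := ⟨_, fun k => rfl⟩
  refine ⟨e ⟨0, by simpa using hn⟩, fun k hk => ?_⟩
  obtain ⟨a, ha⟩ := e.surjective k
  subst ha
  have h0 : a.1 ≠ 0 := fun h => hk (by congr 1; ext; exact h)
  have h1 := a.2
  have h2 : a.1 < n := by simpa using h1
  refine ⟨a.1 + 1, ⟨by omega, by omega⟩, ?_⟩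
  rw [he, couplingEigenvalue, dif_pos ⟨by omega, by omega⟩, Equiv.symm_apply_apply]
  rfl

theorem couplingEigenvalue_le_second (G : SimpleGraph (Fin n)) {j : ℕ} (hj : j ∈ Set.Icc 2 n) :
    couplingEigenvalue G j ≤ couplingEigenvalue G 2 := by
  obtain ⟨h1, h2⟩ := hj
  have hc : Fintype.card (Fin n) = n := Fintype.card_fin n
  rw [couplingEigenvalue, couplingEigenvalue, dif_pos ⟨by omega, by omega⟩,
    dif_pos ⟨by omega, by omega⟩]
  refine (coupling_isHermitian G).eigenvalues₀_antitone ?_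
  rw [Fin.le_def]
  simp only
  omega

end Ising

namespace Ising

open Matrix

variable {n : ℕ}

/-! ### Deterministic control of the local fields at low temperature -/

/-- The fluctuation functional `|R x|² + n (|x̄| - t)²`. -/
noncomputable def fluctuation (t : ℝ) (Q : Matrix (Fin n) (Fin n) ℝ) (x : Spins (Fin n)) : ℝ :=
  (centredCoupling Q *ᵥ spinVec x) ⬝ᵥ (centredCoupling Q *ᵥ spinVec x)
    + n * (|meanSpin x| - t) ^ 2

/-- The mean-field equation at i expanded around t, with e accounting for the row sum not being
exactly 1. -/
theorem abs_localField_sub_le {β t e q r : ℝ} {Q : Matrix (Fin n) (Fin n) ℝ}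
    (hQ : IsFerromagnetic Q q) (ht : |t| ≤ 1) (he : ∀ i, |rowDev Q i| ≤ e)
    {x : Spins (Fin n)} (hx : x ∈ nearMeanField β Q r) (i : Fin n) :
    |localField Q x i - t| ≤ r + e
      + ∑ j, Q i j * |Real.tanh (β * localField Q x j) - t| := by
  have h1 : localField Q x i - t
      = (localField Q x i - ∑ j, Q i j * Real.tanh (β * localField Q x j)) + t * rowDev Q i
        + ∑ j, Q i j * (Real.tanh (β * localField Q x j) - t) := by
    simp_rw [mul_sub]
    rw [Finset.sum_sub_distrib, ← Finset.sum_mul, rowDev]; ring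
  have h2 : |∑ j, Q i j * (Real.tanh (β * localField Q x j) - t)|
      ≤ ∑ j, Q i j * |Real.tanh (β * localField Q x j) - t| := by
    refine (Finset.abs_sum_le_sum_abs _ _).trans (le_of_eq ?_)
    exact Finset.sum_congr rfl fun j _ => by rw [abs_mul, abs_of_nonneg (hQ.nonneg i j)]
  have h3 : |t * rowDev Q i| ≤ e := by
    rw [abs_mul]
    exact (mul_le_of_le_one_left (abs_nonneg _) ht).trans (he i)
  rw [h1]
  refine (abs_add_three _ _ _).trans ?_
  have := (hx i).le
  linarith

/-- At the vertex of largest deviation M ≤ r + e + (1 + e)κM. Closeness within the basin η therefore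
improves itself to the order of the errors. -/
theorem abs_localField_sub_le_of_contraction {β t κ η e q r : ℝ}
    {Q : Matrix (Fin n) (Fin n) ℝ} (hQ : IsFerromagnetic Q q) (ht : |t| ≤ 1) (hκ : 0 ≤ κ)
    (hκ1 : κ < 1) (hcon : ∀ m, |m - t| ≤ η → |Real.tanh (β * m) - t| ≤ κ * |m - t|)
    (he : ∀ i, |rowDev Q i| ≤ e) (he1 : e ≤ (1 - κ) / 2)
    {x : Spins (Fin n)} (hx : x ∈ nearMeanField β Q r)
    (hη : ∀ i, |localField Q x i - t| ≤ η) (i : Fin n) :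
    |localField Q x i - t| ≤ 2 * (r + e) / (1 - κ) := by
  have : Nonempty (Fin n) := ⟨i⟩
  obtain ⟨k, hk⟩ := Finite.exists_max fun i => |localField Q x i - t|
  refine (hk i).trans ?_
  have h1 := abs_localField_sub_le hQ ht he hx k
  obtain ⟨M, hM⟩ : ∃ M, M = |localField Q x k - t| := ⟨_, rfl⟩
  have hM0 : 0 ≤ M := hM ▸ abs_nonneg _
  have h2 : ∑ j, Q k j * |Real.tanh (β * localField Q x j) - t| ≤ (1 + e) * (κ * M) := by
    calc _ ≤ ∑ j, Q k j * (κ * M) := by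
          refine Finset.sum_le_sum fun j _ => mul_le_mul_of_nonneg_left ?_ (hQ.nonneg k j)
          refine (hcon _ (hη j)).trans (mul_le_mul_of_nonneg_left ?_ hκ)
          rw [hM]; exact hk j
      _ = (1 + rowDev Q k) * (κ * M) := by rw [← Finset.sum_mul, rowDev]; ring
      _ ≤ _ := by
          have := (abs_le.1 (he k)).2
          gcongr
  rw [← hM] at h1 ⊢
  have hκ0 : 0 < 1 - κ := by linarith
  have h3 : e * (κ * M) ≤ (1 - κ) / 2 * M := by
    have : κ * M ≤ M := mul_le_of_le_one_left hM0 hκ1.le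
    have he0 : 0 ≤ e := (abs_nonneg _).trans (he k)
    calc e * (κ * M) ≤ e * M := by gcongr
      _ ≤ _ := by gcongr
  rw [le_div_iff₀ hκ0]
  linarith

/-- m_i - t is the sum of (Rx)_i, x̄ - t and two terms of size e, hence the factor 4. A nonnegative
mean selects t rather than -t. -/
theorem sum_sq_localField_sub_le (hn : 0 < n) {t e : ℝ} {Q : Matrix (Fin n) (Fin n) ℝ}
    (he : ∀ i, |rowDev Q i| ≤ e) {x : Spins (Fin n)} (hx : 0 ≤ meanSpin x) :
    ∑ i, (localField Q x i - t) ^ 2 ≤ 4 * (fluctuation t Q x + 2 * (n * e ^ 2)) := by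
  have hn0 : (0 : ℝ) < n := by exact_mod_cast hn
  have he2 : ∀ i, rowDev Q i ^ 2 ≤ e ^ 2 := fun i => by
    rw [← sq_abs]; exact pow_le_pow_left₀ (abs_nonneg _) (he i) 2
  have hm1 : meanSpin x ^ 2 ≤ 1 := by
    rw [← sq_abs]; exact pow_le_one₀ (abs_nonneg _) (abs_meanSpin_le x)
  obtain ⟨b, hb⟩ : ∃ b, b = (∑ j, rowDev Q j * spinVec x j) / n := ⟨_, rfl⟩
  have hb2 : b ^ 2 ≤ e ^ 2 := by
    have h1 : |b| ≤ e := by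
      rw [hb, abs_div, abs_of_pos hn0, div_le_iff₀ hn0]
      calc |∑ j, rowDev Q j * spinVec x j| ≤ ∑ j, |rowDev Q j * spinVec x j| :=
            Finset.abs_sum_le_sum_abs _ _
        _ ≤ ∑ _j : Fin n, e := by
            refine Finset.sum_le_sum fun j _ => ?_
            rw [abs_mul, spinVec, abs_spin, mul_one]; exact he j
        _ = e * n := by simp [mul_comm]
    rw [← sq_abs]; exact pow_le_pow_left₀ (abs_nonneg _) h1 2
  have h1 : ∀ i, (localField Q x i - t) ^ 2 ≤ 4 * ((centredCoupling Q *ᵥ spinVec x) i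
      * (centredCoupling Q *ᵥ spinVec x) i) + 4 * ((meanSpin x - t) ^ 2 + 2 * e ^ 2) := by
    intro i
    have e1 : localField Q x i - t = (centredCoupling Q *ᵥ spinVec x) i + (meanSpin x - t)
        + meanSpin x * rowDev Q i + b := by
      rw [sum_mulVec_centred, hb]
      simp only [spinVec, localField, meanSpin]
      ring
    have e2 : (meanSpin x * rowDev Q i) ^ 2 ≤ e ^ 2 := by
      rw [mul_pow]
      exact (mul_le_of_le_one_left (sq_nonneg _) hm1).trans (he2 i)
    rw [e1]
    generalize (centredCoupling Q *ᵥ spinVec x) i = p at *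
    generalize meanSpin x * rowDev Q i = s at *
    generalize meanSpin x - t = u at *
    nlinarith [sq_nonneg (p - u), sq_nonneg (p - s), sq_nonneg (p - b), sq_nonneg (u - s),
      sq_nonneg (u - b), sq_nonneg (s - b)]
  refine (Finset.sum_le_sum fun i _ => h1 i).trans (le_of_eq ?_)
  rw [Finset.sum_add_distrib, ← Finset.mul_sum, fluctuation, abs_of_nonneg hx, dotProduct]
  simp
  ring

/-- One more use of the mean-field equation converts an ℓ² bound into a uniform one: Cauchy-Schwarz
against a row of squared norm at most 2q. -/
theorem abs_localField_sub_le_sqrt (hn : 0 < n) {β t e q r : ℝ} (hβ : 0 ≤ β)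
    {Q : Matrix (Fin n) (Fin n) ℝ} (hQ : IsFerromagnetic Q q) (hq : 0 ≤ q) (ht : |t| ≤ 1)
    (hfix : t = Real.tanh (β * t)) (he : ∀ i, |rowDev Q i| ≤ e) {x : Spins (Fin n)}
    (hx : x ∈ nearMeanField β Q r) (hx0 : 0 ≤ meanSpin x) (i : Fin n) :
    |localField Q x i - t| ≤ r + e
      + β * Real.sqrt (8 * q * (fluctuation t Q x + 2 * (n * e ^ 2))) := by
  refine (abs_localField_sub_le hQ ht he hx i).trans ?_
  have h1 : ∑ j, Q i j * |Real.tanh (β * localField Q x j) - t|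
      ≤ β * ∑ j, Q i j * |localField Q x j - t| := by
    rw [Finset.mul_sum]
    refine Finset.sum_le_sum fun j _ => ?_
    have h2 : |Real.tanh (β * localField Q x j) - t| ≤ β * |localField Q x j - t| := by
      have := abs_tanh_sub_le (β * localField Q x j) (β * t)
      rwa [← hfix, ← mul_sub, abs_mul, abs_of_nonneg hβ] at this
    calc _ ≤ Q i j * (β * |localField Q x j - t|) :=
          mul_le_mul_of_nonneg_left h2 (hQ.nonneg i j)
      _ = _ := by ring
  have h2 : ∑ j, Q i j * |localField Q x j - t|
      ≤ Real.sqrt (8 * q * (fluctuation t Q x + 2 * (n * e ^ 2))) := by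
    refine Real.le_sqrt_of_sq_le ?_
    refine (Finset.sum_mul_sq_le_sq_mul_sq _ _ _).trans ?_
    simp_rw [sq_abs]
    have h3 : ∑ j, Q i j ^ 2 ≤ 2 * q := by
      calc ∑ j, Q i j ^ 2 ≤ ∑ j, q * Q i j := Finset.sum_le_sum fun j _ => by
            rw [sq]; exact mul_le_mul_of_nonneg_right (hQ.le i j) (hQ.nonneg i j)
        _ = q * ∑ j, Q i j := by rw [Finset.mul_sum]
        _ ≤ q * 2 := mul_le_mul_of_nonneg_left (hQ.row i) hq
        _ = _ := by ring
    have h4 := sum_sq_localField_sub_le hn (t := t) he hx0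
    have h5 : 0 ≤ ∑ j, (localField Q x j - t) ^ 2 := Finset.sum_nonneg fun _ _ => sq_nonneg _
    refine (mul_le_mul h3 h4 h5 (by positivity)).trans (le_of_eq ?_)
    ring
  have := mul_le_mul_of_nonneg_left h2 hβ
  linarith

/-- If `R` is small as a quadratic form and the fluctuations are small, then no vertex has a local
field far from `t`: such vertices would span an unusually dense subgraph. -/
theorem abs_localField_sub_le_of_quad (hn : 0 < n) {β t κ η e q r θ : ℝ} (hκ : 0 ≤ κ)
    (hκ1 : κ < 1) (hη : 0 < η) {Q : Matrix (Fin n) (Fin n) ℝ}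
    (hQ : IsFerromagnetic Q q) (ht : |t| ≤ 1)
    (hcon : ∀ m, |m - t| ≤ η → |Real.tanh (β * m) - t| ≤ κ * |m - t|)
    (he : ∀ i, |rowDev Q i| ≤ e) (he1 : e ≤ (1 - κ) / 4)
    (hre : r + e ≤ (1 - κ) * η / 4)
    (hR : ∀ v, v ⬝ᵥ (centredCoupling Q *ᵥ v) ≤ θ * (v ⬝ᵥ v))
    (hθ : θ ≤ (1 - κ) * η / 12)
    {x : Spins (Fin n)} (hx : x ∈ nearMeanField β Q r) (hx0 : 0 ≤ meanSpin x)
    (hY : 4 * (fluctuation t Q x + 2 * (n * e ^ 2)) ≤ η ^ 2 * ((1 - κ) * η / 48) * n)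
    (i : Fin n) :
    |localField Q x i - t| ≤ η := by
  have hn0 : (0 : ℝ) < n := by exact_mod_cast hn
  obtain ⟨B, hB⟩ : ∃ B : Finset (Fin n),
      B = Finset.univ.filter fun i => η < |localField Q x i - t| := ⟨_, rfl⟩
  have hmem : ∀ i, i ∈ B ↔ η < |localField Q x i - t| := by simp [hB]
  by_contra hi
  have hiB : i ∈ B := (hmem i).2 (not_le.1 hi)
  obtain ⟨b, hb⟩ : ∃ b : ℝ, b = B.card := ⟨_, rfl⟩
  have hb0 : 0 < b := by
    rw [hb]; exact_mod_cast Finset.card_pos.2 ⟨i, hiB⟩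
  obtain ⟨c, hc⟩ : ∃ c, c = (1 - κ) * η / 4 := ⟨_, rfl⟩
  have hκ0 : 0 < 1 - κ := by linarith
  have hc0 : 0 < c := by rw [hc]; positivity
  -- Chebyshev: the ℓ² bound leaves only a small proportion of bad vertices.
  have hbn : b ≤ c / 12 * n := by
    have h1 : b * η ^ 2 ≤ ∑ i, (localField Q x i - t) ^ 2 := by
      calc b * η ^ 2 = ∑ i ∈ B, η ^ 2 := by simp [hb]
        _ ≤ ∑ i ∈ B, (localField Q x i - t) ^ 2 := by
            refine Finset.sum_le_sum fun j hj => ?_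
            rw [← sq_abs (localField Q x j - t)]
            exact pow_le_pow_left₀ hη.le ((hmem j).1 hj).le 2
        _ ≤ _ := Finset.sum_le_sum_of_subset_of_nonneg (Finset.subset_univ _)
            fun _ _ _ => sq_nonneg _
    have h2 := h1.trans ((sum_sq_localField_sub_le hn he hx0).trans hY)
    have h3 : η ^ 2 * b ≤ η ^ 2 * (c / 12 * n) := by
      rw [hc]
      refine (le_of_eq (mul_comm _ _)).trans (h2.trans (le_of_eq ?_))
      ring
    exact le_of_mul_le_mul_left h3 (by positivity)
  obtain ⟨v, hv⟩ : ∃ v : Fin n → ℝ, v = fun i => if i ∈ B then 1 else 0 := ⟨_, rfl⟩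
  have hvB : ∀ f : Fin n → ℝ, ∑ i, f i * v i = ∑ i ∈ B, f i := by
    intro f
    rw [hv]
    simp
  have hvv : v ⬝ᵥ v = b := by
    rw [dotProduct, hvB, hv, hb]
    simp
  have hsv : ∑ j, v j = b := by
    have := hvB fun _ => 1
    simp only [one_mul] at this
    rw [this, hb]; simp
  -- Good neighbours alone would contract the deviation below η, so a bad vertex must receive weight
  -- at least c from B.
  have hlow : ∀ i ∈ B, c ≤ ∑ j, Q i j * v j := by
    intro i hi
    have h1 := abs_localField_sub_le hQ ht he hx i
    have h2 := (hmem i).1 hi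
    have h3 : ∑ j, Q i j * |Real.tanh (β * localField Q x j) - t|
        ≤ ∑ j, (Q i j * (κ * η) + 2 * (Q i j * v j)) := by
      refine Finset.sum_le_sum fun j _ => ?_
      have hq := hQ.nonneg i j
      rw [hv]
      by_cases hj : j ∈ B
      · have h4 : |Real.tanh (β * localField Q x j) - t| ≤ 2 := by
          have a1 := abs_sub (Real.tanh (β * localField Q x j)) t
          have a2 := Real.abs_tanh_lt_one (β * localField Q x j)
          linarith
        simp only [if_pos hj, mul_one]
        have h5 := mul_le_mul_of_nonneg_left h4 hq
        have h6 : 0 ≤ Q i j * (κ * η) := by positivity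
        linarith
      · have h4 : |localField Q x j - t| ≤ η := not_lt.1 fun h => hj ((hmem j).2 h)
        simp only [if_neg hj, mul_zero, add_zero]
        refine mul_le_mul_of_nonneg_left ((hcon _ h4).trans ?_) hq
        exact mul_le_mul_of_nonneg_left h4 hκ
    rw [Finset.sum_add_distrib, ← Finset.sum_mul, ← Finset.mul_sum] at h3
    have h5 : (∑ j, Q i j) * (κ * η) ≤ κ * η + c := by
      have e1 : ∑ j, Q i j = 1 + rowDev Q i := by rw [rowDev]; ring
      have e2 : rowDev Q i * (κ * η) ≤ (1 - κ) / 4 * η := by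
        have := (abs_le.1 (he i)).2
        have hκη : κ * η ≤ η := mul_le_of_le_one_left hη.le hκ1.le
        calc rowDev Q i * (κ * η) ≤ (1 - κ) / 4 * (κ * η) := by
              refine mul_le_mul_of_nonneg_right (this.trans he1) (by positivity)
          _ ≤ _ := by gcongr
      rw [e1, hc]; linarith
    rw [← hc] at hre
    have h6 : η - κ * η = 4 * c := by rw [hc]; ring
    linarith
  -- Expander-mixing bound: test the quadratic form of R on the indicator of B.
  have hup : ∑ i ∈ B, ∑ j, Q i j * v j ≤ θ * b + 3 * b ^ 2 / n := by
    have h1 := hR v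
    rw [hvv, dotProduct_comm, dotProduct, hvB] at h1
    simp_rw [sum_mulVec_centred] at h1
    rw [Finset.sum_sub_distrib, Finset.sum_sub_distrib, hsv, hvB] at h1
    have hκ4 : e ≤ 1 := by linarith
    have a1 : ∑ i ∈ B, b / n * (1 + rowDev Q i) ≤ 2 * b ^ 2 / n := by
      calc _ ≤ ∑ i ∈ B, b / n * 2 := by
            refine Finset.sum_le_sum fun j _ => ?_
            have := (abs_le.1 (he j)).2
            gcongr
            linarith
        _ = _ := by
            rw [Finset.sum_const, nsmul_eq_mul, ← hb]; ring
    have a2 : ∑ _i ∈ B, (∑ j ∈ B, rowDev Q j) / n ≤ b ^ 2 / n := by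
      rw [Finset.sum_const, nsmul_eq_mul, ← hb, sq, mul_div_assoc]
      have : ∑ j ∈ B, rowDev Q j ≤ b := by
        calc _ ≤ ∑ j ∈ B, (1 : ℝ) :=
              Finset.sum_le_sum fun j _ => ((abs_le.1 (he j)).2).trans hκ4
          _ = b := by simp [hb]
      gcongr
    have a3 : 3 * b ^ 2 / (n : ℝ) = 2 * b ^ 2 / n + b ^ 2 / n := by ring
    linarith
  have hlow' : c * b ≤ ∑ i ∈ B, ∑ j, Q i j * v j := by
    calc c * b = ∑ i ∈ B, c := by rw [Finset.sum_const, nsmul_eq_mul, ← hb, mul_comm]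
      _ ≤ _ := Finset.sum_le_sum hlow
  -- Contradiction: cb is at most cb/3 + cb/4.
  have h1 : 3 * b ^ 2 / n ≤ c / 4 * b := by
    rw [div_le_iff₀ hn0]
    nlinarith
  have h2 : θ * b ≤ c / 3 * b := by
    refine mul_le_mul_of_nonneg_right ?_ hb0.le
    rw [hc]; linarith
  have : 0 < c * b := by positivity
  linarith

end Ising

namespace Ising

open Matrix

variable {n : ℕ}

/-! ### Low temperature -/

/-- Without a field the law is invariant under x ↦ -x, and one of x, -x has nonnegative mean. -/
theorem isingZ_le_two_mul_mass_nonnegMean (β : ℝ) (Q : Matrix (Fin n) (Fin n) ℝ) :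
    isingZ β Q 0 ≤ 2 * mass β Q (nonnegMeanEvent n) := by
  have hsum : ∀ x : Spins (Fin n), ∑ i, spin ((-x) i) = -∑ i, spin (x i) := by
    intro x
    rw [← Finset.sum_neg_distrib]
    exact Finset.sum_congr rfl fun i _ => by rw [Pi.neg_apply, spin_neg]
  have hw : ∀ x, isingWeight β Q 0 (-x) = isingWeight β Q 0 x := by
    intro x
    rw [isingWeight_zero, isingWeight_zero]
    congr 2
    unfold energy
    refine Finset.sum_congr rfl fun i _ => Finset.sum_congr rfl fun j _ => ?_
    rw [Pi.neg_apply, Pi.neg_apply, spin_neg, spin_neg]; ring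
  have hneg : mass β Q {x | -x ∈ nonnegMeanEvent n} = mass β Q (nonnegMeanEvent n) := by
    unfold mass
    rw [← Equiv.sum_comp (Equiv.neg (Spins (Fin n)))]
    refine Finset.sum_congr rfl fun x _ => ?_
    by_cases h : x ∈ nonnegMeanEvent n
    · rw [Set.indicator_of_mem (by simpa using h), Set.indicator_of_mem h]
      exact hw x
    · rw [Set.indicator_of_notMem (by simpa using h), Set.indicator_of_notMem h]
  have hcover : (Set.univ : Set (Spins (Fin n)))
      ⊆ nonnegMeanEvent n ∪ {x | -x ∈ nonnegMeanEvent n} := by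
    intro x _
    simp only [Set.mem_union, Set.mem_ofPred_eq, nonnegMeanEvent, hsum, neg_div]
    rcases le_total 0 ((∑ i, spin (x i)) / (n : ℝ)) with h | h
    · exact Or.inl h
    · exact Or.inr (by linarith)
  rw [← mass_univ]
  refine (mass_mono β Q hcover).trans ((mass_union_le β Q _ _).trans ?_)
  rw [hneg]; linarith

theorem sum_spin_setOn_ge (S : Finset (Fin n)) (b : Spins S) (x : Spins (Fin n)) :
    ∑ i, spin (x i) - 2 * S.card ≤ ∑ i, spin (setOn S b x i) := by
  have h : ∑ i, (spin (x i) - spin (setOn S b x i)) ≤ 2 * S.card := by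
    calc _ ≤ ∑ i, (if i ∈ S then (2 : ℝ) else 0) := by
          refine Finset.sum_le_sum fun i _ => ?_
          split_ifs with hi
          · have h1 := (abs_le.1 (abs_spin (x i)).le).2
            have h2 := (abs_le.1 (abs_spin (setOn S b x i)).le).1
            linarith
          · rw [setOn_of_notMem b x hi, sub_self]
      _ = _ := by simp [mul_comm]
  rw [Finset.sum_sub_distrib] at h
  linarith

/-- The fluctuations are small with overwhelming probability. -/
theorem exists_mass_fluctuation_le {β t δ : ℝ} (hβ : 0 < β) (ht : 0 < t)
    (hfix : t = Real.tanh (β * t)) (hδ : 0 < δ) (hδ1 : δ ≤ 1) :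
    ∃ η > 0, ∃ C ≥ 0, ∀ n : ℕ, 0 < n → ∀ G : SimpleGraph (Fin n), 0 < avgDegree G →
      degreeDeviation G ≤ 1 →
      (∀ v, v ⬝ᵥ (centredCoupling (coupling G) *ᵥ v) ≤ (1 - δ) * (v ⬝ᵥ v)) → ∀ τ : ℝ,
      mass β (coupling G) {x | τ ≤ fluctuation t (coupling G) x}
        ≤ (2 * n + 1) * Real.exp (C * (1 + n / avgDegree G + n * degreeDeviation G ^ 2) - η * τ)
          * isingZ β (coupling G) 0 := by
  obtain ⟨η, hη, C, hC, h⟩ := exists_exponential_moment hβ ht hfix hδ hδ1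
  -- 19 = 18 + 1, the constant of the Frobenius bound plus that of the exponential moment.
  refine ⟨η, hη, 19 * C, by positivity, fun n hn G hd hdev hR τ => ?_⟩
  have hF := isFerromagnetic_coupling hdev
  have hδ0 := sum_rowDev_coupling hd
  have hδle : ∀ i, |rowDev (coupling G) i| ≤ 1 := fun i => (abs_rowDev_coupling_le G i).trans hdev
  have hmom := h n hn (coupling G) hF.symm hF.diag hδ0 hδle hR
    (centredCoupling_norm_le_nine hn hF hδ0)
  have hlow := exp_freeEnergy_le_isingZ hfix hF.symm hF.diag hδ0
  have hFr := hF.sum_sq_centredCoupling_le hn hδ0 hδle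
  have hdl := sum_sq_rowDev_coupling_le G
  have hset : {x | τ ≤ fluctuation t (coupling G) x}
      = {x | η * τ ≤ η * fluctuation t (coupling G) x} := by
    ext x
    exact (mul_le_mul_iff_right₀ hη).symm
  rw [hset]
  refine (mass_le_of_exp β (coupling G) _ _).trans ?_
  simp_rw [isingWeight_zero, ← Real.exp_add]
  refine (mul_le_mul_of_nonneg_left hmom (Real.exp_pos _).le).trans ?_
  have hn0 : (0 : ℝ) < n := by exact_mod_cast hn
  have hnd : 0 ≤ n / avgDegree G := by positivity
  have hnd2 : 0 ≤ n * degreeDeviation G ^ 2 := by positivity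
  have hE : C * (1 + ∑ i, ∑ j, centredCoupling (coupling G) i j ^ 2
      + ∑ i, rowDev (coupling G) i ^ 2)
      ≤ 19 * C * (1 + n / avgDegree G + n * degreeDeviation G ^ 2) := by
    rw [mul_comm 19 C, mul_assoc]
    refine mul_le_mul_of_nonneg_left ?_ hC
    rw [← div_eq_mul_inv] at hFr
    linarith
  calc _ ≤ Real.exp (-(η * τ)) * ((2 * n + 1) * (Real.exp (n * freeEnergy β t)
          * Real.exp (19 * C * (1 + n / avgDegree G + n * degreeDeviation G ^ 2)))) := by
        rw [← Real.exp_add]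
        gcongr
    _ = (2 * n + 1) * (Real.exp (19 * C * (1 + n / avgDegree G + n * degreeDeviation G ^ 2)
          - η * τ)) * Real.exp (n * freeEnergy β t) := by
        rw [sub_eq_add_neg, Real.exp_add]; ring
    _ ≤ _ := mul_le_mul_of_nonneg_left hlow (by positivity)

/-- H supplies a coarse bound that brings all fields into the basin of contraction; the contraction
sharpens it to ε/log n. The threshold τ must dominate n/d̄ + n·dev² + log n, so that exceeding it
has probability n^{-K}, yet stay below n(t/2)², so that x̄ ≥ t/2 and resetting O(log n) spins keeps
the mean nonnegative. -/
theorem tendsto_tiltedError (G : ∀ n : ℕ, SimpleGraph (Fin n))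
    (hreg : Tendsto (fun n => degreeDeviation (G n)) atTop (𝓝 0))
    {c : ℝ} (hc : 0 < c) {s : ℕ → ℕ} (hs : ∀ᶠ n : ℕ in atTop, (s n : ℝ) ≤ c * Real.log n)
    {β t : ℝ} (hβ : 1 < β) (ht : 0 < t) (hfix : t = Real.tanh (β * t))
    (hO : (fun n => degreeDeviation (G n)) =O[atTop] (fun n => alphaRate (G n)))
    (hd : (fun n : ℕ => Real.log n ^ 4) =o[atTop] (fun n => avgDegree (G n)))
    {δ : ℝ} (hδ : 0 < δ) (hδ1 : δ ≤ 1)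
    (hR : ∀ᶠ n : ℕ in atTop, ∀ v,
      v ⬝ᵥ (centredCoupling (coupling (G n)) *ᵥ v) ≤ (1 - δ) * (v ⬝ᵥ v))
    (H : ∀ κ η : ℝ, 0 ≤ κ → κ < 1 → 0 < η →
      (∀ m, |m - t| ≤ η → |Real.tanh (β * m) - t| ≤ κ * |m - t|) →
      ∃ τ : ℕ → ℝ, ∃ r > 0,
        (∀ C > 0, ∀ᶠ n : ℕ in atTop, C * (1 + n / avgDegree (G n)
          + n * degreeDeviation (G n) ^ 2 + Real.log n) ≤ τ n) ∧
        (∀ᶠ n : ℕ in atTop, τ n ≤ n * (t / 2) ^ 2) ∧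
        ∀ᶠ n : ℕ in atTop, ∀ x ∈ nearMeanField β (coupling (G n)) r, 0 ≤ meanSpin x →
          fluctuation t (coupling (G n)) x < τ n →
          ∀ i, |localField (coupling (G n)) x i - t| ≤ η) :
    Tendsto (fun n => tiltedError β t (G n) (s n)) atTop (𝓝 0) := by
  have hβ0 : 0 < β := one_pos.trans hβ
  have ht1 : |t| ≤ 1 := by
    rw [hfix]; exact (Real.abs_tanh_lt_one _).le
  have hlog : Tendsto (fun n : ℕ => Real.log n) atTop atTop :=
    Real.tendsto_log_atTop.comp tendsto_natCast_atTop_atTop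
  change Tendsto (fun n => condError β t (coupling (G n)) (nonnegMeanEvent n) (s n)) atTop (𝓝 0)
  refine tendsto_condError G hreg hc hs hβ0.le ht.le
    ((isBigO_log_pow (by norm_num)).trans_isLittleO hd) _ fun ε hε K hK => ?_
  obtain ⟨κ, η, hκ, hκ1, hη, hcon⟩ := exists_contraction hβ0 ht hfix
  obtain ⟨τ, r, hr, hτ, hτn, hloc⟩ := H κ η hκ hκ1 hη hcon
  obtain ⟨η', hη', C, hC, hfl⟩ := exists_mass_fluctuation_le hβ0 ht hfix hδ hδ1
  have hκ0 : 0 < 1 - κ := by linarith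
  have hdl := alphaRate_pow_tendsto G (k := 1) (by norm_num) hO hd
  -- Residual and degree error are both at most a/log n, and 2(2a)/(1 - κ) = ε.
  obtain ⟨a, ha⟩ : ∃ a, a = ε * (1 - κ) / 4 := ⟨_, rfl⟩
  have ha0 : 0 < a := by rw [ha]; positivity
  have hsn : Tendsto (fun n : ℕ => Real.log n / n) atTop (𝓝 0) :=
    (Real.isLittleO_log_id_atTop.comp_tendsto tendsto_natCast_atTop_atTop).tendsto_div_nhds_zero
  filter_upwards [hs, hR, hloc, hτn, hτ ((C + K + 4 + 1) / η') (by positivity),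
    hdl.eventually (eventually_le_nhds ha0),
    hreg.eventually (eventually_le_nhds (half_pos hκ0)),
    hreg.eventually (eventually_le_nhds one_pos), hlog.eventually_ge_atTop 1,
    hlog.eventually_ge_atTop (a / r),
    hsn.eventually (eventually_le_nhds (show 0 < t / (4 * c) by positivity)),
    eventually_ge_atTop 3, hd.bound one_pos,
    eventually_mass_nearMeanField G hreg hβ0.le (k := 1) (by norm_num) hd ha0
      (show 0 < K + 2 by positivity)]
    with n hs hR hloc hτn hτ hdl hdev2 hdev hl hl2 hsn hn hd hnear
  have hn0 : 0 < n := by omega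
  have hnr : (3 : ℝ) ≤ n := by exact_mod_cast hn
  have hd0 : 0 < avgDegree (G n) := by
    rcases (avgDegree_nonneg (G n)).lt_or_eq with h | h
    · exact h
    · rw [← h, norm_zero, mul_zero, Real.norm_of_nonneg (by positivity)] at hd
      have : (0 : ℝ) < Real.log n ^ 4 := by positivity
      linarith
  have hZ := isingZ_pos β (coupling (G n)) 0
  have hA := isingZ_le_two_mul_mass_nonnegMean β (coupling (G n))
  have hfl := hfl n hn0 (G n) hd0 hdev hR (τ n)
  have hF := isFerromagnetic_coupling hdev
  rw [pow_one] at hdl hnear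
  have hnexp : (n : ℝ) = Real.exp (Real.log n) := (Real.exp_log (by linarith)).symm
  generalize Real.log (n : ℝ) = L at *
  have hr' : a / L ≤ r := by
    rw [div_le_iff₀ (by linarith)]
    rw [div_le_iff₀ hr] at hl2
    linarith
  have hmean : ∀ x : Spins (Fin n), x ∈ nonnegMeanEvent n → 0 ≤ meanSpin x := fun x hx => hx
  refine ⟨by linarith, nonnegMeanEvent n ∩ (nearMeanField β (coupling (G n)) (a / L)
    ∩ {x | fluctuation t (coupling (G n)) x < τ n}), Set.inter_subset_left, ?_, ?_, ?_⟩
  · rintro x ⟨hx0, hx1, hx2⟩ i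
    have hxr : x ∈ nearMeanField β (coupling (G n)) r := fun i => (hx1 i).trans_le hr'
    have h1 := hloc x hxr (hmean x hx0) hx2
    refine (abs_localField_sub_le_of_contraction hF ht1 hκ hκ1 hcon
      (abs_rowDev_coupling_le (G n)) hdev2 hx1 h1 i).trans ?_
    have h2 : degreeDeviation (G n) ≤ a / L := by
      rw [le_div_iff₀ (by linarith)]; exact hdl
    rw [div_le_iff₀ hκ0]
    have h3 : ε / L * (1 - κ) = 4 * (a / L) := by rw [ha]; ring
    rw [h3]; linarith
  · rintro x ⟨hx0, -, hx2⟩ S hS b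
    have h1 : t / 2 ≤ meanSpin x := by
      have h2 : (n : ℝ) * (|meanSpin x| - t) ^ 2 ≤ n * (t / 2) ^ 2 := by
        refine le_trans ?_ ((le_of_lt hx2).trans hτn)
        rw [fluctuation]
        exact le_add_of_nonneg_left (dotProduct_self_nonneg_real _)
      have h3 := abs_le.1 (abs_le_of_sq_le_sq (le_of_mul_le_mul_left h2 (by linarith))
        (by positivity))
      rw [abs_of_nonneg (hmean x hx0)] at h3
      linarith [h3.1, h3.2]
    have h2 := sum_spin_setOn_ge S b x
    rw [sum_spin_eq hn0, hS] at h2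
    refine div_nonneg (le_trans ?_ h2) (Nat.cast_nonneg _)
    rw [div_le_iff₀ (by linarith), div_mul_eq_mul_div, le_div_iff₀ (by positivity)] at hsn
    have h3 : (n : ℝ) * (t / 2) ≤ n * meanSpin x := by gcongr
    linarith
  · have hsub : nonnegMeanEvent n \ (nonnegMeanEvent n ∩ (nearMeanField β (coupling (G n)) (a / L)
        ∩ {x | fluctuation t (coupling (G n)) x < τ n}))
        ⊆ (nearMeanField β (coupling (G n)) (a / L))ᶜ
          ∪ {x | τ n ≤ fluctuation t (coupling (G n)) x} := by
      rintro x ⟨hx, hx'⟩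
      by_contra h
      rw [Set.mem_union, not_or] at h
      have h2 : fluctuation t (coupling (G n)) x < τ n := lt_of_not_ge h.2
      exact hx' ⟨hx, not_not.1 h.1, h2⟩
    refine (mass_mono _ _ hsub).trans ((mass_union_le _ _ _ _).trans ?_)
    have h1 : (2 * n + 1) * Real.exp (C * (1 + n / avgDegree (G n)
        + n * degreeDeviation (G n) ^ 2) - η' * τ n) ≤ Real.exp (-((K + 2) * L)) := by
      -- 2n + 1 ≤ n² holds from n = 3 on.
      have a1 : (2 * (n : ℝ) + 1) ≤ Real.exp (2 * L) := by
        rw [two_mul L, Real.exp_add, ← hnexp]; nlinarith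
      calc _ ≤ Real.exp (2 * L) * Real.exp (C * (1 + n / avgDegree (G n)
            + n * degreeDeviation (G n) ^ 2) - η' * τ n) := by gcongr
        _ = Real.exp (2 * L + (C * (1 + n / avgDegree (G n)
            + n * degreeDeviation (G n) ^ 2) - η' * τ n)) := (Real.exp_add _ _).symm
        _ ≤ _ := by
            refine Real.exp_le_exp.2 ?_
            rw [div_mul_eq_mul_div, div_le_iff₀ hη'] at hτ
            have p1 : 0 ≤ n / avgDegree (G n) := by positivity
            have p2 : 0 ≤ n * degreeDeviation (G n) ^ 2 := by positivity
            generalize n / avgDegree (G n) = u at *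
            generalize n * degreeDeviation (G n) ^ 2 = w at *
            have p3 : 0 ≤ (K + 5) * (1 + u + w) := by positivity
            have p4 : 0 ≤ (C + 1) * L := by positivity
            linarith
    -- The factor 4 counts two exceptional events and the loss of 2 in conditioning on a nonnegative
    -- mean; n² pays for it.
    have h2 : Real.exp (-((K + 2) * L)) * 4 ≤ Real.exp (-(K * L)) := by
      have e : -(K * L) = -((K + 2) * L) + (L + L) := by ring
      rw [e, Real.exp_add, Real.exp_add L L, ← hnexp]
      refine mul_le_mul_of_nonneg_left ?_ (Real.exp_pos _).le
      nlinarith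
    have h3 := mul_le_mul_of_nonneg_right h1 hZ.le
    have hm := mass_nonneg β (coupling (G n)) (nonnegMeanEvent n)
    have h4 := mul_le_mul_of_nonneg_right h2 hm
    have h5 := mul_le_mul_of_nonneg_left hA (Real.exp_pos (-((K + 2) * L))).le
    linarith

theorem tendsto_avgDegree {G : ∀ n : ℕ, SimpleGraph (Fin n)} {m : ℕ} (hm : m ≠ 0)
    (hd : (fun n : ℕ => Real.log n ^ m) =o[atTop] (fun n => avgDegree (G n))) :
    Tendsto (fun n => avgDegree (G n)) atTop atTop := by
  have hlog : Tendsto (fun n : ℕ => Real.log n ^ m) atTop atTop :=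
    (tendsto_pow_atTop hm).comp (Real.tendsto_log_atTop.comp tendsto_natCast_atTop_atTop)
  refine tendsto_atTop_mono' _ ?_ hlog
  filter_upwards [hd.bound one_pos, hlog.eventually_ge_atTop 0] with n h h0
  rwa [one_mul, Real.norm_of_nonneg h0, Real.norm_of_nonneg (avgDegree_nonneg _)] at h

/-- As the degree deviations tend to 0, the bound on the second eigenvalue passes to R with
arbitrarily small loss. -/
theorem eventually_quad_le {G : ∀ n : ℕ, SimpleGraph (Fin n)}
    (hreg : Tendsto (fun n => degreeDeviation (G n)) atTop (𝓝 0))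
    (hd : Tendsto (fun n => avgDegree (G n)) atTop atTop) {L θ : ℝ} (hL0 : 0 ≤ L) (hL : L < 1)
    (hev : ∀ᶠ n in atTop, couplingEigenvalue (G n) 2 ≤ L) (hθ : L < θ) :
    ∀ᶠ n : ℕ in atTop, ∀ v,
      v ⬝ᵥ (centredCoupling (coupling (G n)) *ᵥ v) ≤ θ * (v ⬝ᵥ v) := by
  obtain ⟨ε, hε⟩ : ∃ ε, ε = min ((θ - L) / 4) (1 / 2) := ⟨_, rfl⟩
  have hε0 : 0 < ε := by
    rw [hε]; exact lt_min (by linarith) (by norm_num)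
  have hε1 : ε ≤ 1 / 2 := hε ▸ min_le_right _ _
  have hε2 : ε ≤ (θ - L) / 4 := hε ▸ min_le_left _ _
  have hsq : Tendsto (fun n => degreeDeviation (G n) ^ 2) atTop (𝓝 0) := by
    simpa using hreg.pow 2
  have hL1 : 0 < 1 - L := by linarith
  filter_upwards [hev, hd.eventually_gt_atTop 0, eventually_gt_atTop 0,
    hreg.eventually (eventually_le_nhds one_pos),
    hsq.eventually (eventually_le_nhds (show 0 < ε * (1 - L) ^ 2 by positivity))]
    with n hev hd hn hdev hsq v
  have hF := isFerromagnetic_coupling hdev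
  obtain ⟨i₀, hi₀⟩ := exists_eigenvalue_eq_couplingEigenvalue hn (G n)
  obtain ⟨w, hw⟩ := exists_isEigenbasis (coupling_isHermitian (G n))
  refine (centredCoupling_quad_le hn hF (sum_rowDev_coupling hd) hw hL0 hL hε0.le hε1
    (i₀ := i₀) (fun k hk => ?_) ?_ v).trans ?_
  · obtain ⟨j, hj, hjk⟩ := hi₀ k hk
    rw [hjk]
    exact (couplingEigenvalue_le_second (G n) hj).trans hev
  · refine (sum_sq_rowDev_coupling_le (G n)).trans ?_
    rw [mul_comm]
    exact mul_le_mul_of_nonneg_right hsq (Nat.cast_nonneg _)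
  · exact mul_le_mul_of_nonneg_right (by linarith) (dotProduct_self_nonneg_real v)

/-- Take τ = ε d̄. Since d̄² ≫ n log n, the quantities n/d̄, n·dev² = O(n log n/d̄) and log n are
all o(d̄), while Cauchy-Schwarz bounds the field deviations by a multiple of √(τ/d̄) = √ε. -/
theorem tendsto_tiltedError_of_dense (G : ∀ n : ℕ, SimpleGraph (Fin n))
    (hreg : Tendsto (fun n => degreeDeviation (G n)) atTop (𝓝 0))
    {c : ℝ} (hc : 0 < c) {s : ℕ → ℕ} (hs : ∀ᶠ n : ℕ in atTop, (s n : ℝ) ≤ c * Real.log n)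
    {β t : ℝ} (hβ : 1 < β) (ht : 0 < t) (hfix : t = Real.tanh (β * t))
    (hO : (fun n => degreeDeviation (G n)) =O[atTop] (fun n => alphaRate (G n)))
    (hd : (fun n : ℕ => Real.log n ^ 4) =o[atTop] (fun n => avgDegree (G n)))
    (hdense : (fun n : ℕ => Real.sqrt (n * Real.log n)) =o[atTop] (fun n => avgDegree (G n)))
    (hgap : limsup (fun n => (couplingEigenvalue (G n) 2 : EReal)) atTop < 1) :
    Tendsto (fun n => tiltedError β t (G n) (s n)) atTop (𝓝 0) := by
  have hβ0 : 0 < β := one_pos.trans hβ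
  have ht1 : |t| ≤ 1 := by
    rw [hfix]; exact (Real.abs_tanh_lt_one _).le
  have hlog : Tendsto (fun n : ℕ => Real.log n) atTop atTop :=
    Real.tendsto_log_atTop.comp tendsto_natCast_atTop_atTop
  have hdtop := tendsto_avgDegree (by norm_num) hd
  obtain ⟨L, hL1, hL2⟩ := EReal.lt_iff_exists_real_btwn.1 hgap
  have hL2' : L < 1 := by exact_mod_cast hL2
  have hev : ∀ᶠ n in atTop, couplingEigenvalue (G n) 2 ≤ max L 0 := by
    filter_upwards [eventually_lt_of_limsup_lt hL1] with n hn
    exact (EReal.coe_lt_coe_iff.1 hn).le.trans (le_max_left _ _)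
  have hL : max L 0 < 1 := max_lt hL2' one_pos
  have hR := eventually_quad_le hreg hdtop (le_max_right L 0) hL hev
    (θ := 1 - (1 - max L 0) / 2) (by linarith)
  refine tendsto_tiltedError G hreg hc hs hβ ht hfix hO hd (by linarith)
    (by linarith [le_max_right L 0]) hR fun κ η hκ hκ1 hη _ => ?_
  have hsmall : ∀ a > 0, ∀ᶠ n : ℕ in atTop, n * Real.log n ≤ a * avgDegree (G n) ^ 2 := by
    intro a ha
    filter_upwards [hdense.bound (Real.sqrt_pos.2 ha)] with n hn
    have h0 : 0 ≤ n * Real.log n := mul_nonneg (Nat.cast_nonneg _) (Real.log_natCast_nonneg n)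
    rw [Real.norm_of_nonneg (Real.sqrt_nonneg _), Real.norm_of_nonneg (avgDegree_nonneg _)] at hn
    have h1 := pow_le_pow_left₀ (Real.sqrt_nonneg _) hn 2
    rwa [Real.sq_sqrt h0, mul_pow, Real.sq_sqrt ha.le] at h1
  have hnd : ∀ a > 0, ∀ᶠ n : ℕ in atTop, n / avgDegree (G n) ≤ a * avgDegree (G n) := by
    intro a ha
    filter_upwards [hsmall a ha, hlog.eventually_ge_atTop 1, hdtop.eventually_gt_atTop 0]
      with n hn hl hd
    rw [div_le_iff₀ hd]
    have : (n : ℝ) * 1 ≤ n * Real.log n := by gcongr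
    linarith
  obtain ⟨D, hD0, hD⟩ := hO.exists_pos
  have hdev : ∀ a > 0, ∀ᶠ n : ℕ in atTop,
      n * degreeDeviation (G n) ^ 2 ≤ a * avgDegree (G n) := by
    intro a ha
    filter_upwards [hsmall (a / D ^ 2) (by positivity), hD.bound, hdtop.eventually_gt_atTop 0]
      with n hn hD hd
    have hl : 0 ≤ Real.log n := Real.log_natCast_nonneg n
    rw [Real.norm_of_nonneg (degreeDeviation_nonneg _), alphaRate,
      Real.norm_of_nonneg (Real.sqrt_nonneg _)] at hD
    have h1 := pow_le_pow_left₀ (degreeDeviation_nonneg _) hD 2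
    rw [mul_pow, Real.sq_sqrt (by positivity)] at h1
    calc n * degreeDeviation (G n) ^ 2 ≤ n * (D ^ 2 * (Real.log n / avgDegree (G n))) := by gcongr
      _ = D ^ 2 * (n * Real.log n) / avgDegree (G n) := by ring
      _ ≤ D ^ 2 * (a / D ^ 2 * avgDegree (G n) ^ 2) / avgDegree (G n) := by gcongr
      _ = a * avgDegree (G n) := by field_simp
  have hlogd : ∀ a > 0, ∀ᶠ n : ℕ in atTop, Real.log n ≤ a * avgDegree (G n) := by
    intro a ha
    filter_upwards [hd.bound ha, hlog.eventually_ge_atTop 1] with n hn hl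
    rw [Real.norm_of_nonneg (by positivity), Real.norm_of_nonneg (avgDegree_nonneg _)] at hn
    refine le_trans ?_ hn
    exact le_self_pow₀ hl (by norm_num)
  -- The first bound keeps τ below n(t/2)², as d̄ ≤ n; the second makes the square-root term η/3,
  -- next to η/3 each for r and the degree error.
  obtain ⟨ε, hε⟩ : ∃ ε, ε = min ((t / 2) ^ 2) ((η / (12 * β)) ^ 2) := ⟨_, rfl⟩
  have hε0 : 0 < ε := by rw [hε]; positivity
  refine ⟨fun n => ε * avgDegree (G n), η / 3, by positivity, fun C hC => ?_, ?_, ?_⟩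
  · have ha : 0 < ε / (4 * C) := by positivity
    filter_upwards [hnd _ ha, hdev _ ha, hlogd _ ha, hlog.eventually_ge_atTop 1]
      with n h1 h2 h3 h4
    calc C * (1 + n / avgDegree (G n) + n * degreeDeviation (G n) ^ 2 + Real.log n)
        ≤ C * (4 * (ε / (4 * C) * avgDegree (G n))) := by
          refine mul_le_mul_of_nonneg_left ?_ hC.le
          linarith
      _ = ε * avgDegree (G n) := by field_simp
  · refine Eventually.of_forall fun n => ?_
    have h1 : ε ≤ (t / 2) ^ 2 := hε ▸ min_le_left _ _
    calc ε * avgDegree (G n) ≤ (t / 2) ^ 2 * n :=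
          mul_le_mul h1 (avgDegree_le _) (avgDegree_nonneg _) (sq_nonneg _)
      _ = _ := mul_comm _ _
  · filter_upwards [hdev (ε / 2) (by positivity), hdtop.eventually_gt_atTop 0,
      eventually_gt_atTop 0, hreg.eventually (eventually_le_nhds one_pos),
      hreg.eventually (eventually_le_nhds (show 0 < η / 3 by positivity))]
      with n h1 hd hn hdev hdev2 x hx hx0 hY i
    have hF := isFerromagnetic_coupling hdev
    refine (abs_localField_sub_le_sqrt hn hβ0.le hF (inv_nonneg.2 hd.le) ht1 hfix
      (abs_rowDev_coupling_le (G n)) hx hx0 i).trans ?_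
    have h2 : Real.sqrt (8 * (avgDegree (G n))⁻¹ * (fluctuation t (coupling (G n)) x
        + 2 * (n * degreeDeviation (G n) ^ 2))) ≤ η / (3 * β) := by
      refine Real.sqrt_le_iff.2 ⟨by positivity, ?_⟩
      calc _ ≤ 8 * (avgDegree (G n))⁻¹ * (2 * (ε * avgDegree (G n))) := by
            refine mul_le_mul_of_nonneg_left ?_ (by positivity)
            linarith
        _ = 16 * ε := by field_simp; norm_num
        _ ≤ 16 * (η / (12 * β)) ^ 2 := by
            have : ε ≤ (η / (12 * β)) ^ 2 := hε ▸ min_le_right _ _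
            linarith
        _ = (η / (3 * β)) ^ 2 := by field_simp; norm_num
    have h3 : β * Real.sqrt (8 * (avgDegree (G n))⁻¹ * (fluctuation t (coupling (G n)) x
        + 2 * (n * degreeDeviation (G n) ^ 2))) ≤ η / 3 := by
      refine (mul_le_mul_of_nonneg_left h2 hβ0.le).trans (le_of_eq ?_)
      field_simp
    linarith

/-- Take τ = ε n, which dominates n/d̄, n·dev² and log n. Cauchy-Schwarz is then too weak, but R is
arbitrarily small as a quadratic form, so bad vertices are excluded by the density argument. -/
theorem tendsto_tiltedError_of_spectral (G : ∀ n : ℕ, SimpleGraph (Fin n))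
    (hreg : Tendsto (fun n => degreeDeviation (G n)) atTop (𝓝 0))
    {c : ℝ} (hc : 0 < c) {s : ℕ → ℕ} (hs : ∀ᶠ n : ℕ in atTop, (s n : ℝ) ≤ c * Real.log n)
    {β t : ℝ} (hβ : 1 < β) (ht : 0 < t) (hfix : t = Real.tanh (β * t))
    (hO : (fun n => degreeDeviation (G n)) =O[atTop] (fun n => alphaRate (G n)))
    (hd : (fun n : ℕ => Real.log n ^ 4) =o[atTop] (fun n => avgDegree (G n)))
    (hev : Tendsto (fun n : ℕ => ⨆ k : Set.Icc 2 n, |couplingEigenvalue (G n) k|) atTop (𝓝 0)) :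
    Tendsto (fun n => tiltedError β t (G n) (s n)) atTop (𝓝 0) := by
  have ht1 : |t| ≤ 1 := by
    rw [hfix]; exact (Real.abs_tanh_lt_one _).le
  have hlog : Tendsto (fun n : ℕ => Real.log n) atTop atTop :=
    Real.tendsto_log_atTop.comp tendsto_natCast_atTop_atTop
  have hdtop := tendsto_avgDegree (by norm_num) hd
  have hev' : ∀ a > 0, ∀ᶠ n in atTop, couplingEigenvalue (G n) 2 ≤ a := by
    intro a ha
    filter_upwards [hev.eventually (eventually_le_nhds ha), eventually_ge_atTop 2] with n h hn
    refine (le_abs_self _).trans (le_trans ?_ h)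
    exact le_ciSup (f := fun k : Set.Icc 2 n => |couplingEigenvalue (G n) k|)
      (Set.finite_range _).bddAbove ⟨2, le_rfl, hn⟩
  have hquad : ∀ θ > 0, ∀ᶠ n : ℕ in atTop, ∀ v,
      v ⬝ᵥ (centredCoupling (coupling (G n)) *ᵥ v) ≤ θ * (v ⬝ᵥ v) := by
    intro θ hθ
    have h0 : 0 < min (θ / 2) (1 / 2) := by positivity
    exact eventually_quad_le hreg hdtop h0.le ((min_le_right _ _).trans_lt (by norm_num))
      (hev' _ h0) ((min_le_left _ _).trans_lt (by linarith))
  refine tendsto_tiltedError G hreg hc hs hβ ht hfix hO hd (δ := 1 / 2) (by norm_num)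
    (by norm_num) (hquad _ (by norm_num)) fun κ η hκ hκ1 hη hcon => ?_
  have hκ0 : 0 < 1 - κ := by linarith
  have hsq : Tendsto (fun n => degreeDeviation (G n) ^ 2) atTop (𝓝 0) := by
    simpa using hreg.pow 2
  have hlogn : Tendsto (fun n : ℕ => Real.log n / n) atTop (𝓝 0) :=
    (Real.isLittleO_log_id_atTop.comp_tendsto tendsto_natCast_atTop_atTop).tendsto_div_nhds_zero
  obtain ⟨ε, hε⟩ : ∃ ε, ε = min ((t / 2) ^ 2) (η ^ 2 * ((1 - κ) * η / 48) / 8) := ⟨_, rfl⟩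
  have hε0 : 0 < ε := by rw [hε]; positivity
  refine ⟨fun n => ε * n, (1 - κ) * η / 8, by positivity, fun C hC => ?_, ?_, ?_⟩
  · have ha : 0 < ε / (4 * C) := by positivity
    filter_upwards [hdtop.eventually_ge_atTop (ε / (4 * C))⁻¹,
      hsq.eventually (eventually_le_nhds ha), hlogn.eventually (eventually_le_nhds ha),
      hlog.eventually_ge_atTop 1, eventually_gt_atTop 0] with n h1 h2 h3 h4 hn
    have hn0 : (0 : ℝ) < n := by exact_mod_cast hn
    rw [div_le_iff₀ hn0] at h3
    have h5 : n / avgDegree (G n) ≤ ε / (4 * C) * n := by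
      rw [div_eq_inv_mul]
      refine mul_le_mul_of_nonneg_right ?_ hn0.le
      exact inv_le_of_inv_le₀ ha h1
    have h6 : n * degreeDeviation (G n) ^ 2 ≤ ε / (4 * C) * n := by
      rw [mul_comm]; gcongr
    calc C * (1 + n / avgDegree (G n) + n * degreeDeviation (G n) ^ 2 + Real.log n)
        ≤ C * (4 * (ε / (4 * C) * n)) := by
          refine mul_le_mul_of_nonneg_left ?_ hC.le
          linarith
      _ = ε * n := by field_simp
  · refine Eventually.of_forall fun n => ?_
    have h1 : ε ≤ (t / 2) ^ 2 := hε ▸ min_le_left _ _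
    exact (mul_le_mul_of_nonneg_right h1 (Nat.cast_nonneg n)).trans_eq (mul_comm _ _)
  · filter_upwards [hsq.eventually (eventually_le_nhds (half_pos hε0)), eventually_gt_atTop 0,
      hreg.eventually (eventually_le_nhds one_pos),
      hreg.eventually (eventually_le_nhds (show 0 < (1 - κ) / 4 by positivity)),
      hreg.eventually (eventually_le_nhds (show 0 < (1 - κ) * η / 8 by positivity)),
      hquad ((1 - κ) * η / 12) (by positivity)]
      with n h1 hn hdev hdev2 hdev3 hR x hx hx0 hY i
    have hn0 : (0 : ℝ) < n := by exact_mod_cast hn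
    have hF := isFerromagnetic_coupling hdev
    refine abs_localField_sub_le_of_quad hn hκ hκ1 hη hF ht1 hcon
      (abs_rowDev_coupling_le (G n)) hdev2 (by linarith) hR le_rfl hx hx0 ?_ i
    have h2 : ε ≤ η ^ 2 * ((1 - κ) * η / 48) / 8 := hε ▸ min_le_right _ _
    have h3 := mul_le_mul_of_nonneg_left h1 hn0.le
    have h4 := mul_le_mul_of_nonneg_right h2 hn0.le
    linarith

end Ising

theorem lemma6 (G : ∀ n : ℕ, SimpleGraph (Fin n))
    (hreg : Tendsto (fun n => degreeDeviation (G n)) atTop (𝓝 0))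
    (c : ℝ) (hc : 0 < c) (s : ℕ → ℕ) (hs : ∀ᶠ n : ℕ in atTop, (s n : ℝ) ≤ c * Real.log n)
    (β : ℝ) :
    -- high temperature
    (0 ≤ β → β < 1 →
      (fun n : ℕ => Real.log n ^ 4) =o[atTop] (fun n => avgDegree (G n)) →
      Tendsto (fun n => uniformError β (G n) (s n)) atTop (𝓝 0)) ∧
    -- criticality
    (β = 1 →
      (fun n => degreeDeviation (G n)) =O[atTop] (fun n => alphaRate (G n)) →
      (fun n : ℕ => Real.log n ^ 10) =o[atTop] (fun n => avgDegree (G n)) →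
      Tendsto (fun n => uniformError β (G n) (s n)) atTop (𝓝 0)) ∧
    -- low temperature
    (1 < β →
      (fun n => degreeDeviation (G n)) =O[atTop] (fun n => alphaRate (G n)) →
      (((fun n : ℕ => Real.sqrt (n * Real.log n)) =o[atTop] (fun n => avgDegree (G n)) ∧
          limsup (fun n => (couplingEigenvalue (G n) 2 : EReal)) atTop < 1) ∨
        ((∃ γ : ℝ, 0 < γ ∧ ∀ᶠ n : ℕ in atTop, (n : ℝ) ^ γ ≤ avgDegree (G n)) ∧
          Tendsto (fun n : ℕ => ⨆ k : Set.Icc 2 n, |couplingEigenvalue (G n) k|) atTop (𝓝 0))) →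
      (fun n : ℕ => Real.log n ^ 4) =o[atTop] (fun n => avgDegree (G n)) →
      ∀ t : ℝ, 0 < t → t = Real.tanh (β * t) →
        Tendsto (fun n => tiltedError β t (G n) (s n)) atTop (𝓝 0)) := by
  refine ⟨fun hβ hβ1 hd => Ising.tendsto_uniformError_of_lt_one G hreg hc hs hβ hβ1 hd, ?_, ?_⟩
  · rintro rfl hO hd
    exact Ising.tendsto_uniformError_of_eq_one G hreg hc hs hO hd
  · rintro hβ hO (⟨hdense, hgap⟩ | ⟨-, hev⟩) hd t ht hfix
    · exact Ising.tendsto_tiltedError_of_dense G hreg hc hs hβ ht hfix hO hd hdense hgap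
    · exact Ising.tendsto_tiltedError_of_spectral G hreg hc hs hβ ht hfix hO hd hev
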